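/- **Theorem 5.1.** For integers $n,k\ge 1$ let $G(n,k)$ be the generalized Petersen graph: the cubic multigraph with vertices $v_i,w_i$ and edges $v_iv_{i+1}$, $w_iw_{i+k}$, $v_iw_i$ $(0\le i<n)$, indices modulo $n$, in which the $3n$ listed edges are regarded as distinct edges (so loops and parallel edges may occur). Let $h_k(n)$ be the number of Hamiltonian cycles of $G(n,k)$, where a Hamiltonian cycle is the edge set of a closed walk that visits each vertex exactly once. (For $n\ge 2$ this is the usual notion; for $n=1$ the walk $v_0w_0v_0$ along the single edge $v_0w_0$ is counted, so $h_k(1)=1$.) Let $P=P^{(1)}P^{(2)}P^{(3)}P^{(4)}P^{(5)}P^{(6)}\bigl(P^{(7)}\bigr)^2P^{(8)}\in\mathbb Z[x]$, where \begin{align*} P^{(1)}&=x-1,\quad P^{(2)}=x+1,\quad P^{(3)}=x^2+1,\quad P^{(4)}=x^2-x+1,\quad P^{(5)}=x^2+x+1,\\ P^{(6)}&=x^4-x^2+1,\quad P^{(7)}=x^6-x^3-x-1,\quad P^{(8)}=x^{14}-x^{12}-x^8+x^6-x^4-2x^2-1, \end{align*} and let $Q=Q^{(1)}\bigl(Q^{(2)}Q^{(3)}Q^{(5)}Q^{(7)}Q^{(11)}\bigr)^2Q^{(4)}Q^{(8)}Q^{(9)}Q^{(10)}Q^{(12)}Q^{(13)}\in\mathbb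 Z[x]$, where \begin{align*} Q^{(1)}&=x-1,\quad Q^{(2)}=x+1,\quad Q^{(3)}=x^2+1,\quad Q^{(4)}=x^4+1,\quad Q^{(5)}=x^4-x^3+x^2-x+1,\\ Q^{(7)}&=x^8-x^6+x^4-x^2+1,\quad Q^{(8)}=x^8-x^4-x^2+x-1,\quad Q^{(9)}=x^8-x^4-x^2-x-1,\\ Q^{(10)}&=x^{10}+x^8-2x^6-x^4+x^2-1,\\ Q^{(11)}&=x^{21}-x^{20}+x^{19}-2x^{18}+2x^{17}-3x^{16}+3x^{15}-3x^{14}+3x^{13}-3x^{12}\\ &\quad+2x^{11}-2x^{10}+x^9-2x^8+2x^7-x^6+x^5-x^4+x^3-x^2+x-1,\\ Q^{(12)}&=x^{22}-2x^{18}-x^{15}-2x^{14}-x^{12}+x^{11}+3x^{10}-x^9-x^8+2x^6+x^5+x^4-x^3+x+1,\\ Q^{(13)}&=x^{37}+x^{34}-x^{29}+x^{27}-x^{25}+x^{20}+3x^{17}+3x^{14}+8x^{12}+x^9+3x^7-3x^5-1. \end{align*} Write $P_i$ and $Q_i$ for the coefficients of $x^i$ in $P$ and $Q$. Then $\deg P=38$,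 $\deg Q=162$, and $$P_{38}h_3(n)+P_{37}h_3(n-1)+\dots+P_1h_3(n-37)+P_0h_3(n-38)=0\quad\text{for all } n\ge 39,$$ $$Q_{162}h_4(n)+Q_{161}h_4(n-1)+\dots+Q_1h_4(n-161)+Q_0h_4(n-162)=0\quad\text{for all } n\ge 163.$$ Explicitly, the coefficients $P_0,P_1,\dots,P_{38}$ are 1, 2, 3, 6, 5, 6, 3, -2, 0, -6, -2, -4, 4, 0, -2, -6, -3, -10, -7, 0, 2, 6, 2, 6, -4, -2, -2, 0, -2, 4, 4, 2, -2, 0, 0, -2, -1, 0, 1, and the coefficients $Q_0,Q_1,\dots,Q_{162}$ are -1, 2, -2, 3, -10, 12, -13, 30, -51, 38, -56, 124, -125, 91, -205, 260, -87, 150, -395, 131, 165, 205, 7, -903, 680, -370, 1934, -2628, 1773, -3209, 5354, -4076, 4494, -8135, 7988, -6156, 10028, -11486, 7586, -9113, 13095, -8205, 5742, -10580, 7544, -266, 3517, -3091, -7967, 10326, -7766, 18242, -25199, 19498, -23046, 31413, -24322, 19086, -27751, 26018, -18757, 26544, -32452, 22362, -21291, 24233, -9473, -6804, 10117, -23260,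 40604, -39327, 33736, -36746, 27198, -10072, 7580, -7641, 1552, -8165, 24431, -29303, 33015, -40137, 34426, -16912, 4473, 11028, -31833, 42174, -41404, 39960, -31311, 13171, 787, -9286, 17737, -19638, 11823, -3909, -3465, 13053, -18753, 17089, -13954, 8952, -216, -7352, 11071, -13733, 14258, -10650, 6458, -2911, -1068, 4344, -5168, 5384, -5326, 4113, -2619, 1677, -532, -854, 1600, -2266, 2975, -3287, 3051, -2690, 1946, -830, -229, 1128, -1880, 2277, -2184, 1866, -1325, 664, -55, -386, 686, -804, 733, -583, 387, -184, 15, 82, -136, 141, -112, 80, -46, 20, 0, -9, 12, -11, 6, -3, 1. -/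

import Mathlib

namespace GenPetersen

open scoped Polynomial
open Polynomial

/-- The vertices of the generalized Petersen graph `G(n, k)`, with indices modulo `n`. -/
inductive Vertex (n : ℕ) : Type
  | v (i : ZMod n)
  | w (i : ZMod n)

/-- Labels for the `3 n` edges of `G(n, k)`: `outer i` is `v_i v_{i+1}`, `inner i` is
`w_i w_{i+k}` and `spoke i` is `v_i w_i`. Edges are labelled, so that parallel edges (which
occur for `n = 2` and for `n = 2 k`, for instance) are different edges. -/
inductive Edge (n : ℕ) : Type
  | outer (i : ZMod n)
  | inner (i : ZMod n)
  | spoke (i : ZMod n)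

/-- The unordered pair of ends of an edge of `G(n, k)`. -/
def ends (n k : ℕ) : Edge n → Sym2 (Vertex n)
  | .outer i => s(.v i, .v (i + 1))
  | .inner i => s(.w i, .w (i + (k : ZMod n)))
  | .spoke i => s(.v i, .w i)

/-- The generalized Petersen graph `G(n, k)`, a cubic multigraph. -/
def petersen (n k : ℕ) : Graph (Vertex n) (Edge n) where
  vertexSet := Set.univ
  edgeSet := Set.univ
  IsLink e x y := ends n k e = s(x, y)
  isLink_symm := fun _ _ => ⟨fun _ _ h => h.trans Sym2.eq_swap⟩
  eq_or_eq_of_isLink_of_isLink := fun _ _ _ _ _ h h' =>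
    (Sym2.eq_iff.1 (h.symm.trans h')).imp And.left And.left
  edge_mem_iff_exists_isLink := fun e =>
    ⟨fun _ => (ends n k e).ind (f := fun z => ∃ x y, z = s(x, y)) fun x y => ⟨x, y, rfl⟩,
      fun _ => trivial⟩
  left_mem_of_isLink := fun _ _ _ _ => trivial

/-- `C` is (the edge set of) a Hamiltonian cycle of the multigraph `G`: it is the set of edges
traversed by a closed walk `u 0, e 0, u 1, e 1, …, e (m - 1), u m = u 0` that visits each vertex
exactly once (in one period). As soon as `G` has at least three vertices, the edges `e i` are
automatically distinct and the closed walk is determined by `C` up to its starting point and its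
direction, so this is the usual notion. In a graph that consists of two vertices joined by one
edge (and possibly of loops), the walk going back and forth along that edge is counted as a
Hamiltonian cycle; this convention matters for `G(1, k)` only. -/
def IsHamiltonianCycle {α β : Type*} (G : Graph α β) (C : Set β) : Prop :=
  ∃ m : ℕ, 0 < m ∧ ∃ (u : ZMod m → α) (e : ZMod m → β),
    Set.BijOn u Set.univ G.vertexSet ∧
    (∀ i, G.IsLink (e i) (u i) (u (i + 1))) ∧
    C = Set.range e

/-- `h k n` is the number `h_k(n)` of Hamiltonian cycles in `G(n, k)`. -/
noncomputable def h (k n : ℕ) : ℕ :=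
  Set.ncard {C : Set (Edge n) | IsHamiltonianCycle (petersen n k) C}

noncomputable def P1 : ℤ[X] :=
  X - 1

noncomputable def P2 : ℤ[X] :=
  X + 1

noncomputable def P3 : ℤ[X] :=
  X ^ 2 + 1

noncomputable def P4 : ℤ[X] :=
  X ^ 2 - X + 1

noncomputable def P5 : ℤ[X] :=
  X ^ 2 + X + 1

noncomputable def P6 : ℤ[X] :=
  X ^ 4 - X ^ 2 + 1

noncomputable def P7 : ℤ[X] :=
  X ^ 6 - X ^ 3 - X - 1

noncomputable def P8 : ℤ[X] :=
  X ^ 14 - X ^ 12 - X ^ 8 + X ^ 6 - X ^ 4 - 2 * X ^ 2 - 1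

/-- The polynomial `P` for `k = 3`. -/
noncomputable def P : ℤ[X] :=
  P1 * P2 * P3 * P4 * P5 * P6 * P7 ^ 2 * P8

noncomputable def Q1 : ℤ[X] :=
  X - 1

noncomputable def Q2 : ℤ[X] :=
  X + 1

noncomputable def Q3 : ℤ[X] :=
  X ^ 2 + 1

noncomputable def Q4 : ℤ[X] :=
  X ^ 4 + 1

noncomputable def Q5 : ℤ[X] :=
  X ^ 4 - X ^ 3 + X ^ 2 - X + 1

noncomputable def Q7 : ℤ[X] :=
  X ^ 8 - X ^ 6 + X ^ 4 - X ^ 2 + 1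

noncomputable def Q8 : ℤ[X] :=
  X ^ 8 - X ^ 4 - X ^ 2 + X - 1

noncomputable def Q9 : ℤ[X] :=
  X ^ 8 - X ^ 4 - X ^ 2 - X - 1

noncomputable def Q10 : ℤ[X] :=
  X ^ 10 + X ^ 8 - 2 * X ^ 6 - X ^ 4 + X ^ 2 - 1

noncomputable def Q11 : ℤ[X] :=
  (X ^ 21 - X ^ 20 + X ^ 19 - 2 * X ^ 18 + 2 * X ^ 17 - 3 * X ^ 16 + 3 * X ^ 15 - 3 * X ^ 14
   + 3 * X ^ 13 - 3 * X ^ 12 + 2 * X ^ 11 - 2 * X ^ 10 + X ^ 9 - 2 * X ^ 8 + 2 * X ^ 7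
   - X ^ 6 + X ^ 5 - X ^ 4 + X ^ 3 - X ^ 2 + X - 1)

noncomputable def Q12 : ℤ[X] :=
  (X ^ 22 - 2 * X ^ 18 - X ^ 15 - 2 * X ^ 14 - X ^ 12 + X ^ 11 + 3 * X ^ 10 - X ^ 9 - X ^ 8
   + 2 * X ^ 6 + X ^ 5 + X ^ 4 - X ^ 3 + X + 1)

noncomputable def Q13 : ℤ[X] :=
  (X ^ 37 + X ^ 34 - X ^ 29 + X ^ 27 - X ^ 25 + X ^ 20 + 3 * X ^ 17 + 3 * X ^ 14 + 8 * X ^ 12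
   + X ^ 9 + 3 * X ^ 7 - 3 * X ^ 5 - 1)

/-- The polynomial `Q` for `k = 4`. (There is no factor `Q6`.) -/
noncomputable def Q : ℤ[X] :=
  Q1 * (Q2 * Q3 * Q5 * Q7 * Q11) ^ 2 * Q4 * Q8 * Q9 * Q10 * Q12 * Q13

/-- The tabulated coefficients `P_0, P_1, …, P_38`, from the constant term upwards. -/
def PCoeffs : List ℤ :=
  [1, 2, 3, 6, 5, 6, 3, -2, 0, -6, -2, -4, 4, 0, -2, -6, -3, -10, -7, 0, 2, 6, 2, 6, -4, -2,
    -2, 0, -2, 4, 4, 2, -2, 0, 0, -2, -1, 0, 1]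

/-- The tabulated coefficients `Q_0, Q_1, …, Q_162`, from the constant term upwards. -/
def QCoeffs : List ℤ :=
  [-1, 2, -2, 3, -10, 12, -13, 30, -51, 38, -56, 124, -125, 91, -205, 260, -87, 150, -395,
    131, 165, 205, 7, -903, 680, -370, 1934, -2628, 1773, -3209, 5354, -4076, 4494, -8135,
    7988, -6156, 10028, -11486, 7586, -9113, 13095, -8205, 5742, -10580, 7544, -266, 3517,
    -3091, -7967, 10326, -7766, 18242, -25199, 19498, -23046, 31413, -24322, 19086, -27751,
    26018, -18757, 26544, -32452, 22362, -21291, 24233, -9473, -6804, 10117, -23260, 40604,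
    -39327, 33736, -36746, 27198, -10072, 7580, -7641, 1552, -8165, 24431, -29303, 33015,
    -40137, 34426, -16912, 4473, 11028, -31833, 42174, -41404, 39960, -31311, 13171, 787,
    -9286, 17737, -19638, 11823, -3909, -3465, 13053, -18753, 17089, -13954, 8952, -216, -7352,
    11071, -13733, 14258, -10650, 6458, -2911, -1068, 4344, -5168, 5384, -5326, 4113, -2619,
    1677, -532, -854, 1600, -2266, 2975, -3287, 3051, -2690, 1946, -830, -229, 1128, -1880,
    2277, -2184, 1866, -1325, 664, -55, -386, 686, -804, 733, -583, 387, -184, 15, 82, -136,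
    141, -112, 80, -46, 20, 0, -9, 12, -11, 6, -3, 1]

end GenPetersen

namespace GenPetersen

/-! ### Partial configurations on a strip -/

/-! The proof is a transfer matrix argument completed by a finite calculation. For n ≥ 2 a
Hamiltonian cycle is the same as an edge set that has degree two at every vertex and connects all
vertices (`isHamiltonianCycle_iff`). Cutting in front of column 0 crosses one outer edge and k inner
ones (the same inner edge repeatedly if n < k), and opens the cycle to a strip of n columns with k +
1 terminals on either side.

Of everything outside the strip only a state `(L, R)` matters: which terminals behind (`L`) and in
front (`R`) are used, and which of them are connected outside. Label 0 marks an unused terminal, and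
equal nonzero labels mark the ends of one path. `count k n L R` counts the ways to fill n columns so
that a single cycle results. The number h_k(n) is the sum of `count k n l l` over the states whose
used terminals all carry different labels (`h_eq_sum_count`).

Connectedness is expressed by two-colourings: each colouring that is constant along chosen edges and
along labels must have one colour only. In this form the removal of the first column is a transport
of colourings (`good_contract`). It leads to a few cases: the paths pass, swap rims, begin, are
joined, or close up. It alters `L` only if two paths that lead through to `L` are joined. With
standardised labels finitely many states remain, so the vector of counts satisfies x_{n+1} = A x_n
with a fixed matrix A (`count_step`). If a polynomial q satisfies q(A) x_2 = 0, applying powers of A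
gives the recurrence from every later start (`Valid.recurrence_of_le`). The instance that begins
with h_k(1) = 1 involves a convention and is checked separately.

In the calculation the states are sorted into sectors by the number t of paths that lead through.
For each `R`, the counts for all `L` of a sector are the digits of one number in base `2 ^ bits`.
Counts for n columns are at most 2^n (`Valid.count_le`), so digits do not overflow, and a linear
relation between packed numbers holds digit by digit (`comb_eq_zero_of_pack`). Nothing is proved
about the construction of the table: `tableOk` checks the finished table against `stepRow`, and only
this check enters the argument (`recurrence_of_verify`). The evaluations are `verified_three` and
`verified_four`. The expansions of P and Q are products of coefficient lists. -/

/-- The choice of a set of edges of a strip: `V i` says whether the outer edge entering column `i`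
is chosen, `W i` whether the inner edge entering column `i` is, and `S i` whether the spoke is. -/
@[ext]
structure Conf where
  V : ℕ → Bool
  W : ℕ → Bool
  S : ℕ → Bool

/-- Exactly two of three. -/
def Two (a b c : Bool) : Prop := a.toNat + b.toNat + c.toNat = 2

/-- The predicate `P j x` holds for each entry `x` of the list, at its index `j`. -/
def At (P : ℕ → ℕ → Prop) : List ℕ → Prop
  | [] => True
  | a :: l => P 0 a ∧ At (fun j => P (j + 1)) l

/-- The value at the terminal `j` of the cut in front of column `n`. -/
def term (n : ℕ) (V W : ℕ → Bool) : ℕ → Bool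
  | 0 => V n
  | j + 1 => W (n + j)

/-- A two-colouring of labels and vertices that is constant along the chosen edges. -/
structure Colouring (k n : ℕ) (L R : List ℕ) (p : Conf) (X Y Z : ℕ → Bool) : Prop where
  right : At (fun j x => x ≠ 0 → term 0 Y Z j = X x) R
  left : At (fun j x => x ≠ 0 → term n Y Z j = X x) L
  spoke : ∀ i < n, p.S i = true → Y i = Z i
  outer : ∀ i < n, p.V (i + 1) = true → Y i = Y (i + 1)
  inner : ∀ i < n, p.W (i + k) = true → Z i = Z (i + k)

/-- The colouring has the single colour `b`. -/
structure Mono (n : ℕ) (L R : List ℕ) (X Y Z : ℕ → Bool) (b : Bool) : Prop where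
  left : ∀ x ∈ L, x ≠ 0 → X x = b
  right : ∀ x ∈ R, x ≠ 0 → X x = b
  vert : ∀ i < n, Y i = b ∧ Z i = b

/-- The configuration `p` on `n` columns completes paths with the labelled ends `R` in front of the
strip and `L` behind it to a single cycle. -/
structure Good (k n : ℕ) (L R : List ℕ) (p : Conf) : Prop where
  lenL : L.length = k + 1
  lenR : R.length = k + 1
  right : At (fun j x => term 0 p.V p.W j = decide (x ≠ 0)) R
  left : At (fun j x => term n p.V p.W j = decide (x ≠ 0)) L
  twoV : ∀ i < n, Two (p.V i) (p.S i) (p.V (i + 1))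
  twoW : ∀ i < n, Two (p.W i) (p.S i) (p.W (i + k))
  suppV : ∀ i, n < i → p.V i = false
  suppW : ∀ i, n + k ≤ i → p.W i = false
  suppS : ∀ i, n ≤ i → p.S i = false
  nonempty : 0 < n ∨ ∃ x, (x ∈ L ∨ x ∈ R) ∧ x ≠ 0
  conn : ∀ X Y Z, Colouring k n L R p X Y Z → ∃ b, Mono n L R X Y Z b

/-- Put a value in front of a sequence. -/
def push (b : Bool) (f : ℕ → Bool) : ℕ → Bool
  | 0 => b
  | j + 1 => f j

@[simp] theorem push_zero (b : Bool) (f : ℕ → Bool) : push b f 0 = b := rfl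

@[simp] theorem push_succ (b : Bool) (f : ℕ → Bool) (i : ℕ) : push b f (i + 1) = f i := rfl

/-- Put a column in front of a configuration. -/
def Conf.push (v w s : Bool) (p : Conf) : Conf :=
  ⟨GenPetersen.push v p.V, GenPetersen.push w p.W, GenPetersen.push s p.S⟩

/-- Remove the first column of a configuration. -/
def Conf.tail (p : Conf) : Conf := ⟨fun i => p.V (i + 1), fun i => p.W (i + 1), fun i => p.S (i + 1)⟩

theorem push_tail (p : Conf) : Conf.push (p.V 0) (p.W 0) (p.S 0) p.tail = p := by
  ext i <;> cases i <;> rfl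

theorem push_injective (v w s : Bool) : Function.Injective (Conf.push v w s) := by
  intro p q h
  have h1 : ∀ i, (Conf.push v w s p).V (i + 1) = (Conf.push v w s q).V (i + 1) := by simp [h]
  have h2 : ∀ i, (Conf.push v w s p).W (i + 1) = (Conf.push v w s q).W (i + 1) := by simp [h]
  have h3 : ∀ i, (Conf.push v w s p).S (i + 1) = (Conf.push v w s q).S (i + 1) := by simp [h]
  ext i
  · exact h1 i
  · exact h2 i
  · exact h3 i

theorem at_append_singleton {P : ℕ → ℕ → Prop} {l : List ℕ} {x : ℕ} :
    At P (l ++ [x]) ↔ At P l ∧ P l.length x := by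
  induction l generalizing P with
  | nil => simp [At]
  | cons a l ih => simp [At, ih, and_assoc]

theorem at_map {P : ℕ → ℕ → Prop} {l : List ℕ} {G : ℕ → ℕ} :
    At P (l.map G) ↔ At (fun j x => P j (G x)) l := by
  induction l generalizing P with
  | nil => simp [At]
  | cons a l ih => simp [At, ih]

theorem At.imp {P Q : ℕ → ℕ → Prop} {l : List ℕ} (h : At P l)
    (hPQ : ∀ j x, x ∈ l → P j x → Q j x) : At Q l := by
  induction l generalizing P Q with
  | nil => trivial
  | cons a l ih =>
    exact ⟨hPQ 0 a (by simp) h.1, ih h.2 fun j x hx => hPQ (j + 1) x (by simp [hx])⟩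

theorem At.congr {P Q : ℕ → ℕ → Prop} {l : List ℕ}
    (hPQ : ∀ j x, x ∈ l → (P j x ↔ Q j x)) : At P l ↔ At Q l :=
  ⟨fun h => h.imp fun j x hx => (hPQ j x hx).1, fun h => h.imp fun j x hx => (hPQ j x hx).2⟩

theorem term_succ_push (n : ℕ) (v w : Bool) (V W : ℕ → Bool) (j : ℕ) :
    term (n + 1) (push v V) (push w W) j = term n V W j := by
  cases j with
  | zero => rfl
  | succ j => simp only [term, show n + 1 + j = (n + j) + 1 by omega, push]

/-- The edges that leave a column are determined by those that enter it and by the spoke. -/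
theorem Two.right_eq {a b c d : Bool} (h : Two a b c) (h' : Two a b d) : c = d := by
  revert h h'; cases a <;> cases b <;> cases c <;> cases d <;> simp [Two]

theorem forall_lt_succ_iff {n : ℕ} {P : ℕ → Prop} :
    (∀ i < n + 1, P i) ↔ P 0 ∧ ∀ i < n, P (i + 1) := by
  constructor
  · intro h
    exact ⟨h 0 (by omega), fun i hi => h (i + 1) (by omega)⟩
  · rintro ⟨h0, h⟩ i hi
    cases i with
    | zero => exact h0
    | succ i => exact h i (by omega)

/-- Colours before and after the contraction of a column that belong to each other. -/
structure Compat (G : ℕ → ℕ) (L rest : List ℕ) (a b x y : ℕ) (s : Bool) (X X' : ℕ → Bool)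
    (c d : Bool) : Prop where
  left : ∀ z ∈ L, z ≠ 0 → X z = X' (G z)
  right : ∀ z ∈ rest, z ≠ 0 → X z = X' (G z)
  fst : a ≠ 0 → c = X a
  snd : b ≠ 0 → d = X b
  spoke : s = true → c = d
  fst' : x ≠ 0 → c = X' x
  snd' : y ≠ 0 → d = X' y

/-! ### Removal of the first column. -/

section Contract

variable {k n : ℕ} {L rest : List ℕ} {a b x y : ℕ} {s : Bool} {G : ℕ → ℕ} {p : Conf}

/-- After the removal, the vertices that followed `v_0` and `w_0` are attached to the labels `x` and
`y` instead. So the colours `c`, `d` of the removed column live on as the colours of these labels,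
and all other conditions are merely shifted by one column. -/
theorem colouring_contract (hk : rest.length + 1 = k)
    (hx : p.V 0 = decide (x ≠ 0)) (hy : p.W rest.length = decide (y ≠ 0))
    (hGL : ∀ z ∈ L, (G z = 0 ↔ z = 0)) (hGR : ∀ z ∈ rest, (G z = 0 ↔ z = 0))
    {X X' Y Z : ℕ → Bool} {c d : Bool} (hc : Compat G L rest a b x y s X X' c d) :
    Colouring k (n + 1) L (a :: b :: rest) (.push (decide (a ≠ 0)) (decide (b ≠ 0)) s p)
      X (push c Y) (push d Z) ↔
    Colouring k n (L.map G) (x :: (rest.map G ++ [y])) p X' Y Z := by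
  have eL : At (fun j x => x ≠ 0 → term (n + 1) (push c Y) (push d Z) j = X x) L ↔
      At (fun j x => x ≠ 0 → term n Y Z j = X' x) (L.map G) := by
    rw [at_map]
    refine At.congr fun j z hz => ?_
    rw [term_succ_push, ne_eq, ne_eq, hGL z hz]
    exact ⟨fun h h0 => (h h0).trans (hc.left z hz h0), fun h h0 => (h h0).trans (hc.left z hz h0).symm⟩
  have eR : At (fun j x => x ≠ 0 → Z j = X x) rest ↔
      At (fun j x => x ≠ 0 → Z j = X' x) (rest.map G) := by
    rw [at_map]
    refine At.congr fun j z hz => ?_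
    rw [ne_eq, ne_eq, hGR z hz]
    exact ⟨fun h h0 => (h h0).trans (hc.right z hz h0),
      fun h h0 => (h h0).trans (hc.right z hz h0).symm⟩
  subst hk
  constructor
  · intro h
    have hr := h.right
    have ho := forall_lt_succ_iff.1 h.outer
    have hi := forall_lt_succ_iff.1 h.inner
    refine ⟨?_, eL.1 h.left, fun i hi => h.spoke (i + 1) (by omega), fun i hi => ho.2 i hi,
      fun i hj => ?_⟩
    · simp only [At, at_append_singleton, term, List.length_map, zero_add] at hr ⊢
      refine ⟨fun h0 => ?_, eR.1 ?_, fun h0 => ?_⟩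
      · exact (ho.1 (by simpa [Conf.push, push, hx] using h0)).symm.trans (hc.fst' h0)
      · simpa [push] using hr.2.2
      · have := hi.1 (by simpa [Conf.push, push, hy] using h0)
        simp only [push_zero, zero_add, push_succ] at this
        exact this.symm.trans (hc.snd' h0)
    · have := hi.2 i hj
      simp only [Conf.push, show i + 1 + (rest.length + 1) = i + (rest.length + 1) + 1 by omega,
        push_succ]
        at this
      exact this
  · intro h
    have hr := h.right
    simp only [At, at_append_singleton, term, List.length_map, zero_add] at hr
    refine ⟨?_, eL.2 h.left, forall_lt_succ_iff.2 ⟨fun hs => hc.spoke hs, fun i hi => h.spoke i hi⟩,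
      forall_lt_succ_iff.2 ⟨fun hv => ?_, fun i hi => h.outer i hi⟩,
      forall_lt_succ_iff.2 ⟨fun hw => ?_, fun i hi hw => ?_⟩⟩
    · simp only [At, term, zero_add, push_zero, push_succ]
      exact ⟨hc.fst, hc.snd, eR.2 hr.2.1⟩
    · have h0 : x ≠ 0 := by simpa [Conf.push, push, hx] using hv
      exact (hc.fst' h0).trans (hr.1 h0).symm
    · have h0 : y ≠ 0 := by simpa [Conf.push, push, hy] using hw
      simpa [push] using (hc.snd' h0).trans (hr.2.2 h0).symm
    · simp only [Conf.push, show i + 1 + (rest.length + 1) = i + (rest.length + 1) + 1 by omega,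
        push_succ]
        at hw ⊢
      exact h.inner i hi hw

/-- The contraction of the first column of a strip. -/
theorem good_contract (hk : rest.length + 1 = k)
    (hGL : ∀ z ∈ L, (G z = 0 ↔ z = 0)) (hGR : ∀ z ∈ rest, (G z = 0 ↔ z = 0))
    (two0 : Two (decide (a ≠ 0)) s (decide (x ≠ 0)))
    (two1 : Two (decide (b ≠ 0)) s (decide (y ≠ 0)))
    (h1 : ∀ X', ∃ X c d, Compat G L rest a b x y s X X' c d)
    (h2 : ∀ X c d, (a ≠ 0 → c = X a) → (b ≠ 0 → d = X b) → (s = true → c = d) →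
      ∃ X', Compat G L rest a b x y s X X' c d)
    (h3 : ∀ X X' c d e, Compat G L rest a b x y s X X' c d → (∀ z ∈ L, z ≠ 0 → X z = e) →
      (∀ z ∈ rest, z ≠ 0 → X z = e) → (x ≠ 0 → c = e) → (y ≠ 0 → d = e) → c = e ∧ d = e)
    (h4 : (∃ z, (z ∈ L ∨ z ∈ rest) ∧ z ≠ 0) ∨ x ≠ 0 ∨ y ≠ 0) :
    Good k (n + 1) L (a :: b :: rest) (.push (decide (a ≠ 0)) (decide (b ≠ 0)) s p) ↔
      Good k n (L.map G) (x :: (rest.map G ++ [y])) p := by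
  have eL : At (fun j x => term (n + 1) (push (decide (a ≠ 0)) p.V) (push (decide (b ≠ 0)) p.W) j
        = decide (x ≠ 0)) L ↔
      At (fun j x => term n p.V p.W j = decide (x ≠ 0)) (L.map G) := by
    rw [at_map]
    refine At.congr fun j z hz => ?_
    rw [term_succ_push]
    simp only [ne_eq, hGL z hz]
  have eR : At (fun j x => p.W j = decide (x ≠ 0)) rest ↔
      At (fun j x => p.W j = decide (x ≠ 0)) (rest.map G) := by
    rw [at_map]
    refine At.congr fun j z hz => ?_
    simp only [ne_eq, hGR z hz]
  constructor
  · intro h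
    have tv := forall_lt_succ_iff.1 h.twoV
    have tw := forall_lt_succ_iff.1 h.twoW
    have hx : p.V 0 = decide (x ≠ 0) := Two.right_eq tv.1 two0
    have hy : p.W rest.length = decide (y ≠ 0) := by
      refine Two.right_eq ?_ two1
      have := tw.1
      simpa [Conf.push, push, ← hk] using this
    have hr := h.right
    simp only [At, term, zero_add] at hr
    refine ⟨by simpa using h.lenL, by simp [hk], ?_, eL.1 h.left, fun i hi => tv.2 i hi,
      fun i hi => ?_, fun i hi => h.suppV (i + 1) (by omega),
      fun i hi => h.suppW (i + 1) (by omega), fun i hi => h.suppS (i + 1) (by omega), ?_, ?_⟩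
    · simp only [At, at_append_singleton, term, List.length_map, zero_add]
      exact ⟨hx, eR.1 hr.2.2, hy⟩
    · have := tw.2 i hi
      subst hk
      simp only [Conf.push, show i + 1 + (rest.length + 1) = i + (rest.length + 1) + 1 by omega,
        push_succ]
        at this
      exact this
    -- No column may be left, so something nonempty has to be found among the labels.
    · right
      rcases h4 with ⟨z, hz | hz, h0⟩ | h0 | h0
      · exact ⟨G z, .inl (List.mem_map_of_mem hz), by rwa [ne_eq, hGL z hz]⟩
      · exact ⟨G z, .inr (by simp; exact .inr (.inl ⟨z, hz, rfl⟩)), by rwa [ne_eq, hGR z hz]⟩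
      · exact ⟨x, by simp, h0⟩
      · exact ⟨y, by simp, h0⟩
    -- A colouring after the contraction extends to the removed column by `h1`, and the extension
    -- has one colour.
    · intro X' Y Z hcol
      obtain ⟨X, c, d, hc⟩ := h1 X'
      obtain ⟨e, he⟩ := h.conn X (push c Y) (push d Z)
        ((colouring_contract hk hx hy hGL hGR hc).2 hcol)
      have hv := forall_lt_succ_iff.1 he.vert
      refine ⟨e, ⟨?_, ?_, hv.2⟩⟩
      · intro z hz h0
        obtain ⟨z, hzL, rfl⟩ := List.mem_map.1 hz
        have h0' : z ≠ 0 := by rwa [ne_eq, hGL z hzL] at h0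
        exact (hc.left z hzL h0').symm.trans (he.left z hzL h0')
      · intro z hz h0
        simp only [List.mem_cons, List.mem_append, List.mem_map, List.not_mem_nil, or_false] at hz
        rcases hz with rfl | ⟨z, hz, rfl⟩ | rfl
        · exact (hc.fst' h0).symm.trans hv.1.1
        · have h0' : z ≠ 0 := by rwa [ne_eq, hGR z hz] at h0
          exact (hc.right z hz h0').symm.trans (he.right z (by simp [hz]) h0')
        · exact (hc.snd' h0).symm.trans hv.1.2
  · intro h
    have hr := h.right
    simp only [At, at_append_singleton, term, List.length_map, zero_add] at hr
    obtain ⟨hx, hr, hy⟩ := hr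
    refine ⟨by simpa using h.lenL, by simp [← hk], ?_, eL.2 h.left,
      forall_lt_succ_iff.2 ⟨?_, h.twoV⟩, forall_lt_succ_iff.2 ⟨?_, fun i hi => ?_⟩, ?_, ?_, ?_,
      .inl (by omega), ?_⟩
    · simp only [At, term, zero_add]
      exact ⟨rfl, rfl, eR.2 hr⟩
    · simpa [Conf.push, push, hx] using two0
    · simpa [Conf.push, push, ← hk, hy] using two1
    · subst hk
      simp only [Conf.push, show i + 1 + (rest.length + 1) = i + (rest.length + 1) + 1 by omega,
        push_succ]
      exact h.twoW i hi
    · rintro (_ | i) hi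
      · omega
      · exact h.suppV i (by omega)
    · rintro (_ | i) hi
      · omega
      · exact h.suppW i (by omega)
    · rintro (_ | i) hi
      · omega
      · exact h.suppS i (by omega)
    -- Conversely, `h2` pushes a colouring forward. The contracted state no longer contains the
    -- removed column, so its colour has to be recovered by `h3`.
    · intro X Y Z hcol
      have hYY : Y = push (Y 0) fun i => Y (i + 1) := by funext i; cases i <;> rfl
      have hZZ : Z = push (Z 0) fun i => Z (i + 1) := by funext i; cases i <;> rfl
      have hr' := hcol.right
      simp only [At, term, zero_add] at hr'
      obtain ⟨X', hc⟩ := h2 X (Y 0) (Z 0) hr'.1 hr'.2.1 fun hs => hcol.spoke 0 (by omega) hs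
      rw [hYY, hZZ] at hcol
      obtain ⟨e, he⟩ := h.conn X' _ _ ((colouring_contract hk hx hy hGL hGR hc).1 hcol)
      have hl : ∀ z ∈ L, z ≠ 0 → X z = e := fun z hz h0 =>
        (hc.left z hz h0).trans (he.left _ (List.mem_map_of_mem hz) (by rwa [ne_eq, hGL z hz]))
      have hrr : ∀ z ∈ rest, z ≠ 0 → X z = e := fun z hz h0 =>
        (hc.right z hz h0).trans (he.right _ (by simp; exact .inr (.inl ⟨z, hz, rfl⟩))
          (by rwa [ne_eq, hGR z hz]))
      have h00 := h3 X X' (Y 0) (Z 0) e hc hl hrr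
        (fun h0 => (hc.fst' h0).trans (he.right x (by simp) h0))
        (fun h0 => (hc.snd' h0).trans (he.right y (by simp) h0))
      refine ⟨e, ⟨hl, ?_, forall_lt_succ_iff.2 ⟨h00, he.vert⟩⟩⟩
      intro z hz h0
      simp only [List.mem_cons] at hz
      rcases hz with rfl | rfl | hz
      · exact (hc.fst h0).symm.trans h00.1
      · exact (hc.snd h0).symm.trans h00.2
      · exact hrr z hz h0

end Contract

/-! ### Counting the completions of a state -/

/-- A colouring that is constant on the fibres of `G` factors through `G`; `D` restricts this to the
labels in use. -/
theorem exists_lift (D : ℕ → Prop) (G : ℕ → ℕ) (X : ℕ → Bool)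
    (h : ∀ z z', D z → D z' → G z = G z' → X z = X z') :
    ∃ X' : ℕ → Bool, ∀ z, D z → X z = X' (G z) := by
  classical
  refine ⟨fun y => decide (∃ z, D z ∧ G z = y ∧ X z = true), fun z hz => ?_⟩
  by_cases hX : X z = true
  · rw [hX, eq_comm, decide_eq_true_iff]
    exact ⟨z, hz, rfl, hX⟩
  · rw [Bool.not_eq_true] at hX
    rw [hX, eq_comm, decide_eq_false_iff_not]
    rintro ⟨z', hz', hG, hX'⟩
    simp [h z z' hz hz' hG.symm, hX'] at hX

/-- The label `z` occurs in the state. -/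
def Occurs (L R : List ℕ) (z : ℕ) : Prop := z ∈ L ∨ z ∈ R

/-! ### How paths can cross a column. -/

section Transitions

variable {k n : ℕ} {L rest : List ℕ} {a b : ℕ} {G : ℕ → ℕ} {p : Conf}

/-- Without the spoke both paths continue along their rims, and `G` is only an injective renaming of
the labels in use. -/
theorem good_pass (hk : rest.length + 1 = k) (ha : a ≠ 0) (hb : b ≠ 0)
    (h0 : ∀ z, Occurs L (a :: b :: rest) z → (G z = 0 ↔ z = 0))
    (hinj : ∀ z z', Occurs L (a :: b :: rest) z → Occurs L (a :: b :: rest) z' →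
      G z = G z' → z = z') :
    Good k (n + 1) L (a :: b :: rest) (.push true true false p) ↔
      Good k n (L.map G) (G a :: (rest.map G ++ [G b])) p := by
  have hL : ∀ z ∈ L, Occurs L (a :: b :: rest) z := fun z hz => .inl hz
  have hR : ∀ z ∈ rest, Occurs L (a :: b :: rest) z := fun z hz => .inr (by simp [hz])
  have hOa : Occurs L (a :: b :: rest) a := .inr (by simp)
  have hOb : Occurs L (a :: b :: rest) b := .inr (by simp)
  have ha' : G a ≠ 0 := by rwa [ne_eq, h0 a hOa]
  have hb' : G b ≠ 0 := by rwa [ne_eq, h0 b hOb]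
  have := good_contract (k := k) (n := n) (L := L) (rest := rest) (a := a) (b := b) (x := G a)
    (y := G b) (s := false) (G := G) (p := p) hk (fun z hz => h0 z (hL z hz))
    (fun z hz => h0 z (hR z hz)) (by simp [Two, ha, ha']) (by simp [Two, hb, hb'])
    (fun X' => ⟨fun z => X' (G z), X' (G a), X' (G b), by constructor <;> simp⟩)
    (fun X c d hc hd _ => by
      obtain ⟨X', hX'⟩ := exists_lift (Occurs L (a :: b :: rest)) G X
        fun z z' hz hz' hG => by rw [hinj z z' hz hz' hG]
      refine ⟨X', fun z hz _ => hX' z (hL z hz), fun z hz _ => hX' z (hR z hz), hc, hd, by simp,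
        fun _ => (hc ha).trans (hX' a hOa), fun _ => (hd hb).trans (hX' b hOb)⟩)
    (fun X X' c d e _ _ _ hx hy => ⟨hx ha', hy hb'⟩) (.inr (.inl ha'))
  simpa [ha, hb] using this

/-- Exactly one path enters the column; it takes the spoke and leaves on the other rim. -/
theorem good_swap (hk : rest.length + 1 = k) (hab : a = 0 ↔ b ≠ 0)
    (h0 : ∀ z, Occurs L (a :: b :: rest) z → (G z = 0 ↔ z = 0))
    (hinj : ∀ z z', Occurs L (a :: b :: rest) z → Occurs L (a :: b :: rest) z' →
      G z = G z' → z = z') :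
    Good k (n + 1) L (a :: b :: rest) (.push (decide (a ≠ 0)) (decide (b ≠ 0)) true p) ↔
      Good k n (L.map G) (G b :: (rest.map G ++ [G a])) p := by
  have hL : ∀ z ∈ L, Occurs L (a :: b :: rest) z := fun z hz => .inl hz
  have hR : ∀ z ∈ rest, Occurs L (a :: b :: rest) z := fun z hz => .inr (by simp [hz])
  have hOa : Occurs L (a :: b :: rest) a := .inr (by simp)
  have hOb : Occurs L (a :: b :: rest) b := .inr (by simp)
  have ha' := h0 a hOa
  have hb' := h0 b hOb
  refine good_contract hk (fun z hz => h0 z (hL z hz))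
    (fun z hz => h0 z (hR z hz)) ?_ ?_ ?_ ?_ ?_ ?_
  · by_cases h : a = 0 <;> simp_all [Two]
  · by_cases h : a = 0 <;> simp_all [Two]
  · intro X'
    by_cases h : a = 0
    · exact ⟨fun z => X' (G z), X' (G b), X' (G b), by constructor <;> simp_all⟩
    · exact ⟨fun z => X' (G z), X' (G a), X' (G a), by constructor <;> simp_all⟩
  · intro X c d hc hd hcd
    obtain ⟨X', hX'⟩ := exists_lift (Occurs L (a :: b :: rest)) G X
      fun z z' hz hz' hG => by rw [hinj z z' hz hz' hG]
    have hcd := hcd rfl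
    subst hcd
    refine ⟨X', fun z hz _ => hX' z (hL z hz), fun z hz _ => hX' z (hR z hz), hc, hd, by simp,
      fun hx => ?_, fun hy => ?_⟩
    · rw [← hX' b hOb]
      exact hd (by rwa [ne_eq, hb'] at hx)
    · rw [← hX' a hOa]
      exact hc (by rwa [ne_eq, ha'] at hy)
  · intro X X' c d e hc _ _ hx hy
    have hcd := hc.spoke rfl
    by_cases h : a = 0
    · have hb0 := hab.1 h
      have := hx (by rwa [ne_eq, hb'])
      exact ⟨this, hcd ▸ this⟩
    · have := hy (by rwa [ne_eq, ha'])
      exact ⟨hcd ▸ this, this⟩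
  · right
    by_cases h : a = 0
    · exact .inl (by rw [ne_eq, hb']; exact hab.1 h)
    · exact .inr (by rwa [ne_eq, ha'])

/-- No path enters, so both vertices use the spoke and their leaving edges. These are the two ends
of a new path, which needs an unused label `f`. -/
theorem good_cup {f : ℕ} (hk : rest.length + 1 = k) (hf : f ≠ 0) (hf' : ¬ Occurs L (0 :: 0 :: rest) f)
    (h0 : ∀ z, z = f ∨ Occurs L (0 :: 0 :: rest) z → (G z = 0 ↔ z = 0))
    (hinj : ∀ z z', z = f ∨ Occurs L (0 :: 0 :: rest) z → z' = f ∨ Occurs L (0 :: 0 :: rest) z' →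
      G z = G z' → z = z') :
    Good k (n + 1) L (0 :: 0 :: rest) (.push false false true p) ↔
      Good k n (L.map G) (G f :: (rest.map G ++ [G f])) p := by
  have hL : ∀ z ∈ L, Occurs L (0 :: 0 :: rest) z := fun z hz => .inl hz
  have hR : ∀ z ∈ rest, Occurs L (0 :: 0 :: rest) z := fun z hz => .inr (by simp [hz])
  have hGf : G f ≠ 0 := by rwa [ne_eq, h0 f (.inl rfl)]
  have := good_contract (k := k) (n := n) (L := L) (rest := rest) (a := 0) (b := 0) (x := G f)
    (y := G f) (s := true) (G := G) (p := p) hk (fun z hz => h0 z (.inr (hL z hz)))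
    (fun z hz => h0 z (.inr (hR z hz))) (by simp [Two, hGf]) (by simp [Two, hGf])
    (fun X' => ⟨fun z => X' (G z), X' (G f), X' (G f), by constructor <;> simp⟩)
    (fun X c d _ _ hcd => by
      -- As `f` does not occur, the colouring may be changed there to carry the colour of the new
      -- path.
      obtain ⟨X', hX'⟩ := exists_lift (fun z => z = f ∨ Occurs L (0 :: 0 :: rest) z) G
        (Function.update X f c) fun z z' hz hz' hG => by rw [hinj z z' hz hz' hG]
      have hne : ∀ z, Occurs L (0 :: 0 :: rest) z → X z = X' (G z) := fun z hz => by
        rw [← hX' z (.inr hz), Function.update_of_ne]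
        rintro rfl
        exact hf' hz
      have hXf : c = X' (G f) := by rw [← hX' f (.inl rfl), Function.update_self]
      exact ⟨X', fun z hz _ => hne z (hL z hz), fun z hz _ => hne z (hR z hz), by simp, by simp,
        hcd, fun _ => hXf, fun _ => hcd rfl ▸ hXf⟩)
    (fun X X' c d e _ _ _ hx hy => ⟨hx hGf, hy hGf⟩) (.inr (.inl hGf))
  simpa using this

/-- The spoke turns the paths `a` and `b` into one, so `G` identifies these two labels and no others
in use. By `hab` an end of the joined path is left over; its colour is what determines the colour of
the removed column. -/
theorem good_join (hk : rest.length + 1 = k) (ha : a ≠ 0) (hb : b ≠ 0)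
    (hab : ∃ z, (z ∈ L ∨ z ∈ rest) ∧ (z = a ∨ z = b))
    (h0 : ∀ z, Occurs L rest z → (G z = 0 ↔ z = 0))
    (hGab : G a = G b)
    (hinj : ∀ z z', Occurs L (a :: b :: rest) z → Occurs L (a :: b :: rest) z' →
      G z = G z' → z = z' ∨ ((z = a ∨ z = b) ∧ (z' = a ∨ z' = b))) :
    Good k (n + 1) L (a :: b :: rest) (.push true true true p) ↔
      Good k n (L.map G) (0 :: (rest.map G ++ [0])) p := by
  have hL : ∀ z ∈ L, Occurs L (a :: b :: rest) z := fun z hz => .inl hz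
  have hR : ∀ z ∈ rest, Occurs L (a :: b :: rest) z := fun z hz => .inr (by simp [hz])
  have hOa : Occurs L (a :: b :: rest) a := .inr (by simp)
  have hOb : Occurs L (a :: b :: rest) b := .inr (by simp)
  have := good_contract (k := k) (n := n) (L := L) (rest := rest) (a := a) (b := b) (x := 0)
    (y := 0) (s := true) (G := G) (p := p) hk (fun z hz => h0 z (.inl hz))
    (fun z hz => h0 z (.inr hz)) (by simp [Two, ha]) (by simp [Two, hb])
    (fun X' => ⟨fun z => X' (G z), X' (G a), X' (G b), by constructor <;> simp [hGab]⟩)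
    (fun X c d hc hd hcd => by
      have hX : X a = X b := (hc ha).symm.trans ((hcd rfl).trans (hd hb))
      obtain ⟨X', hX'⟩ := exists_lift (Occurs L (a :: b :: rest)) G X fun z z' hz hz' hG => by
        rcases hinj z z' hz hz' hG with h | ⟨rfl | rfl, rfl | rfl⟩ <;> simp [*]
      exact ⟨X', fun z hz _ => hX' z (hL z hz), fun z hz _ => hX' z (hR z hz), hc, hd, hcd,
        by simp, by simp⟩)
    (fun X X' c d e hc hl hr _ _ => by
      obtain ⟨z, hz, hzab⟩ := hab
      have hz0 : z ≠ 0 := by rcases hzab with rfl | rfl <;> assumption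
      have hXz : X z = e := hz.elim (fun h => hl z h hz0) (fun h => hr z h hz0)
      have hcd := hc.spoke rfl
      rcases hzab with rfl | rfl
      · have := (hc.fst ha).trans hXz
        exact ⟨this, hcd ▸ this⟩
      · have := (hc.snd hb).trans hXz
        exact ⟨hcd ▸ this, this⟩)
    (by
      obtain ⟨z, hz, hzab⟩ := hab
      exact .inl ⟨z, hz, by rcases hzab with rfl | rfl <;> assumption⟩)
  simpa [ha, hb] using this

end Transitions

/-- The configuration without any edges. -/
def Conf.none : Conf := ⟨fun _ => false, fun _ => false, fun _ => false⟩

theorem at_iff {P : ℕ → ℕ → Prop} {l : List ℕ} : At P l ↔ ∀ j (hj : j < l.length), P j l[j] := by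
  induction l generalizing P with
  | nil => simp [At]
  | cons a l ih =>
    simp only [At, ih]
    constructor
    · rintro ⟨h0, h⟩ j hj
      cases j with
      | zero => exact h0
      | succ j => exact h j (by simpa using hj)
    · intro h
      exact ⟨h 0 (by simp), fun j hj => h (j + 1) (by simpa using hj)⟩

/-- Here the spoke closes the path `c`, whose two ends are both consumed. A second component would
be detected by a colouring, so no other column, label or edge may remain. -/
theorem good_loop {k n c : ℕ} {L rest : List ℕ} {p : Conf} (hk : rest.length + 1 = k)
    (hL : L.length = k + 1) (hc : c ≠ 0) (hcL : c ∉ L) (hcR : c ∉ rest) :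
    Good k (n + 1) L (c :: c :: rest) (.push true true true p) ↔
      (∀ x ∈ rest, x = 0) ∧ n = 0 ∧ (∀ x ∈ L, x = 0) ∧ p = .none := by
  constructor
  · intro h
    have tv := forall_lt_succ_iff.1 h.twoV
    have tw := forall_lt_succ_iff.1 h.twoW
    have hV : p.V 0 = false := by
      have := tv.1
      revert this
      cases h : p.V 0 <;> simp [Two, Conf.push, h]
    have hW : p.W rest.length = false := by
      have := tw.1
      revert this
      cases h : p.W rest.length <;> simp [Two, Conf.push, h, ← hk]
    -- The colouring that separates the closed cycle from everything else.
    have hcol : Colouring k (n + 1) L (c :: c :: rest) (.push true true true p)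
        (fun x => decide (x = c)) (push true fun _ => false) (push true fun _ => false) := by
      refine ⟨?_, ?_, ?_, ?_, ?_⟩
      · simp only [At, term, push_zero, zero_add, push_succ]
        refine ⟨by simp, by simp, at_iff.2 fun j hj _ => ?_⟩
        symm
        rw [decide_eq_false_iff_not]
        rintro rfl
        exact hcR (List.getElem_mem hj)
      · refine at_iff.2 fun j hj _ => ?_
        rw [term_succ_push]
        have : decide (L[j] = c) = false := by
          rw [decide_eq_false_iff_not]
          rintro rfl
          exact hcL (List.getElem_mem hj)
        rw [this]
        cases j <;> rfl
      · rintro (_ | i) _ _ <;> rfl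
      · rintro (_ | i) _ h'
        · simp [Conf.push, hV] at h'
        · rfl
      · rintro (_ | i) _ h'
        · simp [Conf.push, ← hk, hW] at h'
        · rw [show i + 1 + k = i + k + 1 by omega]
          rfl
    obtain ⟨e, he⟩ := h.conn _ _ _ hcol
    have he1 : true = e := (he.vert 0 (by omega)).1
    subst he1
    have hn : n = 0 := by
      by_contra hn
      exact absurd (he.vert 1 (by omega)).1 (by simp [push])
    subst hn
    have hr0 : ∀ x ∈ rest, x = 0 := fun x hx => by
      by_contra h0
      have := he.right x (by simp [hx]) h0
      simp only [decide_eq_true_iff] at this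
      exact hcR (this ▸ hx)
    refine ⟨hr0, rfl, fun x hx => ?_, ?_⟩
    · by_contra h0
      have := he.left x hx h0
      simp only [decide_eq_true_iff] at this
      exact hcL (this ▸ hx)
    · have hr := h.right
      simp only [At, term, zero_add, Conf.push, push_succ] at hr
      ext i
      · cases i with
        | zero => exact hV
        | succ i => exact h.suppV (i + 2) (by omega)
      · rcases lt_trichotomy i rest.length with hi | rfl | hi
        · rw [at_iff.1 hr.2.2 i hi, hr0 _ (List.getElem_mem hi)]
          rfl
        · exact hW
        · exact h.suppW (i + 1) (by omega)
      · exact h.suppS (i + 1) (by omega)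
  · rintro ⟨hr0, rfl, hl0, rfl⟩
    refine ⟨hL, by simp [← hk], ?_, ?_, ?_, ?_, ?_, ?_, ?_, .inl (by omega), ?_⟩
    · simp only [At, term, zero_add, Conf.push, push_succ, push_zero]
      exact ⟨by simp [hc], by simp [hc], at_iff.2 fun j hj => by
        simp [hr0 _ (List.getElem_mem hj), Conf.none]⟩
    · refine at_iff.2 fun j hj => ?_
      rw [hl0 _ (List.getElem_mem hj)]
      simp only [Conf.push]
      rw [term_succ_push]
      cases j <;> rfl
    · exact forall_lt_succ_iff.2 ⟨rfl, by simp⟩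
    · refine forall_lt_succ_iff.2 ⟨?_, by simp⟩
      rw [← hk]
      rfl
    · rintro (_ | i) hi
      · omega
      · rfl
    · rintro (_ | i) hi
      · omega
      · rfl
    · rintro (_ | i) hi
      · omega
      · rfl
    · intro X Y Z hcol
      have hr := hcol.right
      simp only [At, term, zero_add] at hr
      refine ⟨X c, fun x hx h0 => absurd (hl0 x hx) h0, fun x hx h0 => ?_,
        forall_lt_succ_iff.2 ⟨⟨hr.1 hc, hr.2.1 hc⟩, by simp⟩⟩
      simp only [List.mem_cons] at hx
      rcases hx with rfl | rfl | hx
      · rfl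
      · rfl
      · exact absurd (hr0 x hx) h0

/-- The completions of the state `(L, R)` by `n` columns; `R = []` is the state in which the cycle
is closed already. -/
def Sols (k n : ℕ) (L R : List ℕ) : Set Conf :=
  {p | Good k n L R p ∨ (R = [] ∧ n = 0 ∧ (∀ x ∈ L, x = 0) ∧ p = .none)}

/-- The number of completions of the state `(L, R)` by `n` columns. -/
noncomputable def count (k n : ℕ) (L R : List ℕ) : ℕ := (Sols k n L R).ncard

/-- The support conditions leave only finitely many Boolean values free. -/
theorem finite_good (k n : ℕ) (L R : List ℕ) : {p | Good k n L R p}.Finite := by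
  let f : Conf → Fin (n + k + 1) → Bool × Bool × Bool := fun p i => (p.V i, p.W i, p.S i)
  refine Set.Finite.of_finite_image (f := f) (Set.toFinite _) fun p hp q hq h => ?_
  have hfun : ∀ i (hi : i < n + k + 1), (p.V i, p.W i, p.S i) = (q.V i, q.W i, q.S i) :=
    fun i hi => congrFun h ⟨i, hi⟩
  ext i
  · rcases lt_or_ge i (n + k + 1) with hi | hi
    · exact congrArg Prod.fst (hfun i hi)
    · rw [hp.suppV i (by omega), hq.suppV i (by omega)]
  · rcases lt_or_ge i (n + k + 1) with hi | hi
    · exact congrArg (fun t => t.2.1) (hfun i hi)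
    · rw [hp.suppW i (by omega), hq.suppW i (by omega)]
  · rcases lt_or_ge i (n + k + 1) with hi | hi
    · exact congrArg (fun t => t.2.2) (hfun i hi)
    · rw [hp.suppS i (by omega), hq.suppS i (by omega)]

theorem sols_cons (k n : ℕ) (L : List ℕ) (a : ℕ) (R : List ℕ) :
    Sols k n L (a :: R) = {p | Good k n L (a :: R) p} := by
  simp [Sols]

theorem count_nil_succ (k n : ℕ) (L : List ℕ) : count k (n + 1) L [] = 0 := by
  have : Sols k (n + 1) L [] = ∅ := by
    ext p
    simp only [Sols, Set.mem_ofPred_eq, Set.mem_empty_iff_false, iff_false]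
    rintro (h | h)
    · exact absurd h.lenR (by simp)
    · exact absurd h.2.1 (by simp)
  rw [count, this, Set.ncard_empty]

theorem count_nil_zero (k : ℕ) (L : List ℕ) :
    count k 0 L [] = if ∀ x ∈ L, x = 0 then 1 else 0 := by
  have : Sols k 0 L [] = if ∀ x ∈ L, x = 0 then {Conf.none} else ∅ := by
    split_ifs with hL
    · ext p
      simp only [Sols, Set.mem_ofPred_eq, Set.mem_singleton_iff]
      constructor
      · rintro (h | h)
        · exact absurd h.lenR (by simp)
        · exact h.2.2.2
      · rintro rfl
        exact .inr ⟨by simp, by simp, hL, rfl⟩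
    · ext p
      simp only [Sols, Set.mem_ofPred_eq, Set.mem_empty_iff_false, iff_false]
      rintro (h | h)
      · exact absurd h.lenR (by simp)
      · exact hL h.2.2.1
  rw [count, this]
  split_ifs <;> simp

/-- The labels `a` and `b` prescribe the edges that enter the column, so only the spoke is free. -/
theorem count_succ_eq (k n : ℕ) (L : List ℕ) (a b : ℕ) (rest : List ℕ) :
    count k (n + 1) L (a :: b :: rest) =
      {p | Good k (n + 1) L (a :: b :: rest)
        (.push (decide (a ≠ 0)) (decide (b ≠ 0)) false p)}.ncard +
      {p | Good k (n + 1) L (a :: b :: rest)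
        (.push (decide (a ≠ 0)) (decide (b ≠ 0)) true p)}.ncard := by
  have hfin := finite_good k (n + 1) L (a :: b :: rest)
  have himage : ∀ s, (Conf.push (decide (a ≠ 0)) (decide (b ≠ 0)) s ''
      {p | Good k (n + 1) L (a :: b :: rest) (.push (decide (a ≠ 0)) (decide (b ≠ 0)) s p)}) ⊆
      {p | Good k (n + 1) L (a :: b :: rest) p} := by
    rintro s _ ⟨p, hp, rfl⟩
    exact hp
  have e1 := Set.ncard_image_of_injective
    {p | Good k (n + 1) L (a :: b :: rest) (.push (decide (a ≠ 0)) (decide (b ≠ 0)) false p)}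
    (push_injective (decide (a ≠ 0)) (decide (b ≠ 0)) false)
  have e2 := Set.ncard_image_of_injective
    {p | Good k (n + 1) L (a :: b :: rest) (.push (decide (a ≠ 0)) (decide (b ≠ 0)) true p)}
    (push_injective (decide (a ≠ 0)) (decide (b ≠ 0)) true)
  rw [count, sols_cons, ← e1, ← e2, ← Set.ncard_union_eq ?_ (hfin.subset (himage _))
    (hfin.subset (himage _))]
  · congr 1
    ext p
    simp only [Set.mem_union, Set.mem_image, Set.mem_ofPred_eq]
    constructor
    · intro h
      have hr := h.right
      simp only [At, term, zero_add] at hr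
      have hp := push_tail p
      rw [hr.1, hr.2.1] at hp
      cases hs : p.S 0
      · rw [hs] at hp
        exact .inl ⟨p.tail, by rwa [hp], hp⟩
      · rw [hs] at hp
        exact .inr ⟨p.tail, by rwa [hp], hp⟩
    · rintro (⟨q, hq, rfl⟩ | ⟨q, hq, rfl⟩) <;> exact hq
  · rw [Set.disjoint_left]
    rintro _ ⟨p, -, rfl⟩ ⟨q, -, h⟩
    have : (Conf.push (decide (a ≠ 0)) (decide (b ≠ 0)) true q).S 0 =
      (Conf.push (decide (a ≠ 0)) (decide (b ≠ 0)) false p).S 0 := by rw [h]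
    simp [Conf.push] at this

/-! ### The transitions as identities between counts. -/

section Counts

variable {k n : ℕ} {L rest : List ℕ} {a b : ℕ} {G G' : ℕ → ℕ}

theorem ncard_pass (hk : rest.length + 1 = k) (ha : a ≠ 0) (hb : b ≠ 0)
    (h0 : ∀ z, Occurs L (a :: b :: rest) z → (G z = 0 ↔ z = 0))
    (hinj : ∀ z z', Occurs L (a :: b :: rest) z → Occurs L (a :: b :: rest) z' →
      G z = G z' → z = z') :
    {p | Good k (n + 1) L (a :: b :: rest)
        (.push (decide (a ≠ 0)) (decide (b ≠ 0)) false p)}.ncard =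
      count k n (L.map G) ((a :: (rest ++ [b])).map G) := by
  rw [List.map_cons, List.map_append, List.map_singleton, count, sols_cons]
  congr 1
  ext p
  simp only [Set.mem_ofPred_eq, ← good_pass hk ha hb h0 hinj]
  simp [ha, hb]

theorem count_swap (hk : rest.length + 1 = k) (hab : a = 0 ↔ b ≠ 0)
    (h0 : ∀ z, Occurs L (a :: b :: rest) z → (G z = 0 ↔ z = 0))
    (hinj : ∀ z z', Occurs L (a :: b :: rest) z → Occurs L (a :: b :: rest) z' →
      G z = G z' → z = z') :
    count k (n + 1) L (a :: b :: rest) =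
      count k n (L.map G) ((b :: (rest ++ [a])).map G) := by
  -- Without the spoke, the vertex whose rim edge does not enter would have degree at most one.
  have hz : {p | Good k (n + 1) L (a :: b :: rest)
      (.push (decide (a ≠ 0)) (decide (b ≠ 0)) false p)} = ∅ := by
    ext p
    simp only [Set.mem_ofPred_eq, Set.mem_empty_iff_false, iff_false]
    intro h
    have tv := h.twoV 0 (by omega)
    have tw := h.twoW 0 (by omega)
    by_cases ha : a = 0
    · simp only [Two, Conf.push, push_zero, ha] at tv
      revert tv
      cases (push (decide (0 ≠ 0)) p.V) (0 + 1) <;> simp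
    · have hb : b = 0 := by
        by_contra hb
        exact ha (hab.2 hb)
      simp only [Two, Conf.push, push_zero, hb] at tw
      revert tw
      cases (push (decide (0 ≠ 0)) p.W) (0 + k) <;> simp
  rw [count_succ_eq, hz, Set.ncard_empty,
    zero_add, List.map_cons, List.map_append, List.map_singleton, count, sols_cons]
  congr 1
  ext p
  simp only [Set.mem_ofPred_eq, ← good_swap hk hab h0 hinj]

theorem count_cup {f : ℕ} (hk : rest.length + 1 = k) (hf : f ≠ 0)
    (hf' : ¬ Occurs L (0 :: 0 :: rest) f)
    (h0 : ∀ z, z = f ∨ Occurs L (0 :: 0 :: rest) z → (G z = 0 ↔ z = 0))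
    (hinj : ∀ z z', z = f ∨ Occurs L (0 :: 0 :: rest) z → z' = f ∨ Occurs L (0 :: 0 :: rest) z' →
      G z = G z' → z = z') :
    count k (n + 1) L (0 :: 0 :: rest) =
      count k n (L.map G) ((f :: (rest ++ [f])).map G) := by
  have hz : {p | Good k (n + 1) L (0 :: 0 :: rest)
      (.push (decide (0 ≠ 0)) (decide (0 ≠ 0)) false p)} = ∅ := by
    ext p
    simp only [Set.mem_ofPred_eq, Set.mem_empty_iff_false, iff_false]
    intro h
    have tv := h.twoV 0 (by omega)
    simp only [Two, Conf.push, push_zero] at tv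
    revert tv
    cases (push (decide (0 ≠ 0)) p.V) (0 + 1) <;> simp
  rw [count_succ_eq, hz, Set.ncard_empty,
    zero_add, List.map_cons, List.map_append, List.map_singleton, count, sols_cons]
  congr 1
  ext p
  simp only [Set.mem_ofPred_eq, ← good_cup hk hf hf' h0 hinj]
  simp

theorem count_join (hk : rest.length + 1 = k) (ha : a ≠ 0) (hb : b ≠ 0)
    (h0 : ∀ z, Occurs L (a :: b :: rest) z → (G z = 0 ↔ z = 0))
    (hinj : ∀ z z', Occurs L (a :: b :: rest) z → Occurs L (a :: b :: rest) z' →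
      G z = G z' → z = z')
    (hab : ∃ z, (z ∈ L ∨ z ∈ rest) ∧ (z = a ∨ z = b))
    (h0' : ∀ z, z = 0 ∨ Occurs L rest z → (G' z = 0 ↔ z = 0))
    (hGab : G' a = G' b)
    (hinj' : ∀ z z', Occurs L (a :: b :: rest) z → Occurs L (a :: b :: rest) z' →
      G' z = G' z' → z = z' ∨ ((z = a ∨ z = b) ∧ (z' = a ∨ z' = b))) :
    count k (n + 1) L (a :: b :: rest) =
      count k n (L.map G) ((a :: (rest ++ [b])).map G) +
      count k n (L.map G') ((0 :: (rest ++ [0])).map G') := by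
  rw [count_succ_eq, ncard_pass hk ha hb h0 hinj, List.map_cons (f := G'), List.map_append (f := G'),
    List.map_singleton (f := G'), (h0' 0 (.inl rfl)).2 rfl]
  congr 1
  rw [count, sols_cons]
  congr 1
  ext p
  simp only [Set.mem_ofPred_eq, ← good_join hk ha hb hab (fun z hz => h0' z (.inr hz)) hGab hinj']
  simp [ha, hb]

/-- If the spoke is used the cycle is complete. The state `[]` records this and then admits only the
empty continuation. -/
theorem count_loop {c : ℕ} (hk : rest.length + 1 = k) (hL : L.length = k + 1) (hc : c ≠ 0)
    (hcL : c ∉ L) (hcR : c ∉ rest)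
    (h0 : ∀ z, Occurs L (c :: c :: rest) z → (G z = 0 ↔ z = 0))
    (hinj : ∀ z z', Occurs L (c :: c :: rest) z → Occurs L (c :: c :: rest) z' →
      G z = G z' → z = z') :
    count k (n + 1) L (c :: c :: rest) =
      count k n (L.map G) ((c :: (rest ++ [c])).map G) +
      if ∀ x ∈ rest, x = 0 then count k n L [] else 0 := by
  rw [count_succ_eq, ncard_pass hk hc hc h0 hinj]
  congr 1
  have hset : {p | Good k (n + 1) L (c :: c :: rest)
      (.push (decide (c ≠ 0)) (decide (c ≠ 0)) true p)} =
      if ∀ x ∈ rest, x = 0 then Sols k n L [] else ∅ := by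
    ext p
    have := good_loop (p := p) (n := n) hk hL hc hcL hcR
    simp only [ne_eq, hc, not_false_eq_true, decide_true, Set.mem_ofPred_eq]
    rw [this]
    split_ifs with hr
    · simp only [Sols, Set.mem_ofPred_eq]
      constructor
      · exact fun h => .inr ⟨by simp, h.2⟩
      · rintro (h | h)
        · exact absurd h.lenR (by simp)
        · exact ⟨hr, h.2⟩
    · simp only [Set.mem_empty_iff_false, iff_false]
      exact fun h => hr h.1
  rw [hset]
  split_ifs
  · rfl
  · simp

end Counts

/-! ### Closing a state without further columns -/

/-- Rename the label `b` to `a`. -/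
def rename (a b x : ℕ) : ℕ := if x = b then a else x

/-- Glueing the ends `R` to the ends `L` yields a single cycle. -/
def closes : ℕ → List ℕ → List ℕ → Bool
  | f + 1, a :: L, b :: R =>
    if a = 0 ∧ b = 0 then closes f L R
    else if a = 0 ∨ b = 0 then false
    else if a = b then L.all (· == 0) && R.all (· == 0)
    else closes f (L.map (rename a b)) (R.map (rename a b))
  | _, _, _ => false

theorem count_rename {a b : ℕ} (hab : a ≠ b) (l : List ℕ) :
    (l.map (rename a b)).count a = l.count a + l.count b := by
  induction l with
  | nil => simp
  | cons x l ih =>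
    simp only [List.map_cons, List.count_cons, ih, rename, beq_iff_eq]
    by_cases h1 : x = b
    · subst h1
      simp [Ne.symm hab]; omega
    · by_cases h2 : x = a
      · simp [h2, hab]; omega
      · simp [h1, h2]

theorem count_rename_of_ne {a b c : ℕ} (ha : c ≠ a) (hb : c ≠ b) (l : List ℕ) :
    (l.map (rename a b)).count c = l.count c := by
  induction l with
  | nil => simp
  | cons x l ih =>
    simp only [List.map_cons, List.count_cons, ih, rename, beq_iff_eq]
    by_cases h1 : x = b
    · subst h1
      simp [Ne.symm ha, Ne.symm hb]
    · simp [h1]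

theorem forall₂_of_forall_eq_zero {L R : List ℕ} (h : L.length = R.length)
    (hL : ∀ x ∈ L, x = 0) (hR : ∀ x ∈ R, x = 0) {P : ℕ → ℕ → Prop} (hP : P 0 0) :
    List.Forall₂ P L R := by
  induction L generalizing R with
  | nil => cases R with
    | nil => exact .nil
    | cons _ _ => simp at h
  | cons a L ih => cases R with
    | nil => simp at h
    | cons b R =>
      rw [hL a (by simp), hR b (by simp)]
      exact .cons hP (ih (by simpa using h) (fun x hx => hL x (by simp [hx]))
        fun x hx => hR x (by simp [hx]))

theorem forall₂_map_iff {P : ℕ → ℕ → Prop} {f : ℕ → ℕ} {L R : List ℕ} :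
    List.Forall₂ P (L.map f) (R.map f) ↔ List.Forall₂ (fun x y => P (f x) (f y)) L R := by
  rw [List.forall₂_map_left_iff, List.forall₂_map_right_iff]

/-- Glueing `R` to `L` connects all ends. -/
def Linked (L R : List ℕ) : Prop :=
  List.Forall₂ (fun a b => a = 0 ↔ b = 0) L R ∧
    ∀ X : ℕ → Bool, List.Forall₂ (fun a b => a ≠ 0 → X a = X b) L R →
      ∃ e, ∀ x, Occurs L R x → x ≠ 0 → X x = e

/-- Each label occurs twice. -/
def Paired (L R : List ℕ) : Prop := ∀ x, x ≠ 0 → Occurs L R x → L.count x + R.count x = 2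

theorem linked_cons_zero {L R : List ℕ} : Linked (0 :: L) (0 :: R) ↔ Linked L R := by
  simp only [Linked, List.forall₂_cons]
  refine and_congr (by simp) (forall_congr' fun X => ?_)
  simp only [ne_eq, not_true_eq_false, false_imp_iff, true_and]
  refine imp_congr_right fun _ => exists_congr fun e => forall_congr' fun x => ?_
  by_cases hx : x = 0 <;> simp [Occurs, hx]

/-- Glueing forces `a` and `b` to have the same colour, so the colouring factors through the
renaming. That one of the two labels still occurs keeps this colour visible once the glued pair is
dropped. -/
theorem linked_rename {a b : ℕ} {L R : List ℕ} (ha : a ≠ 0) (hb : b ≠ 0)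
    (hocc : Occurs L R a ∨ Occurs L R b) :
    Linked (a :: L) (b :: R) ↔ Linked (L.map (rename a b)) (R.map (rename a b)) := by
  have hz : ∀ x, rename a b x = 0 ↔ x = 0 := fun x => by
    unfold rename; split_ifs with h <;> simp_all
  have hmap : ∀ x, Occurs L R x →
      Occurs (L.map (rename a b)) (R.map (rename a b)) (rename a b x) := fun x hx =>
    hx.imp List.mem_map_of_mem List.mem_map_of_mem
  have hmap' : ∀ y, Occurs (L.map (rename a b)) (R.map (rename a b)) y →
      ∃ x, Occurs L R x ∧ rename a b x = y := by
    rintro y (hy | hy)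
    · obtain ⟨x, hx, rfl⟩ := List.mem_map.1 hy
      exact ⟨x, .inl hx, rfl⟩
    · obtain ⟨x, hx, rfl⟩ := List.mem_map.1 hy
      exact ⟨x, .inr hx, rfl⟩
  simp only [Linked, List.forall₂_cons, forall₂_map_iff, hz, ne_eq, ha, hb, true_and,
    not_false_eq_true, true_imp_iff]
  refine and_congr Iff.rfl ⟨fun h X hX => ?_, fun h X hX => ?_⟩
  · obtain ⟨e, he⟩ := h (fun x => X (rename a b x)) ⟨by simp [rename], hX⟩
    refine ⟨e, fun y hy h0 => ?_⟩
    obtain ⟨x, hx, rfl⟩ := hmap' y hy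
    exact he x (hx.imp (List.mem_cons_of_mem _) (List.mem_cons_of_mem _)) (by rwa [hz] at h0)
  · have hren : ∀ x, X (rename a b x) = X x := fun x => by
      unfold rename; split_ifs with h
      · rw [hX.1, h]
      · rfl
    obtain ⟨e, he⟩ := h X (by simpa only [hren] using hX.2)
    have he' : ∀ x, Occurs L R x → x ≠ 0 → X x = e := fun x hx h0 => by
      rw [← hren]
      exact he _ (hmap x hx) (by rwa [hz])
    have hae : X a = e := by
      rcases hocc with h | h
      · exact he' a h ha
      · rw [hX.1]
        exact he' b h hb
    refine ⟨e, fun x hx h0 => ?_⟩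
    simp only [Occurs, List.mem_cons] at hx
    rcases hx with (rfl | hx) | (rfl | hx)
    · exact hae
    · exact he' x (.inl hx) h0
    · exact hX.1.symm.trans hae
    · exact he' x (.inr hx) h0

/-- Terminals are glued one pair at a time. As every label occurs twice, glueing different labels
leaves another end of `a`, and the renaming keeps the labels paired. Glueing equal labels completes
a cycle, which must then be the only component. -/
theorem closes_iff (f : ℕ) (L R : List ℕ) (hL : L.length = f) (hR : R.length = f)
    (hp : Paired L R) :
    closes f L R = true ↔ (∃ x, Occurs L R x ∧ x ≠ 0) ∧ Linked L R := by
  induction f generalizing L R with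
  | zero =>
    obtain rfl := List.length_eq_zero_iff.1 hL
    obtain rfl := List.length_eq_zero_iff.1 hR
    simp [closes, Occurs]
  | succ f ih =>
    obtain ⟨a, L, rfl⟩ := List.exists_cons_of_length_eq_add_one hL
    obtain ⟨b, R, rfl⟩ := List.exists_cons_of_length_eq_add_one hR
    have hL' : L.length = f := by simpa using hL
    have hR' : R.length = f := by simpa using hR
    by_cases ha : a = 0
    · by_cases hb : b = 0
      · subst ha hb
        rw [linked_cons_zero, closes, if_pos ⟨rfl, rfl⟩, ih L R hL' hR']
        · refine and_congr (exists_congr fun x => ?_) Iff.rfl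
          by_cases hx : x = 0 <;> simp [Occurs, hx]
        · intro x h0 hx
          have := hp x h0 (hx.imp (List.mem_cons_of_mem _) (List.mem_cons_of_mem _))
          simpa [List.count_cons, Ne.symm h0] using this
      · simp [closes, ha, hb, Linked]
    · by_cases hb : b = 0
      · simp [closes, ha, hb, Linked]
      · by_cases hab : a = b
        · subst hab
          have hcount := hp a ha (.inl (by simp))
          simp only [List.count_cons_self] at hcount
          have haL : a ∉ L := fun h => by have := List.count_pos_iff.2 h; omega
          have haR : a ∉ R := fun h => by have := List.count_pos_iff.2 h; omega
          simp only [closes, ha, if_true, or_self, and_self, if_false, Bool.and_eq_true,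
            List.all_eq_true, beq_iff_eq]
          constructor
          · rintro ⟨h1, h2⟩
            refine ⟨⟨a, .inl (by simp), ha⟩, ?_, fun X hX => ⟨X a, fun x hx h0 => ?_⟩⟩
            · exact .cons Iff.rfl (forall₂_of_forall_eq_zero (hL'.trans hR'.symm) h1 h2 Iff.rfl)
            · simp only [Occurs, List.mem_cons] at hx
              rcases hx with (rfl | hx) | (rfl | hx)
              · rfl
              · exact absurd (h1 x hx) h0
              · rfl
              · exact absurd (h2 x hx) h0
          · rintro ⟨-, hl⟩
            have hne : ∀ x, Occurs L R x → decide (x = a) = false := by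
              rintro x (hx | hx) <;> rw [decide_eq_false_iff_not] <;> rintro rfl
              · exact haL hx
              · exact haR hx
            -- The colouring that separates `a` from the rest; `a` no longer occurs in `L` or `R`.
            obtain ⟨e, he⟩ := hl.2 (fun x => decide (x = a)) (by
              refine .cons (fun _ => rfl) ?_
              refine List.forall₂_iff_get.2 ⟨hL'.trans hR'.symm, fun i h1 h2 _ => ?_⟩
              rw [hne _ (.inl (List.get_mem _ _)), hne _ (.inr (List.get_mem _ _))])
            have he1 := he a (.inl (by simp)) ha
            constructor
            · intro x hx
              by_contra h0
              have := he x (.inl (by simp [hx])) h0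
              rw [hne x (.inl hx), ← he1] at this
              simp at this
            · intro x hx
              by_contra h0
              have := he x (.inr (by simp [hx])) h0
              rw [hne x (.inr hx), ← he1] at this
              simp at this
        · have hca := hp a ha (.inl (by simp))
          have hcb := hp b hb (.inr (by simp))
          simp only [List.count_cons, beq_iff_eq, hab, Ne.symm hab, if_true, if_false] at hca hcb
          have hocc : Occurs L R a := by
            by_contra h
            simp only [Occurs, not_or] at h
            rw [List.count_eq_zero.2 h.1, List.count_eq_zero.2 h.2] at hca
            omega
          have hra : rename a b a = a := by simp [rename, hab]
          rw [linked_rename ha hb (.inl hocc)]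
          simp only [closes, ha, hb, hab, or_self, and_self, if_false]
          rw [ih _ _ (by simpa using hL') (by simpa using hR')]
          · refine and_congr ⟨fun _ => ⟨a, .inl (by simp), ha⟩, fun _ => ⟨a, ?_, ha⟩⟩ Iff.rfl
            refine hocc.imp (fun h => ?_) fun h => ?_
            · exact List.mem_map.2 ⟨a, h, hra⟩
            · exact List.mem_map.2 ⟨a, h, hra⟩
          · intro x h0 hx
            have hxb : x ≠ b := by
              rintro rfl
              rcases hx with hx | hx <;>
              · obtain ⟨y, -, hy⟩ := List.mem_map.1 hx
                unfold rename at hy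
                split_ifs at hy with h
                · exact hab hy
                · exact h hy
            by_cases hxa : x = a
            · subst hxa
              rw [count_rename hab, count_rename hab]
              omega
            · rw [count_rename_of_ne hxa hxb, count_rename_of_ne hxa hxb]
              have := hp x h0 (by
                rcases hx with hx | hx <;>
                obtain ⟨y, hy, hxy⟩ := List.mem_map.1 hx <;>
                unfold rename at hxy <;> split_ifs at hxy with h
                · exact absurd hxy.symm hxa
                · exact .inl (by simp [← hxy, hy])
                · exact absurd hxy.symm hxa
                · exact .inr (by simp [← hxy, hy]))
              simpa [List.count_cons, Ne.symm hxa, Ne.symm hxb] using this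

/-- The configuration on the empty strip that belongs to the ends `R`. -/
def Conf.ofEnds (R : List ℕ) : Conf :=
  ⟨fun i => if i = 0 then decide (R.getD 0 0 ≠ 0) else false,
    fun i => decide (R.getD (i + 1) 0 ≠ 0), fun _ => false⟩

theorem at_getD_iff {Q : ℕ → ℕ → Prop} {L R : List ℕ} (h : L.length = R.length) :
    At (fun j x => Q x (R.getD j 0)) L ↔ List.Forall₂ Q L R := by
  induction L generalizing R with
  | nil => cases R with
    | nil => simp [At]
    | cons _ _ => simp at h
  | cons a L ih => cases R with
    | nil => simp at h
    | cons b R =>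
      simp only [At, List.forall₂_cons, List.getD_cons_zero, List.getD_cons_succ]
      rw [ih (by simpa using h)]

theorem term_ofEnds (R : List ℕ) (j : ℕ) :
    term 0 (Conf.ofEnds R).V (Conf.ofEnds R).W j = decide (R.getD j 0 ≠ 0) := by
  cases j <;> simp [term, Conf.ofEnds]

/-- With no columns the terminals of both sides coincide: `R` determines the configuration, and
connectedness concerns the labels alone. -/
theorem good_zero_iff {k : ℕ} {L R : List ℕ} {p : Conf} (hL : L.length = k + 1)
    (hR : R.length = k + 1) :
    Good k 0 L R p ↔ p = .ofEnds R ∧ (∃ x, Occurs L R x ∧ x ≠ 0) ∧ Linked L R := by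
  have hRat : ∀ P : ℕ → ℕ → Prop, (∀ j, P j (R.getD j 0)) → At P R := fun P h =>
    at_iff.2 fun j hj => by have := h j; rwa [List.getD_eq_getElem _ _ hj] at this
  have hRat' : ∀ P : ℕ → ℕ → Prop, At P R → ∀ j < k + 1, P j (R.getD j 0) := fun P h j hj => by
    have := at_iff.1 h j (by omega)
    rwa [List.getD_eq_getElem _ _ (by omega)]
  have hconn : List.Forall₂ (fun a b => a = 0 ↔ b = 0) L R →
      ((∀ X Y Z, Colouring k 0 L R (.ofEnds R) X Y Z → ∃ b, Mono 0 L R X Y Z b) ↔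
      ∀ X : ℕ → Bool, List.Forall₂ (fun a b => a ≠ 0 → X a = X b) L R →
      ∃ e, ∀ x, Occurs L R x → x ≠ 0 → X x = e) := by
    intro hz
    constructor
    · intro h X hX
      have hterm : ∀ j, term 0 (fun _ => X (R.getD 0 0)) (fun i => X (R.getD (i + 1) 0)) j =
          X (R.getD j 0) := by
        rintro (_ | j) <;> simp [term]
      -- There are no vertices in the strip; `Y` and `Z` only carry the colours of the terminals.
      obtain ⟨b, hb⟩ := h X (fun _ => X (R.getD 0 0)) (fun i => X (R.getD (i + 1) 0))
        ⟨hRat _ fun j _ => hterm j, by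
          have := (at_getD_iff (Q := fun a b => a ≠ 0 → X a = X b) (hL.trans hR.symm)).2 hX
          exact this.imp fun j x _ hx h0 => (hterm j).trans (hx h0).symm,
          by simp, by simp, by simp⟩
      exact ⟨b, fun x hx h0 => hx.elim (fun hx => hb.left x hx h0) fun hx => hb.right x hx h0⟩
    · intro h X Y Z hcol
      obtain ⟨e, he⟩ := h X (by
        refine (at_getD_iff (Q := fun a b => a ≠ 0 → X a = X b) (hL.trans hR.symm)).1 ?_
        have hz' := (at_getD_iff (Q := fun a b => (a = 0 ↔ b = 0)) (hL.trans hR.symm)).2 hz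
        rw [at_iff] at hz' ⊢
        intro j hj h0
        rw [← at_iff.1 hcol.left j hj h0, hRat' _ hcol.right j (by omega) fun h => h0 ?_]
        exact (hz' j hj).2 h)
      exact ⟨e, ⟨fun x hx => he x (.inl hx), fun x hx => he x (.inr hx), by simp⟩⟩
  constructor
  · intro h
    obtain rfl : p = .ofEnds R := by
      ext i
      · cases i with
        | zero => simpa [term, Conf.ofEnds] using hRat' _ h.right 0 (by omega)
        | succ i => simpa [Conf.ofEnds] using h.suppV (i + 1) (by omega)
      · rcases lt_or_ge i k with hi | hi
        · simpa [term, Conf.ofEnds] using hRat' _ h.right (i + 1) (by omega)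
        · rw [h.suppW i (by omega)]
          simp [Conf.ofEnds, List.getElem?_eq_none (show R.length ≤ i + 1 by omega)]
      · exact h.suppS i (by omega)
    have hz : List.Forall₂ (fun a b => a = 0 ↔ b = 0) L R := by
      refine (at_getD_iff (Q := fun a b => (a = 0 ↔ b = 0)) (hL.trans hR.symm)).1 ?_
      refine h.left.imp fun j x _ hx => ?_
      rw [term_ofEnds] at hx
      by_cases h0 : x = 0 <;> simp_all
    exact ⟨rfl, h.nonempty.resolve_left (by omega), hz, (hconn hz).1 h.conn⟩
  · rintro ⟨rfl, hne, hz, hl⟩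
    refine ⟨hL, hR, hRat _ fun j => term_ofEnds R j, ?_, by simp, by simp, fun i hi => ?_,
      fun i hi => ?_, fun _ _ => rfl, .inr hne, (hconn hz).2 hl⟩
    · refine ((at_getD_iff (Q := fun a b => (a = 0 ↔ b = 0)) (hL.trans hR.symm)).2 hz).imp
        fun j x _ hx => ?_
      rw [term_ofEnds]
      simp only [ne_eq, hx]
    · simp [Conf.ofEnds, show i ≠ 0 by omega]
    · simp [Conf.ofEnds, List.getElem?_eq_none (show R.length ≤ i + 1 by omega)]

theorem count_zero {k : ℕ} {L R : List ℕ} (hL : L.length = k + 1) (hR : R.length = k + 1)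
    (hp : Paired L R) : count k 0 L R = if closes (k + 1) L R then 1 else 0 := by
  have hc := closes_iff (k + 1) L R hL hR hp
  have hset : Sols k 0 L R = if closes (k + 1) L R then {Conf.ofEnds R} else ∅ := by
    obtain ⟨b, R, rfl⟩ := List.exists_cons_of_length_eq_add_one hR
    rw [sols_cons]
    ext p
    rw [Set.mem_ofPred_eq, good_zero_iff hL hR, ← hc]
    split_ifs with h <;> simp [h]
  rw [count, hset]
  split_ifs <;> simp

/-! ### Hamiltonian cycles as connected two-regular edge sets -/

section Cycle

variable {D V : Type*} {α β : D → D} {vert : D → V}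

/-- An orbit never runs back through itself. With f = β ∘ α and d' = f d, the equation f^(N+2) d = β
d gives f^N d' = β d'. This descent by two ends at a fixed point of β (N = 0) or of α (N = 1). -/
theorem iterate_ne (hα : ∀ d, α (α d) = d) (hα' : ∀ d, α d ≠ d) (hβ : ∀ d, β (β d) = d)
    (hβ' : ∀ d, β d ≠ d) (N : ℕ) : ∀ d, (fun x => β (α x))^[N] d ≠ β d := by
  induction N using Nat.strong_induction_on with
  | _ N ih =>
    intro d h
    match N with
    | 0 => exact hβ' d h.symm
    | 1 =>
      have : α d = d := by
        have h2 := congrArg β h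
        simpa [hβ] using h2
      exact hα' d this
    | N + 2 =>
      rw [Function.iterate_succ_apply, Function.iterate_succ_apply'] at h
      have h2 := congrArg α (congrArg β h)
      simp only [hβ, hα] at h2
      refine ih N (by omega) (β (α d)) ?_
      rw [h2, hβ]

/-- Think of `α` as reversing a dart and of `β` as exchanging the two darts at a vertex; then β ∘ α
walks along the cycle. Within one period its orbit does not revisit a vertex, by `iterate_ne`. The
set of visited vertices is closed under adjacency, hence contains all vertices. -/
theorem exists_cyclic_order [Finite D] (hα : ∀ d, α (α d) = d) (hα' : ∀ d, α d ≠ d)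
    (hβ : ∀ d, β (β d) = d) (hβ' : ∀ d, β d ≠ d)
    (hv : ∀ d d', vert d = vert d' ↔ d' = d ∨ d' = β d)
    (hconn : ∀ S : Set V, S.Nonempty → (∀ d, vert d ∈ S → vert (α d) ∈ S) → S = Set.univ) (d₀ : D) :
    ∃ m : ℕ, 0 < m ∧ ∃ x : ZMod m → D, Function.Bijective (vert ∘ x) ∧
      (∀ i, vert (α (x i)) = vert (x (i + 1))) ∧ ∀ d, ∃ i, d = x i ∨ d = α (x i) := by
  set f : D → D := fun x => β (α x) with hf
  have hinj : Function.Injective f := fun a b h => by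
    have h2 := congrArg α (congrArg β h)
    simpa [hf, hα, hβ] using h2
  set m := Function.minimalPeriod f d₀ with hm
  have hmpos : 0 < m :=
    Function.minimalPeriod_pos_of_mem_periodicPts (hinj.mem_periodicPts d₀)
  have : NeZero m := ⟨hmpos.ne'⟩
  have hmod : ∀ j, f^[j % m] d₀ = f^[j] d₀ := fun j => Function.iterate_mod_minimalPeriod_eq
  have hvβ : ∀ d, vert (β d) = vert d := fun d => ((hv d (β d)).2 (.inr rfl)).symm
  have hx : ∀ j : ℕ, f^[(j : ZMod m).val] d₀ = f^[j] d₀ := fun j => by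
    rw [ZMod.val_natCast, hmod]
  -- The inverse of the walk, α ∘ β, also stays in the orbit, because the orbit is periodic.
  have hback : ∀ j, ∃ j', α (β (f^[j] d₀)) = f^[j'] d₀ := fun j => by
    refine ⟨j + (m - 1), ?_⟩
    have h1 : f^[j] d₀ = f^[(j + (m - 1)) + 1] d₀ := by
      rw [show j + (m - 1) + 1 = j + m by omega, ← hmod (j + m), Nat.add_mod_right, hmod]
    rw [h1, Function.iterate_succ_apply']
    simp only [hf, hβ, hα]
  have hsurj : ∀ v, ∃ j, v = vert (f^[j] d₀) := by
    have := hconn {v | ∃ j, v = vert (f^[j] d₀)} ⟨vert d₀, 0, rfl⟩ (by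
      rintro d ⟨j, hj⟩
      rcases (hv _ _).1 hj.symm with rfl | rfl
      · exact ⟨j + 1, by rw [Function.iterate_succ_apply', hf, hvβ]⟩
      · obtain ⟨j', hj'⟩ := hback j
        exact ⟨j', by rw [hj']⟩)
    intro v
    have hv : v ∈ {v | ∃ j, v = vert (f^[j] d₀)} := this ▸ Set.mem_univ v
    exact hv
  have hle : ∀ i j, i ≤ j → j < m → vert (f^[i] d₀) = vert (f^[j] d₀) → i = j := by
    intro i j hij hj h
    have hj' : f^[j] d₀ = f^[j - i] (f^[i] d₀) := by
      rw [← Function.iterate_add_apply, Nat.sub_add_cancel hij]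
    rcases (hv _ _).1 h with h | h
    · exact ((Function.iterate_eq_iterate_iff_of_lt_minimalPeriod hj (by omega)).1 h).symm
    · exact absurd (hj' ▸ h) (iterate_ne hα hα' hβ hβ' _ _)
  refine ⟨m, hmpos, fun i => f^[i.val] d₀, ⟨fun i j h => ?_, fun v => ?_⟩, fun i => ?_, fun d => ?_⟩
  · apply ZMod.val_injective m
    rcases le_total i.val j.val with hij | hij
    · exact hle _ _ hij (ZMod.val_lt j) h
    · exact (hle _ _ hij (ZMod.val_lt i) h.symm).symm
  · obtain ⟨j, rfl⟩ := hsurj v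
    exact ⟨(j : ZMod m), by simp only [Function.comp, hx]⟩
  · have : i + 1 = ((i.val + 1 : ℕ) : ZMod m) := by simp
    simp only
    rw [this, hx, Function.iterate_succ_apply', hf, hvβ]
  · obtain ⟨j, hj⟩ := hsurj (vert d)
    rcases (hv _ _).1 hj.symm with rfl | rfl
    · exact ⟨(j : ZMod m), .inl (by simp only [hx])⟩
    · obtain ⟨j', hj'⟩ := hback j
      refine ⟨(j' : ZMod m), .inr ?_⟩
      simp only [hx]
      rw [← hj', hα]

end Cycle

/-- An edge of `G(n, k)` with one of its two orientations. -/
abbrev Dart (n : ℕ) : Type := Edge n × Bool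

/-- The vertex where a dart starts. -/
def vert (n k : ℕ) : Dart n → Vertex n
  | (.outer i, false) => .v i
  | (.outer i, true) => .v (i + 1)
  | (.inner i, false) => .w i
  | (.inner i, true) => .w (i + k)
  | (.spoke i, false) => .v i
  | (.spoke i, true) => .w i

/-- The dart with the opposite orientation. -/
def flip {n : ℕ} (d : Dart n) : Dart n := (d.1, !d.2)

theorem flip_flip {n : ℕ} (d : Dart n) : flip (flip d) = d := by simp [flip]

theorem isLink_iff {n k : ℕ} {e : Edge n} {x y : Vertex n} :
    (petersen n k).IsLink e x y ↔ ∃ d : Dart n, d.1 = e ∧ vert n k d = x ∧ vert n k (flip d) = y := by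
  change ends n k e = s(x, y) ↔ _
  constructor
  · intro h
    cases e with
    | outer i =>
      rcases Sym2.eq_iff.1 h with ⟨rfl, rfl⟩ | ⟨rfl, rfl⟩
      · exact ⟨(.outer i, false), rfl, rfl, rfl⟩
      · exact ⟨(.outer i, true), rfl, rfl, rfl⟩
    | inner i =>
      rcases Sym2.eq_iff.1 h with ⟨rfl, rfl⟩ | ⟨rfl, rfl⟩
      · exact ⟨(.inner i, false), rfl, rfl, rfl⟩
      · exact ⟨(.inner i, true), rfl, rfl, rfl⟩
    | spoke i =>
      rcases Sym2.eq_iff.1 h with ⟨rfl, rfl⟩ | ⟨rfl, rfl⟩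
      · exact ⟨(.spoke i, false), rfl, rfl, rfl⟩
      · exact ⟨(.spoke i, true), rfl, rfl, rfl⟩
  · rintro ⟨⟨e, b⟩, rfl, rfl, rfl⟩
    cases e <;> cases b <;> simp [ends, vert, flip, Sym2.eq_swap]

/-- Counting darts instead of edges gives three different ones at each vertex even where there are
loops or parallel edges. -/
theorem vert_eq_v {n k : ℕ} {d : Dart n} {i : ZMod n} :
    vert n k d = .v i ↔ d = (.outer (i - 1), true) ∨ d = (.spoke i, false) ∨
      d = (.outer i, false) := by
  obtain ⟨e, b⟩ := d
  cases e <;> cases b <;> simp [vert, eq_sub_iff_add_eq]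

theorem vert_eq_w {n k : ℕ} {d : Dart n} {i : ZMod n} :
    vert n k d = .w i ↔ d = (.inner (i - (k : ZMod n)), true) ∨ d = (.spoke i, true) ∨
      d = (.inner i, false) := by
  obtain ⟨e, b⟩ := d
  cases e <;> cases b <;> simp [vert, eq_sub_iff_add_eq]

open Classical in
/-- Every vertex is the start of exactly two darts that belong to `C`. -/
structure Regular {n : ℕ} (k : ℕ) (C : Set (Edge n)) : Prop where
  v : ∀ i : ZMod n, Two (decide (.outer (i - 1) ∈ C)) (decide (.spoke i ∈ C)) (decide (.outer i ∈ C))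
  w : ∀ i : ZMod n, Two (decide (.inner (i - (k : ZMod n)) ∈ C)) (decide (.spoke i ∈ C)) (decide (.inner i ∈ C))

/-- The edges in `C` connect all vertices. -/
def Spans {n : ℕ} (k : ℕ) (C : Set (Edge n)) : Prop :=
  ∀ T : Vertex n → Bool,
    (∀ d : Dart n, d.1 ∈ C → T (vert n k d) = T (vert n k (flip d))) → ∀ x y, T x = T y

open Classical in
theorem two_iff_exists_pair {n : ℕ} {C : Set (Edge n)} {a b c : Dart n}
    (hab : a ≠ b) (hac : a ≠ c) (hbc : b ≠ c) :
    Two (decide (a.1 ∈ C)) (decide (b.1 ∈ C)) (decide (c.1 ∈ C)) ↔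
      ∃ p q : Dart n, p ≠ q ∧ ∀ d, ((d = a ∨ d = b ∨ d = c) ∧ d.1 ∈ C) ↔ d = p ∨ d = q := by
  constructor
  · intro h
    by_cases ha : a.1 ∈ C <;> by_cases hb : b.1 ∈ C <;> by_cases hc : c.1 ∈ C <;>
      simp only [Two, ha, hb, hc, decide_true, decide_false, Bool.toNat_true, Bool.toNat_false] at h <;>
      try omega
    · refine ⟨a, b, hab, fun d => ⟨?_, ?_⟩⟩
      · rintro ⟨rfl | rfl | rfl, hd⟩ <;> simp_all
      · rintro (rfl | rfl) <;> simp_all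
    · refine ⟨a, c, hac, fun d => ⟨?_, ?_⟩⟩
      · rintro ⟨rfl | rfl | rfl, hd⟩ <;> simp_all
      · rintro (rfl | rfl) <;> simp_all
    · refine ⟨b, c, hbc, fun d => ⟨?_, ?_⟩⟩
      · rintro ⟨rfl | rfl | rfl, hd⟩ <;> simp_all
      · rintro (rfl | rfl) <;> simp_all
  · rintro ⟨p, q, hpq, h⟩
    have hp := (h p).2 (.inl rfl)
    have hq := (h q).2 (.inr rfl)
    have ha := h a
    have hb := h b
    have hc := h c
    simp only [true_or, or_true, true_and] at ha hb hc
    simp only [Two, ha, hb, hc]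
    rcases hp.1 with rfl | rfl | rfl <;> rcases hq.1 with rfl | rfl | rfl <;>
      first
      | exact absurd rfl hpq
      | simp_all [eq_comm]

open Classical in
theorem regular_iff {n k : ℕ} {C : Set (Edge n)} :
    Regular k C ↔ ∀ x : Vertex n, ∃ p q : Dart n, p ≠ q ∧
      ∀ d, (vert n k d = x ∧ d.1 ∈ C) ↔ d = p ∨ d = q := by
  have hv : ∀ i : ZMod n, Two (decide (.outer (i - 1) ∈ C)) (decide (.spoke i ∈ C))
      (decide (.outer i ∈ C)) ↔ ∃ p q : Dart n, p ≠ q ∧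
      ∀ d, (vert n k d = .v i ∧ d.1 ∈ C) ↔ d = p ∨ d = q := fun i => by
    simp only [vert_eq_v]
    exact two_iff_exists_pair (a := (.outer (i - 1), true)) (b := (.spoke i, false))
      (c := (.outer i, false)) (by simp) (by simp) (by simp)
  have hw : ∀ i : ZMod n, Two (decide (.inner (i - (k : ZMod n)) ∈ C)) (decide (.spoke i ∈ C))
      (decide (.inner i ∈ C)) ↔ ∃ p q : Dart n, p ≠ q ∧
      ∀ d, (vert n k d = .w i ∧ d.1 ∈ C) ↔ d = p ∨ d = q := fun i => by
    simp only [vert_eq_w]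
    exact two_iff_exists_pair (a := (.inner (i - (k : ZMod n)), true)) (b := (.spoke i, true))
      (c := (.inner i, false)) (by simp) (by simp) (by simp)
  constructor
  · rintro h (i | i)
    · exact (hv i).1 (h.v i)
    · exact (hw i).1 (h.w i)
  · exact fun h => ⟨fun i => (hv i).2 (h (.v i)), fun i => (hw i).2 (h (.w i))⟩

/-- The vertices are two copies of the integers modulo `n`. -/
def vertexEquiv (n : ℕ) : Vertex n ≃ ZMod n ⊕ ZMod n where
  toFun | .v i => .inl i | .w i => .inr i
  invFun | .inl i => .v i | .inr i => .w i
  left_inv x := by cases x <;> rfl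
  right_inv x := by cases x <;> rfl

/-- The edges are three copies of the integers modulo `n`. -/
def edgeEquiv (n : ℕ) : Edge n ≃ ZMod n ⊕ ZMod n ⊕ ZMod n where
  toFun | .outer i => .inl i | .inner i => .inr (.inl i) | .spoke i => .inr (.inr i)
  invFun | .inl i => .outer i | .inr (.inl i) => .inner i | .inr (.inr i) => .spoke i
  left_inv x := by cases x <;> rfl
  right_inv x := by rcases x with _ | _ | _ <;> rfl

instance (n : ℕ) [NeZero n] : Finite (Edge n) := Finite.of_equiv _ (edgeEquiv n).symm

theorem card_vertex (n : ℕ) [NeZero n] : Nat.card (Vertex n) = 2 * n := by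
  rw [Nat.card_congr (vertexEquiv n), Nat.card_sum, Nat.card_zmod]
  omega

/-- Regularity pairs each dart of `C` with the other dart of `C` at its vertex. This pairing and the
reversal are the two involutions of `exists_cyclic_order`. -/
theorem isHamiltonianCycle_of_regular {n k : ℕ} [NeZero n] {C : Set (Edge n)}
    (hr : Regular k C) (hs : Spans k C) : IsHamiltonianCycle (petersen n k) C := by
  classical
  rw [regular_iff] at hr
  have hother : ∀ d : {d : Dart n // d.1 ∈ C}, ∃ d' : {d : Dart n // d.1 ∈ C}, d' ≠ d ∧
      ∀ d'' : {d : Dart n // d.1 ∈ C}, vert n k d.1 = vert n k d''.1 ↔ d'' = d ∨ d'' = d' := by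
    rintro ⟨d, hd⟩
    obtain ⟨p, q, hpq, h⟩ := hr (vert n k d)
    have hp := (h p).2 (.inl rfl)
    have hq := (h q).2 (.inr rfl)
    rcases (h d).1 ⟨rfl, hd⟩ with rfl | rfl
    · refine ⟨⟨q, hq.2⟩, fun h => hpq (congrArg Subtype.val h).symm, ?_⟩
      rintro ⟨d'', hd''⟩
      rw [eq_comm]
      refine Iff.trans ⟨fun e => (h d'').1 ⟨e, hd''⟩, fun e => ((h d'').2 e).1⟩ ?_
      simp [Subtype.ext_iff]
    · refine ⟨⟨p, hp.2⟩, fun h => hpq (congrArg Subtype.val h), ?_⟩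
      rintro ⟨d'', hd''⟩
      rw [eq_comm]
      refine Iff.trans ⟨fun e => (h d'').1 ⟨e, hd''⟩, fun e => ((h d'').2 e).1⟩ ?_
      rw [or_comm]
      simp [Subtype.ext_iff]
  choose β hβ' hv using hother
  have hβ : ∀ d, β (β d) = d := fun d => by
    have h1 := (hv d (β d)).2 (.inr rfl)
    rcases (hv (β d) d).1 h1.symm with h | h
    · exact absurd h.symm (hβ' d)
    · exact h.symm
  obtain ⟨p, q, -, hpq⟩ := hr (.v 0)
  have hp := (hpq p).2 (.inl rfl)
  obtain ⟨m, hm, x, hbij, hlink, hrange⟩ := exists_cyclic_order (D := {d : Dart n // d.1 ∈ C}) (V := Vertex n)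
    (α := fun d => ⟨flip d.1, d.2⟩) (β := β) (vert := fun d => vert n k d.1)
    (fun d => Subtype.ext (flip_flip d.1))
    (fun d h => by
      have := congrArg (fun d : {d : Dart n // d.1 ∈ C} => d.1.2) h
      simp [flip] at this) hβ hβ' hv
    (fun S hS hcl => by
      have hcl' : ∀ d : Dart n, d.1 ∈ C →
          decide (vert n k d ∈ S) = decide (vert n k (flip d) ∈ S) := fun d hd => by
        have h1 := hcl ⟨d, hd⟩
        have h2 := hcl ⟨flip d, hd⟩
        simp only [flip_flip] at h1 h2
        simp only [decide_eq_decide]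
        exact ⟨h1, h2⟩
      obtain ⟨y, hy⟩ := hS
      refine Set.eq_univ_of_forall fun z => ?_
      have := hs (fun z => decide (z ∈ S)) hcl' y z
      simpa [hy] using this)
    ⟨p, hp.2⟩
  refine ⟨m, hm, fun i => vert n k (x i).1, fun i => (x i).1.1, ?_, fun i => ?_, ?_⟩
  · exact Set.bijOn_univ.2 hbij
  · exact isLink_iff.2 ⟨(x i).1, rfl, rfl, hlink i⟩
  · ext e
    constructor
    · intro he
      obtain ⟨i, hi⟩ := hrange ⟨(e, false), he⟩
      refine ⟨i, ?_⟩
      rcases hi with hi | hi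
      · exact (congrArg (fun d : {d : Dart n // d.1 ∈ C} => d.1.1) hi).symm
      · exact (congrArg (fun d : {d : Dart n // d.1 ∈ C} => d.1.1) hi).symm
    · rintro ⟨i, rfl⟩
      exact (x i).2

/-- At each vertex the walk uses the dart by which it leaves and the reverse of the one by which it
arrives. If these were equal, the vertices before and after would coincide, so that 2 = 0 modulo m;
but m = 2n is at least 4. This is where n = 1 has to be excluded. -/
theorem IsHamiltonianCycle.regular_spans {n k : ℕ} (hn : 2 ≤ n) {C : Set (Edge n)}
    (h : IsHamiltonianCycle (petersen n k) C) : Regular k C ∧ Spans k C := by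
  have : NeZero n := ⟨by omega⟩
  obtain ⟨m, hm, u, e, hbij, hlink, rfl⟩ := h
  have : NeZero m := ⟨hm.ne'⟩
  have hbij : Function.Bijective u := Set.bijOn_univ.1 hbij
  have hm3 : 3 ≤ m := by
    have := Nat.card_congr (Equiv.ofBijective u hbij)
    rw [Nat.card_zmod, card_vertex] at this
    omega
  choose d hd1 hd2 hd3 using fun i => isLink_iff.1 (hlink i)
  have h1 : (1 : ZMod m) ≠ 0 := by
    have : ((1 : ℕ) : ZMod m) ≠ 0 := by
      rw [Ne, ZMod.natCast_eq_zero_iff]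
      exact fun h => by have := Nat.le_of_dvd (by omega) h; omega
    simpa using this
  have h2 : (1 : ZMod m) + 1 ≠ 0 := by
    have : ((2 : ℕ) : ZMod m) ≠ 0 := by
      rw [Ne, ZMod.natCast_eq_zero_iff]
      exact fun h => by have := Nat.le_of_dvd (by omega) h; omega
    rwa [Nat.cast_ofNat, ← one_add_one_eq_two] at this
  constructor
  · rw [regular_iff]
    intro x
    obtain ⟨j, rfl⟩ := hbij.2 x
    refine ⟨d j, flip (d (j - 1)), fun h => ?_, fun c => ⟨?_, ?_⟩⟩
    · have := congrArg (fun c => vert n k (flip c)) h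
      simp only [flip_flip, hd2, hd3] at this
      have := hbij.1 this
      exact h2 (by linear_combination this)
    · rintro ⟨hc, l, hl⟩
      have hcl : c = d l ∨ c = flip (d l) := by
        rw [← hd1] at hl
        obtain ⟨c1, c2⟩ := c
        simp only at hl
        subst hl
        cases h : (d l).2 <;> cases c2 <;> simp [Prod.ext_iff, flip, h]
      rcases hcl with rfl | rfl
      · rw [hd2] at hc
        rw [hbij.1 hc]
        exact .inl rfl
      · rw [hd3] at hc
        rw [← hbij.1 hc]
        simp
    · rintro (rfl | rfl)
      · exact ⟨hd2 j, j, (hd1 j).symm⟩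
      · refine ⟨?_, j - 1, (hd1 _).symm⟩
        rw [hd3]
        simp
  · intro T hT
    have hstep : ∀ i, T (u i) = T (u (i + 1)) := fun i => by
      have := hT (d i) ⟨i, (hd1 i).symm⟩
      rwa [hd2, hd3] at this
    have hall : ∀ j : ℕ, T (u (j : ZMod m)) = T (u 0) := by
      intro j
      induction j with
      | zero => simp
      | succ j ih => rw [Nat.cast_succ, ← hstep, ih]
    intro x y
    obtain ⟨i, rfl⟩ := hbij.2 x
    obtain ⟨j, rfl⟩ := hbij.2 y
    rw [← ZMod.natCast_zmod_val i, ← ZMod.natCast_zmod_val j, hall, hall]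

theorem isHamiltonianCycle_iff {n k : ℕ} (hn : 2 ≤ n) {C : Set (Edge n)} :
    IsHamiltonianCycle (petersen n k) C ↔ Regular k C ∧ Spans k C := by
  have : NeZero n := ⟨by omega⟩
  exact ⟨fun h => h.regular_spans hn, fun h => isHamiltonianCycle_of_regular h.1 h.2⟩

/-- The walk along the only spoke is the only Hamiltonian cycle of `G(1, k)`. -/
theorem h_one (k : ℕ) : h k 1 = 1 := by
  have hsub : ∀ i j : ZMod 1, i = j := fun i j => Subsingleton.elim _ _
  have : {C : Set (Edge 1) | IsHamiltonianCycle (petersen 1 k) C} = {{Edge.spoke 0}} := by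
    ext C
    simp only [Set.mem_ofPred_eq, Set.mem_singleton_iff]
    constructor
    · rintro ⟨m, hm, u, e, hbij, hlink, rfl⟩
      have : NeZero m := ⟨hm.ne'⟩
      have hbij : Function.Bijective u := Set.bijOn_univ.1 hbij
      have hm2 : m = 2 := by
        have := Nat.card_congr (Equiv.ofBijective u hbij)
        rwa [Nat.card_zmod, card_vertex] at this
      subst hm2
      -- For n = 1 the outer and the inner edge are loops, while consecutive vertices of the walk
      -- differ.
      have he : ∀ i, e i = .spoke 0 := fun i => by
        obtain ⟨⟨e', b⟩, h1, h2, h3⟩ := isLink_iff.1 (hlink i)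
        have hne : u i ≠ u (i + 1) := fun h => by
          have key : ∀ i : ZMod 2, i ≠ i + 1 := by decide
          exact key i (hbij.1 h)
        rw [← h1]
        cases e' with
        | outer i =>
          refine absurd ?_ hne
          rw [← h2, ← h3]
          cases b <;> exact congrArg Vertex.v (hsub _ _)
        | inner i =>
          refine absurd ?_ hne
          rw [← h2, ← h3]
          cases b <;> exact congrArg Vertex.w (hsub _ _)
        | spoke i => exact congrArg Edge.spoke (hsub _ _)
      ext x
      simp [he, eq_comm]
    · rintro rfl
      refine ⟨2, by omega, ![.v 0, .w 0], fun _ => .spoke 0, ?_, fun i => ?_, ?_⟩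
      · refine Set.bijOn_univ.2 ⟨fun i j h => ?_, fun x => ?_⟩
        · fin_cases i <;> fin_cases j <;> first | rfl | simp_all
        · cases x with
          | v i => exact ⟨0, congrArg Vertex.v (hsub _ _)⟩
          | w i => exact ⟨1, congrArg Vertex.w (hsub _ _)⟩
      · change s(Vertex.v 0, Vertex.w 0) = _
        fin_cases i
        · rfl
        · exact Sym2.eq_swap
      · ext x
        simp
  rw [h, this, Set.ncard_singleton]

/-! ### Hamiltonian cycles as completions of identity states -/

/-- Number the places marked `true` from left to right, starting with `c + 1`. -/
def numbering : ℕ → List Bool → List ℕ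
  | _, [] => []
  | c, b :: l => if b then (c + 1) :: numbering (c + 1) l else 0 :: numbering c l

@[simp] theorem length_numbering (c : ℕ) (l : List Bool) : (numbering c l).length = l.length := by
  induction l generalizing c with
  | nil => rfl
  | cons b l ih => cases b <;> simp [numbering, ih]

theorem map_numbering (c : ℕ) (l : List Bool) :
    (numbering c l).map (fun x => decide (x ≠ 0)) = l := by
  induction l generalizing c with
  | nil => rfl
  | cons b l ih =>
    cases b
    · simpa [numbering] using ih c
    · simpa [numbering] using ih (c + 1)

theorem lt_of_mem_numbering {c x : ℕ} {l : List Bool} (h : x ∈ numbering c l) (hx : x ≠ 0) :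
    c < x := by
  induction l generalizing c with
  | nil => simp [numbering] at h
  | cons b l ih =>
    cases b
    · simp only [numbering, Bool.false_eq_true, if_false, List.mem_cons, hx, false_or] at h
      exact ih h
    · simp only [numbering, if_true, List.mem_cons] at h
      rcases h with rfl | h
      · omega
      · have := ih h
        omega

theorem count_numbering_le {x : ℕ} (hx : x ≠ 0) (c : ℕ) (l : List Bool) :
    (numbering c l).count x ≤ 1 := by
  induction l generalizing c with
  | nil => simp [numbering]
  | cons b l ih =>
    cases b
    · simpa [numbering, List.count_cons, hx.symm] using ih c
    · by_cases h : x = c + 1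
      · subst h
        have : (numbering (c + 1) l).count (c + 1) = 0 :=
          List.count_eq_zero.2 fun h => by have := lt_of_mem_numbering h hx; omega
        simp [numbering, this]
      · simpa [numbering, List.count_cons, Ne.symm h] using ih (c + 1)

theorem getElem_inj_of_count_le_one {l : List ℕ} {i j : ℕ} (hi : i < l.length) (hj : j < l.length)
    (hc : l.count l[i] ≤ 1) (h : l[i] = l[j]) : i = j := by
  by_contra hij
  have := List.duplicate_iff_exists_distinct_get (l := l) (x := l[i])
  have h2 : List.Duplicate l[i] l := by
    rw [this]
    rcases lt_or_gt_of_ne hij with h' | h'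
    · exact ⟨⟨i, hi⟩, ⟨j, hj⟩, h', rfl, h⟩
    · exact ⟨⟨j, hj⟩, ⟨i, hi⟩, h', h, rfl⟩
  have := List.duplicate_iff_two_le_count.1 h2
  omega

/-- All lists of Booleans of a given length. -/
def boolLists : ℕ → List (List Bool)
  | 0 => [[]]
  | n + 1 => (boolLists n).map (List.cons false) ++ (boolLists n).map (List.cons true)

theorem mem_boolLists {n : ℕ} {l : List Bool} : l ∈ boolLists n ↔ l.length = n := by
  induction n generalizing l with
  | zero => simp [boolLists]
  | succ n ih =>
    cases l with
    | nil => simp [boolLists]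
    | cons b l => cases b <;> simp [boolLists, ih]

theorem nodup_boolLists (n : ℕ) : (boolLists n).Nodup := by
  induction n with
  | zero => simp [boolLists]
  | succ n ih =>
    refine List.Nodup.append (ih.map List.cons_injective) (ih.map List.cons_injective) ?_
    intro l h1 h2
    obtain ⟨_, -, rfl⟩ := List.mem_map.1 h1
    obtain ⟨_, -, h⟩ := List.mem_map.1 h2
    simp at h

/-- The states with each end labelled differently, to be glued to themselves. -/
def idRows (K : ℕ) : List (List ℕ) := (boolLists K).map (numbering 0)

theorem nodup_idRows (K : ℕ) : (idRows K).Nodup :=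
  (nodup_boolLists K).map fun l l' h => by
    simpa only [map_numbering] using congrArg (List.map fun x => decide (x ≠ 0)) h

/-- The chosen terminals in front of the strip, numbered. -/
def labels (k : ℕ) (p : Conf) : List ℕ := numbering 0 ((List.range (k + 1)).map (term 0 p.V p.W))

theorem labels_mem_idRows (k : ℕ) (p : Conf) : labels k p ∈ idRows (k + 1) :=
  List.mem_map_of_mem (mem_boolLists.2 (by simp))

theorem length_labels (k : ℕ) (p : Conf) : (labels k p).length = k + 1 := by simp [labels]

theorem decide_labels {k j : ℕ} {p : Conf} (hj : j < (labels k p).length) :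
    decide ((labels k p)[j] ≠ 0) = term 0 p.V p.W j := by
  have h := map_numbering 0 ((List.range (k + 1)).map (term 0 p.V p.W))
  have hj' : j < k + 1 := by rwa [length_labels] at hj
  have := List.getElem_of_eq h (i := j) (by simpa using hj')
  simp only [List.getElem_map, List.getElem_range] at this
  exact (decide_eq_decide.2 Iff.rfl).trans this

theorem Good.labels_eq {k n : ℕ} {l L : List ℕ} {p : Conf} (hl : l ∈ idRows (k + 1))
    (h : Good k n L l p) : labels k p = l := by
  obtain ⟨bs, hbs, rfl⟩ := List.mem_map.1 hl
  rw [mem_boolLists] at hbs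
  unfold labels
  congr 1
  refine List.ext_getElem (by simp [hbs]) fun j hj hj' => ?_
  have := at_iff.1 h.right j (by simpa using hj')
  have h2 := List.getElem_of_eq (map_numbering 0 bs) (i := j) (by simpa using hj')
  simp only [List.getElem_map] at h2
  simp only [List.getElem_map, List.getElem_range, this, h2]

/-- The function `g` recovers the index from an element, so the sets in the union are disjoint. -/
theorem ncard_exists_mem {A : List ℕ → Set Conf} (g : Conf → List ℕ) (hfin : ∀ l, (A l).Finite) :
    ∀ ls : List (List ℕ), ls.Nodup → (∀ l ∈ ls, ∀ p ∈ A l, g p = l) →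
      {p | ∃ l ∈ ls, p ∈ A l}.ncard = (ls.map fun l => (A l).ncard).sum := by
  intro ls
  induction ls with
  | nil => simp
  | cons l ls ih =>
    intro hnd hg
    rw [List.nodup_cons] at hnd
    have hset : {p | ∃ l' ∈ l :: ls, p ∈ A l'} = A l ∪ {p | ∃ l' ∈ ls, p ∈ A l'} := by
      ext p
      simp
    have hfin' : {p | ∃ l' ∈ ls, p ∈ A l'}.Finite := by
      have : {p | ∃ l' ∈ ls, p ∈ A l'} = ⋃ l' ∈ ls.toFinset, A l' := by ext p; simp
      rw [this]
      exact Set.Finite.biUnion (Finset.finite_toSet _) fun l' _ => hfin l'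
    rw [hset, Set.ncard_union_eq _ (hfin l) hfin', ih hnd.2 fun l' hl' => hg l' (by simp [hl'])]
    · simp
    · rw [Set.disjoint_left]
      rintro p hp ⟨l', hl', hp'⟩
      have h1 := hg l (by simp) p hp
      have h2 := hg l' (by simp [hl']) p hp'
      exact hnd.1 (h1 ▸ h2 ▸ hl')

open Classical in
/-- The configuration on `n` columns cut out of a set of edges of `G(n, k)`. -/
noncomputable def conf {n : ℕ} (k : ℕ) (C : Set (Edge n)) : Conf where
  V i := decide (i ≤ n ∧ Edge.outer ((i : ZMod n) - 1) ∈ C)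
  W i := decide (i < n + k ∧ Edge.inner ((i : ZMod n) - (k : ZMod n)) ∈ C)
  S i := decide (i < n ∧ Edge.spoke (i : ZMod n) ∈ C)

section Conf

variable {n k : ℕ} [NeZero n]

theorem conf_V {C : Set (Edge n)} (i : ZMod n) :
    (conf k C).V (i.val + 1) = true ↔ Edge.outer i ∈ C := by
  have := ZMod.val_lt i
  simp [conf]
  omega

theorem conf_W {C : Set (Edge n)} (i : ZMod n) :
    (conf k C).W (i.val + k) = true ↔ Edge.inner i ∈ C := by
  have := ZMod.val_lt i
  simp [conf]
  omega

theorem conf_S {C : Set (Edge n)} (i : ZMod n) :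
    (conf k C).S i.val = true ↔ Edge.spoke i ∈ C := by
  have := ZMod.val_lt i
  simp [conf]
  omega

theorem conf_injective : Function.Injective (conf (n := n) k) := by
  intro C C' h
  ext e
  cases e with
  | outer i => rw [← conf_V (k := k), ← conf_V (k := k), h]
  | inner i => rw [← conf_W (k := k), ← conf_W (k := k), h]
  | spoke i => rw [← conf_S (k := k), ← conf_S (k := k), h]

/-- Edges are indexed modulo `n`, so the terminals on the two sides belong to the same edges. -/
theorem term_conf {C : Set (Edge n)} {j : ℕ} (hj : j < k + 1) :
    term n (conf k C).V (conf k C).W j = term 0 (conf k C).V (conf k C).W j := by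
  have := NeZero.pos n
  cases j with
  | zero => simp [term, conf]
  | succ j =>
    have h1 : n + j < n + k := by omega
    have h2 : j < n + k := by omega
    simp [term, conf, h1, h2]

/-- A sequence that repeats after `n` places where the set `A` requires it. -/
theorem eq_val_of_periodic {f A : ℕ → Bool} {m : ℕ}
    (hA : ∀ j, n + j < m → A (n + j) = A j) (hf : ∀ j, n + j < m → A j = true → f (n + j) = f j) :
    ∀ i < m, A i = true → f i = f (i : ZMod n).val := by
  intro i
  induction i using Nat.strong_induction_on with
  | _ i ih =>
    intro hi hAi
    rcases lt_or_ge i n with h | h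
    · rw [ZMod.val_natCast_of_lt h]
    · obtain ⟨j, rfl⟩ := Nat.exists_eq_add_of_le h
      have hn := NeZero.pos n
      have hAj : A j = true := by rw [← hA j hi, hAi]
      rw [hf j hi hAj, ih j (by omega) (by omega) hAj]
      simp

/-- The last `n` places of the window represent each inner edge once. A place before them is moved
forward by `n`, several times if n is small compared with k, until it lies among them; `d` is the
distance to the end of the window. -/
theorem eq_of_window {W : ℕ → Bool} (h : ∀ i < k, W i = W (n + i)) :
    ∀ d i, i + d = n + k → i < n + k → W i = W (((i : ZMod n) - (k : ZMod n)).val + k) := by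
  intro d
  induction d using Nat.strong_induction_on with
  | _ d ih =>
    intro i hd hi
    have hn := NeZero.pos n
    rcases lt_or_ge i k with hik | hik
    · rw [h i hik, ih (d - n) (by omega) (n + i) (by omega) (by omega)]
      simp
    · rw [← Nat.cast_sub hik, ZMod.val_natCast_of_lt (by omega)]
      congr 1
      omega

end Conf

/-- The edges of `G(n, k)` that a configuration chooses. -/
def Conf.edges {n : ℕ} (k : ℕ) (p : Conf) : Set (Edge n) :=
  {e | match e with
    | .outer i => p.V (i.val + 1) = true
    | .inner i => p.W (i.val + k) = true
    | .spoke i => p.S i.val = true}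

/-- Equal labels on both sides make the terminals agree, so the configuration is periodic where the
window overlaps itself and comes from edges indexed modulo `n`. -/
theorem Good.exists_conf {n k : ℕ} (hn : 0 < n) {l : List ℕ} {p : Conf} (h : Good k n l l p) :
    ∃ C : Set (Edge n), conf k C = p := by
  have : NeZero n := ⟨hn.ne'⟩
  have hterm : ∀ j < k + 1, term 0 p.V p.W j = term n p.V p.W j := fun j hj =>
    (at_iff.1 h.right j (h.lenR ▸ hj)).trans (at_iff.1 h.left j (h.lenR ▸ hj)).symm
  have hV : p.V 0 = p.V n := hterm 0 (by omega)
  have hW : ∀ j < k, p.W j = p.W (n + j) := fun j hj => by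
    simpa [term] using hterm (j + 1) (by omega)
  refine ⟨p.edges k, ?_⟩
  have memV : ∀ i : ZMod n, Edge.outer i ∈ p.edges k ↔ p.V (i.val + 1) = true := fun i => Iff.rfl
  have memW : ∀ i : ZMod n, Edge.inner i ∈ p.edges k ↔ p.W (i.val + k) = true := fun i => Iff.rfl
  have memS : ∀ i : ZMod n, Edge.spoke i ∈ p.edges k ↔ p.S i.val = true := fun i => Iff.rfl
  ext i
  · simp only [conf, memV]
    rw [Bool.eq_iff_iff, decide_eq_true_iff]
    rcases lt_or_ge n i with hi | hi
    · simp [h.suppV i hi, hi]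
    · simp only [hi, true_and]
      cases i with
      | zero =>
        have : ((n - 1 : ℕ) : ZMod n) = ((0 : ℕ) : ZMod n) - 1 := by
          rw [Nat.cast_sub (by omega)]; simp
        rw [← this, ZMod.val_natCast_of_lt (by omega), Nat.sub_add_cancel hn, hV]
      | succ i =>
        rw [Nat.cast_succ, add_sub_cancel_right, ZMod.val_natCast_of_lt (by omega)]
  · simp only [conf, memW]
    rw [Bool.eq_iff_iff, decide_eq_true_iff]
    rcases lt_or_ge i (n + k) with hi | hi
    · simp only [hi, true_and]
      rw [← eq_of_window hW (n + k - i) i (by omega) hi]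
    · simp [h.suppW i hi]
      omega
  · simp only [conf, memS]
    rw [Bool.eq_iff_iff, decide_eq_true_iff]
    rcases lt_or_ge i n with hi | hi
    · simp only [hi, true_and]
      rw [ZMod.val_natCast_of_lt hi]
    · simp [h.suppS i hi]
      omega

/-! ### Connectedness in the strip and in the closed graph. -/

section Closed

variable {n k : ℕ} [NeZero n] {C : Set (Edge n)}

theorem decide_labels_conf {j : ℕ} (hj : j < (labels k (conf k C)).length) :
    decide ((labels k (conf k C))[j] ≠ 0) = term n (conf k C).V (conf k C).W j := by
  rw [decide_labels, term_conf (by rwa [length_labels] at hj)]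

/-- A function on the vertices is unrolled along the strip. Nonzero labels occur only once in the
identity state, so each can be given the colour of its terminal, which `idxOf` finds. -/
theorem spans_of_conn
    (h : ∀ X Y Z, Colouring k n (labels k (conf k C)) (labels k (conf k C)) (conf k C) X Y Z →
      ∃ b, Mono n (labels k (conf k C)) (labels k (conf k C)) X Y Z b) : Spans k C := by
  intro T hT
  set l := labels k (conf k C) with hl
  let Y : ℕ → Bool := fun i => T (.v i)
  let Z : ℕ → Bool := fun i => T (.w i)
  have hidx : ∀ j (hj : j < l.length), l[j] ≠ 0 → l.idxOf l[j] = j := fun j hj h0 => by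
    have hlt : l.idxOf l[j] < l.length := List.idxOf_lt_length_of_mem (List.getElem_mem hj)
    refine getElem_inj_of_count_le_one hlt hj ?_ (List.getElem_idxOf hlt)
    rw [List.getElem_idxOf hlt]
    exact count_numbering_le h0 _ _
  obtain ⟨b, hb⟩ := h (fun x => term 0 Y Z (l.idxOf x)) Y Z
    { right := at_iff.2 fun j hj h0 => by rw [hidx j hj h0]
      left := at_iff.2 fun j hj h0 => by
        rw [hidx j hj h0]
        cases j <;> simp [term, Y, Z]
      spoke := fun i hi hs => by
        refine hT (.spoke i, false) ?_
        simpa [conf, hi] using hs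
      outer := fun i hi hs => by
        have := hT (.outer i, false) ?_
        · simpa [vert, flip, Y] using this
        · simp only [conf, decide_eq_true_eq] at hs
          simpa using hs.2
      inner := fun i hi hs => by
        have := hT (.inner i, false) ?_
        · simpa [vert, flip, Z] using this
        · simp only [conf, decide_eq_true_eq] at hs
          simpa using hs.2 }
  have hall : ∀ x, T x = b := by
    rintro (i | i)
    · simpa [Y] using (hb.vert i.val (ZMod.val_lt i)).1
    · simpa [Z] using (hb.vert i.val (ZMod.val_lt i)).2
  exact fun x y => (hall x).trans (hall y).symm

/-- A label has the same colour at its front and its back terminal. So the colouring repeats after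
`n` places wherever a chosen edge crosses the cut, and this suffices to compare the ends of each
chosen edge after reduction modulo `n`. -/
theorem conn_of_spans (hs : Spans k C) (X Y Z : ℕ → Bool)
    (h : Colouring k n (labels k (conf k C)) (labels k (conf k C)) (conf k C) X Y Z) :
    ∃ b, Mono n (labels k (conf k C)) (labels k (conf k C)) X Y Z b := by
  have hn := NeZero.pos n
  set l := labels k (conf k C) with hl
  have hlen : l.length = k + 1 := length_labels _ _
  have hright := at_iff.1 h.right
  have hleft := at_iff.1 h.left
  have hne : ∀ j (hj : j < l.length), term 0 (conf k C).V (conf k C).W j = true → l[j] ≠ 0 :=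
    fun j hj ht => by simpa [ht] using decide_labels (p := conf k C) (k := k) hj
  have hYn : ∀ i ≤ n, (conf k C).V i = true → Y i = Y (i : ZMod n).val := fun i hi hV => by
    rcases hi.lt_or_eq with hi | rfl
    · rw [ZMod.val_natCast_of_lt hi]
    · have h0 : l[0] ≠ 0 := hne 0 (by omega) (by simpa [term, conf] using hV)
      have h1 := hright 0 (by omega) h0
      have h2 := hleft 0 (by omega) h0
      simpa [term] using h2.trans h1.symm
  have hZn : ∀ i < n + k, (conf k C).W i = true → Z i = Z (i : ZMod n).val := by
    have hj' : ∀ j, n + j < n + k → (conf k C).W (n + j) = (conf k C).W j := fun j hj => by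
      have h1 : j < n + k := by omega
      have h2 : j < k := by omega
      simp [conf, h1, h2]
    refine eq_val_of_periodic hj' fun j hj hW => ?_
    have h0 : l[j + 1] ≠ 0 := hne (j + 1) (by omega) (by simpa [term] using hW)
    have h1 := hright (j + 1) (by omega) h0
    have h2 := hleft (j + 1) (by omega) h0
    simpa [term] using h2.trans h1.symm
  have hT := hs (fun | .v i => Y i.val | .w i => Z i.val) (by
    have hinv : ∀ e : Edge n, e ∈ C →
        (fun | .v i => Y i.val | .w i => Z i.val : Vertex n → Bool) (vert n k (e, false)) =
        (fun | .v i => Y i.val | .w i => Z i.val : Vertex n → Bool) (vert n k (e, true)) := by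
      intro e he
      cases e with
      | outer i =>
        have hV := (conf_V (k := k) i).2 he
        have hi := ZMod.val_lt i
        have := hYn _ (by omega) hV
        simp only [vert]
        rw [h.outer _ hi hV, this]
        simp
      | inner i =>
        have hW := (conf_W (k := k) i).2 he
        have hi := ZMod.val_lt i
        have := hZn _ (by omega) hW
        simp only [vert]
        rw [h.inner _ hi hW, this]
        simp
      | spoke i => exact h.spoke _ (ZMod.val_lt i) ((conf_S (k := k) i).2 he)
    rintro ⟨e, b⟩ he
    cases b
    · exact hinv e he
    · exact (hinv e he).symm)
  have hY : ∀ i < n, Y i = Y 0 := fun i hi => by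
    simpa [ZMod.val_natCast_of_lt hi] using hT (.v (i : ZMod n)) (.v 0)
  have hZ : ∀ i < n, Z i = Y 0 := fun i hi => by
    simpa [ZMod.val_natCast_of_lt hi] using hT (.w (i : ZMod n)) (.v 0)
  have hX : ∀ x ∈ l, x ≠ 0 → X x = Y 0 := fun x hx h0 => by
    obtain ⟨j, hj, rfl⟩ := List.getElem_of_mem hx
    rw [← hright j hj h0]
    have ht := decide_labels (p := conf k C) (k := k) hj
    replace ht := (decide_eq_true h0).symm.trans ht
    cases j with
    | zero => rfl
    | succ j =>
      simp only [term, zero_add] at ht ⊢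
      rw [hZn j (by omega) ht.symm, hZ _ (ZMod.val_lt _)]
  exact ⟨Y 0, hX, hX, fun i hi => ⟨hY i hi, hZ i hi⟩⟩

theorem regular_iff_conf : Regular k C ↔
    (∀ i < n, Two ((conf k C).V i) ((conf k C).S i) ((conf k C).V (i + 1))) ∧
    (∀ i < n, Two ((conf k C).W i) ((conf k C).S i) ((conf k C).W (i + k))) := by
  classical
  have eV : ∀ i < n, (Two ((conf k C).V i) ((conf k C).S i) ((conf k C).V (i + 1)) ↔
      Two (decide (.outer ((i : ZMod n) - 1) ∈ C)) (decide (.spoke (i : ZMod n) ∈ C))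
        (decide (.outer (i : ZMod n) ∈ C))) := fun i hi => by
    have h1 : i ≤ n := by omega
    have h2 : i + 1 ≤ n := by omega
    simp only [conf, hi, h1, h2, true_and, Nat.cast_succ, add_sub_cancel_right]
  have eW : ∀ i < n, (Two ((conf k C).W i) ((conf k C).S i) ((conf k C).W (i + k)) ↔
      Two (decide (.inner ((i : ZMod n) - (k : ZMod n)) ∈ C)) (decide (.spoke (i : ZMod n) ∈ C))
        (decide (.inner (i : ZMod n) ∈ C))) := fun i hi => by
    have h1 : i < n + k := by omega
    have h2 : i + k < n + k := by omega
    simp only [conf, hi, h1, h2, true_and, Nat.cast_add, add_sub_cancel_right]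
  constructor
  · intro h
    refine ⟨fun i hi => (eV i hi).2 ?_, fun i hi => (eW i hi).2 ?_⟩
    · convert h.v i
    · convert h.w i
  · rintro ⟨hv, hw⟩
    refine ⟨fun i => ?_, fun i => ?_⟩
    · have := (eV i.val (ZMod.val_lt i)).1 (hv _ (ZMod.val_lt i))
      rw [ZMod.natCast_zmod_val] at this
      convert this
    · have := (eW i.val (ZMod.val_lt i)).1 (hw _ (ZMod.val_lt i))
      rw [ZMod.natCast_zmod_val] at this
      convert this

theorem good_conf_iff :
    Good k n (labels k (conf k C)) (labels k (conf k C)) (conf k C) ↔ Regular k C ∧ Spans k C := by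
  rw [regular_iff_conf]
  constructor
  · exact fun h => ⟨⟨h.twoV, h.twoW⟩, spans_of_conn h.conn⟩
  · rintro ⟨⟨hv, hw⟩, hs⟩
    refine ⟨length_labels _ _, length_labels _ _, at_iff.2 fun j hj => (decide_labels hj).symm,
      at_iff.2 fun j hj => (decide_labels_conf hj).symm, hv, hw, fun i hi => ?_, fun i hi => ?_,
      fun i hi => ?_, .inl (NeZero.pos n), conn_of_spans hs⟩
    · simp [conf]; omega
    · simp [conf]; omega
    · simp [conf]; omega

end Closed

/-- Cut open along the edges that enter the first column, a Hamiltonian cycle completes the state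
that labels these edges. -/
theorem h_eq_sum_count {n k : ℕ} (hn : 2 ≤ n) :
    h k n = ((idRows (k + 1)).map fun l => count k n l l).sum := by
  have : NeZero n := ⟨by omega⟩
  have hA : ∀ l ∈ idRows (k + 1), Sols k n l l = {p | Good k n l l p} := fun l hl => by
    obtain ⟨bs, hbs, rfl⟩ := List.mem_map.1 hl
    rw [mem_boolLists] at hbs
    have hne : numbering 0 bs ≠ [] := fun h => by
      have := congrArg List.length h
      simp [hbs] at this
    ext p
    simp [Sols, hne]
  have hset : conf k '' {C : Set (Edge n) | IsHamiltonianCycle (petersen n k) C} =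
      {p | ∃ l ∈ idRows (k + 1), p ∈ {p | Good k n l l p}} := by
    ext p
    simp only [Set.mem_image, Set.mem_ofPred_eq, isHamiltonianCycle_iff hn]
    constructor
    · rintro ⟨C, hC, rfl⟩
      exact ⟨_, labels_mem_idRows k _, good_conf_iff.2 hC⟩
    · rintro ⟨l, hl, hp⟩
      obtain ⟨C, rfl⟩ := hp.exists_conf (by omega)
      refine ⟨C, good_conf_iff.1 ?_, rfl⟩
      rwa [hp.labels_eq hl]
  rw [h, ← Set.ncard_image_of_injective _ (conf_injective (n := n) (k := k)), hset,
    ncard_exists_mem (labels k) (fun l => finite_good k n l l) _ (nodup_idRows _)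
      fun l hl p hp => Good.labels_eq hl hp]
  congr 1
  refine List.map_congr_left fun l hl => ?_
  rw [count, hA l hl]

/-! ### A transfer table and its verification -/

/-- An index in a `Sept`. -/
inductive Digit
  | a | b | c | d | e | f | g

/-- Seven entries. -/
structure Sept (α : Type) where
  (a b c d e f g : α)

/-- The entry at an index. -/
noncomputable def Sept.sel {α : Type} (x : Sept α) (i : Digit) : α :=
  Digit.rec (motive := fun _ => α) x.a x.b x.c x.d x.e x.f x.g i

/-- Apply a function to each entry. -/
def Sept.map {α β : Type} (f : α → β) (x : Sept α) : Sept β :=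
  ⟨f x.a, f x.b, f x.c, f x.d, f x.e, f x.f, f x.g⟩

/-- Check all entries. -/
def Sept.all {α : Type} (f : α → Bool) (x : Sept α) : Bool :=
  and (f x.a) (and (f x.b) (and (f x.c) (and (f x.d) (and (f x.e) (and (f x.f) (f x.g))))))

/-- A three-dimensional table of `7 ^ 3` entries. -/
abbrev Cube (α : Type) := Sept (Sept (Sept α))

/-- A position in a table. -/
structure Pos where
  (i j k : Digit)

/-- The entry at a position. -/
noncomputable def Cube.get {α : Type} (x : Cube α) (p : Pos) : α := ((x.sel p.i).sel p.j).sel p.k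

/-- Apply a function to each entry. -/
def Cube.map {α β : Type} (f : α → β) (x : Cube α) : Cube β := Sept.map (Sept.map (Sept.map f)) x

/-- Check all entries. -/
def Cube.all {α : Type} (f : α → Bool) (x : Cube α) : Bool := Sept.all (Sept.all (Sept.all f)) x

/-- The index with a given number. -/
def Digit.ofNat : ℕ → Digit
  | 0 => .a | 1 => .b | 2 => .c | 3 => .d | 4 => .e | 5 => .f | _ => .g

/-- The position with a given number. -/
def Pos.ofNat (n : ℕ) : Pos := ⟨.ofNat (n / 49), .ofNat (n / 7 % 7), .ofNat (n % 7)⟩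

/-- The entries of a list, filled up with `d`. -/
def Sept.ofFn {α : Type} (f : ℕ → α) : Sept α := ⟨f 0, f 1, f 2, f 3, f 4, f 5, f 6⟩

/-- The table of the positions. -/
def positions : Cube Pos :=
  .ofFn fun i => .ofFn fun j => .ofFn fun k => ⟨.ofNat i, .ofNat j, .ofNat k⟩

/-- The entry of a list at an index. -/
def entry {α : Type} (d : α) : List α → ℕ → α
  | [], _ => d
  | a :: l, n => match n with
    | 0 => a
    | n + 1 => entry d l n

/-- The entries of a list, filled up with `d`. -/
def Cube.ofList {α : Type} (d : α) (l : List α) : Cube α :=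
  .ofFn fun i => (fun l => .ofFn fun j => (fun l => .ofFn fun k => entry d l k) (l.drop (7 * j)))
    (l.drop (49 * i))

/-- Equality of lists of numbers. -/
def eqL : List ℕ → List ℕ → Bool
  | [], l => match l with
    | [] => true
    | _ :: _ => false
  | a :: l, m => match m with
    | [] => false
    | b :: m => and (Nat.beq a b) (eqL l m)

/-- Equality of lists of lists of numbers. -/
def eqLL : List (List ℕ) → List (List ℕ) → Bool
  | [], l => match l with
    | [] => true
    | _ :: _ => false
  | a :: l, m => match m with
    | [] => false
    | b :: m => and (eqL a b) (eqLL l m)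

/-- The standard label of a place in `R`: paths with both ends in `R` are named after the first. -/
def standard (R : List ℕ) (x : ℕ) : ℕ := if x < 20 then x else 20 + R.idxOf x

/-- The labels after the paths `a` and `b` through the strip have been joined. -/
def merge (t a b x : ℕ) : ℕ :=
  if x = a ∨ x = b then 10 + t else if t < x then x
  else x - (if a < x then 1 else 0) - (if b < x then 1 else 0)

/-- The states after one column; if two paths through the strip are joined, with their labels. -/
def stepRow (t : ℕ) : List ℕ → List (List ℕ × Option (ℕ × ℕ))
  | [] => []
  | a :: l => match l with
    | [] => []
    | b :: R =>
      let std := fun R : List ℕ => R.map (standard R)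
      if a = 0 ∧ b = 0 then [(std (99 :: (R ++ [99])), none)]
      else if a = 0 ∨ b = 0 then [(std (b :: (R ++ [a])), none)]
      else (std (a :: (R ++ [b])), none) ::
        if a = b then if ∀ x ∈ R, x = 0 then [([], none)] else []
        else if 20 ≤ a then [(std ((0 :: (R ++ [0])).map (rename b a)), none)]
        else if 20 ≤ b then [(std ((0 :: (R ++ [0])).map (rename a b)), none)]
        else [(std ((0 :: (R ++ [0])).map (merge t a b)), some (a, b))]

/-- The states on both sides of a strip through which `t` paths lead. -/
structure Sector where
  (t : ℕ) (lanes rows : List (List ℕ))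

/-- The rows that are reached without joining paths through the strip. -/
def explore (t : ℕ) : ℕ → List (List ℕ) → List (List ℕ) → List (List ℕ)
  | 0, _, seen => seen
  | f + 1, todo, seen => match todo with
    | [] => seen
    | R :: todo => bif seen.any (eqL R) then explore t f todo seen
      else explore t f (((stepRow t R).filterMap fun q => match q.2 with
        | none => some q.1
        | some _ => none) ++ todo) (R :: seen)

/-- Add lanes and rows to the first sector with `t` paths. -/
def addTo (t : ℕ) (ls rs : List (List ℕ)) : List Sector → List Sector
  | [] => []
  | g :: gs => bif Nat.beq g.t t then ⟨t, g.lanes ++ ls, g.rows ++ rs⟩ :: gs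
    else g :: addTo t ls rs gs

/-- Add the states that arise by joining two paths through the strip. -/
def addJoins (t : ℕ) (lanes : List (List ℕ)) :
    List (List ℕ × Option (ℕ × ℕ)) → List (ℕ × ℕ) → List Sector → List Sector
  | [], _, gs => gs
  | (R, o) :: js, seen, gs => match o with
    | none => addJoins t lanes js seen gs
    | some (a, b) => addJoins t lanes js ((a, b) :: seen)
      (addTo (t - 2) (if seen.any (fun c => merge t c.1 c.2 1 == merge t a b 1 &&
        (List.range t).all fun i => merge t c.1 c.2 i == merge t a b i) then []
        else lanes.map (·.map (merge t a b))) [R] gs)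

/-- All sectors that are reached. -/
def sectors : ℕ → List Sector → List Sector
  | 0, _ => []
  | f + 1, gs => match gs with
    | [] => []
    | g :: gs =>
      let rows := explore g.t 1000 g.rows []
      ⟨g.t, g.lanes, rows⟩ :: sectors f (addJoins g.t g.lanes (rows.flatMap (stepRow g.t)) [] gs)

/-- How to obtain the vector of a row: the vector at a position or a section of it. -/
inductive Jump where
  | keep (p : Pos)
  | cut (p : Pos) (off d m : ℕ)

/-- A row of the table: its sector, its labels, and how to compute its vector after one column. -/
structure Row where
  (s : ℕ) (R : List ℕ) (next : List Jump)

/-- The index of a list of numbers. -/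
def indexOf (R : List ℕ) : List (List ℕ) → ℕ
  | [] => 0
  | a :: l => bif eqL a R then 0 else indexOf R l + 1

/-- The index and the sector with `t` paths, and the number of its first row. -/
def findSector (t : ℕ) : List Sector → ℕ → ℕ × Sector
  | [], i => (i, ⟨0, [], []⟩)
  | x :: l, i => bif Nat.beq x.t t then (i, x) else findSector t l (i + x.rows.length)

/-- The first index at which `ls` occurs as a section. -/
def offset (ls : List (List ℕ)) : List (List ℕ) → ℕ → ℕ
  | [], n => n
  | a :: l, n => bif eqLL ((a :: l).take ls.length) ls then n else offset ls l (n + 1)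

/-- The number of bits for an entry of a vector. -/
def bits : ℕ := 192

/-- A row of the table. -/
def mkRow (s base : ℕ) (x : Sector) (rest : List Sector) (R : List ℕ) : Row :=
  ⟨s, R, (stepRow x.t R).map fun q => match q.2 with
    | none => .keep (.ofNat (base + indexOf q.1 x.rows))
    | some (a, b) =>
      (fun y => (fun off => .cut (.ofNat (y.1 + indexOf q.1 y.2.rows)) off (2 ^ (bits * off))
        (2 ^ (bits * x.lanes.length))) (offset (x.lanes.map (·.map (merge x.t a b))) y.2.lanes 0))
      (findSector (x.t - 2) rest (base + x.rows.length))⟩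

/-- All rows of the table. -/
def mkRows : List Sector → ℕ → ℕ → List Row
  | [], _, _ => []
  | x :: l, s, i => x.rows.map (mkRow s i x l) ++ mkRows l (s + 1) (i + x.rows.length)

/-- Numbers as the digits of one number. -/
def pack (f : List ℕ → ℕ) : List (List ℕ) → ℕ
  | [] => 0
  | a :: l => Nat.add (f a) (Nat.mul (2 ^ bits) (pack f l))

/-- The digit of a number that belongs to a lane. -/
structure Seed where
  (p : Pos) (off d : ℕ)

/-- Where to find the count for the identity state `l`. -/
def mkSeed (l : List ℕ) : List Sector → ℕ → Seed
  | [], _ => ⟨.ofNat 0, 0, 1⟩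
  | x :: xs, i => bif and (x.lanes.any (eqL l)) (x.rows.any (eqL l)) then
      ⟨.ofNat (i + indexOf l x.rows), indexOf l x.lanes, 2 ^ (bits * indexOf l x.lanes)⟩
    else mkSeed l xs (i + x.rows.length)

/-- The contribution of one way to continue. -/
noncomputable def Jump.value (x : Cube ℕ) (j : Jump) : ℕ :=
  Jump.rec (motive := fun _ => ℕ) (fun p => x.get p)
    (fun p _ d m => Nat.mod (Nat.div (x.get p) d) m) j

/-- The sum of all ways to continue. -/
noncomputable def total (x : Cube ℕ) (l : List Jump) : ℕ :=
  List.rec (motive := fun _ => ℕ) 0 (fun j _ ih => Nat.add (j.value x) ih) l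

/-- The vectors for one more column. -/
noncomputable def advance (prog : Cube (List Jump)) (x : Cube ℕ) : Cube ℕ := prog.map (total x)

/-- The vectors for `N` successive numbers of columns. -/
noncomputable def iterates (prog : Cube (List Jump)) (N : ℕ) : Cube ℕ → List (Cube ℕ) :=
  Nat.rec (motive := fun _ => Cube ℕ → List (Cube ℕ)) (fun _ => [])
    (fun _ ih x => x :: ih (advance prog x)) N

/-- A linear combination. -/
noncomputable def dot {α : Type} (f : α → ℕ) (q : List ℕ) : List α → ℕ :=
  List.rec (motive := fun _ => List α → ℕ) (fun _ => 0)
    (fun c _ ih xs => List.rec (motive := fun _ => ℕ) 0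
      (fun x xs _ => Nat.add (Nat.mul c (f x)) (ih xs)) xs) q

/-- The number of cycles, read off from the vectors. -/
noncomputable def readOff (seeds : List Seed) (x : Cube ℕ) : ℕ :=
  List.rec (motive := fun _ => ℕ) 0
    (fun s _ ih => Nat.add (Nat.mod (Nat.div (x.get s.p) s.d) (2 ^ bits)) ih) seeds

/-- The number of completions by no column at all. -/
def startValue (K : ℕ) (R L : List ℕ) : ℕ := match R with
  | [] => bif L.all (Nat.beq 0) then 1 else 0
  | _ :: _ => bif closes K L R then 1 else 0

/-- The labels on the left side of the strip are as required. -/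
def laneOk (K t : ℕ) (L : List ℕ) : Bool :=
  Nat.beq L.length K && (L.all fun x => Nat.beq x 0 || (bif Nat.ble x t then Nat.beq (L.count x) 1
    else Nat.blt (10 + t) x && Nat.blt x 20 && Nat.beq (L.count x) 2)) &&
  (List.range t).all fun i => L.any (Nat.beq (i + 1))

/-- The labels on the right side of the strip are as required. -/
def rowOk (K t : ℕ) (R : List ℕ) : Bool :=
  Nat.beq R.length 0 ||
  (Nat.beq R.length K && (R.all fun x => Nat.beq x 0 || (bif Nat.ble x t then Nat.beq (R.count x) 1
    else Nat.ble 20 x && Nat.blt x 99 && Nat.beq (R.count x) 2)) &&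
  (List.range t).all fun i => R.any (Nat.beq (i + 1)))

/-- The lanes of a sector. -/
def lanesOf (secs : List Sector) (s : ℕ) : List (List ℕ) := (entry ⟨0, [], []⟩ secs s).lanes

/-- The way to continue belongs to the state after one column. -/
noncomputable def jumpOk (secs : List Sector) (rows : Cube Row) (s t : ℕ) (q : List ℕ × Option (ℕ × ℕ))
    (j : Jump) : Bool :=
  match j with
  | .keep p => (match q.2 with
    | none => true
    | some _ => false) && Nat.beq (rows.get p).s s && eqL (rows.get p).R q.1
  | .cut p off d m => match q.2 with
    | none => false
    | some (a, b) => eqL (rows.get p).R q.1 && Nat.beq d (2 ^ (bits * off)) &&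
      Nat.beq m (2 ^ (bits * (lanesOf secs s).length)) &&
      eqLL (((lanesOf secs (rows.get p).s).drop off).take (lanesOf secs s).length)
        ((lanesOf secs s).map (·.map (merge t a b)))

/-- The ways to continue belong to the states after one column. -/
noncomputable def nextOk (secs : List Sector) (rows : Cube Row) (s t : ℕ) :
    List (List ℕ × Option (ℕ × ℕ)) → List Jump → Bool
  | [], js => match js with
    | [] => true
    | _ :: _ => false
  | q :: qs, js => match js with
    | [] => false
    | j :: js => jumpOk secs rows s t q j && nextOk secs rows s t qs js

/-- The row is as required. -/
noncomputable def Row.ok (K : ℕ) (secs : List Sector) (rows : Cube Row) (r : Row) : Bool :=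
  (fun t => rowOk K t r.R && nextOk secs rows r.s t (stepRow t r.R) r.next)
    (entry ⟨0, [], []⟩ secs r.s).t

/-- The seeds belong to the identity states. -/
noncomputable def seedsOk (secs : List Sector) (rows : Cube Row) : List (List ℕ) → List Seed → Bool
  | [], ss => match ss with
    | [] => true
    | _ :: _ => false
  | l :: ls, ss => match ss with
    | [] => false
    | s :: ss => eqL (rows.get s.p).R l && Nat.beq s.d (2 ^ (bits * s.off)) &&
      eqLL (((lanesOf secs (rows.get s.p).s).drop s.off).take 1) [l] && seedsOk secs rows ls ss

/-- The table is as required. -/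
noncomputable def tableOk (K : ℕ) (secs : List Sector) (rows : Cube Row) (seeds : List Seed) : Bool :=
  (secs.all fun x => Nat.blt x.t 10 && x.lanes.all (laneOk K x.t)) && rows.all (Row.ok K secs rows) &&
    seedsOk secs rows (idRows K) seeds

/-- The vectors satisfy the recurrence. -/
noncomputable def vanishes (pos neg : List ℕ) (seeds : List Seed) (xs : List (Cube ℕ)) : Bool :=
  (positions.all fun p => Nat.beq (dot (fun x => x.get p) pos xs) (dot (fun x => x.get p) neg xs)) &&
    Nat.beq (pos.headD 0 + dot (readOff seeds) pos.tail xs)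
      (neg.headD 0 + dot (readOff seeds) neg.tail xs)

/-- The vectors for strips without columns. -/
def start (K : ℕ) (secs : List Sector) (rows : Cube Row) : Cube ℕ :=
  rows.map fun r => pack (startValue K r.R) (lanesOf secs r.s)

/-- The table is as required and its vectors satisfy the recurrence. -/
noncomputable def verify (K : ℕ) (q : List ℤ) (secs : List Sector) (rows : Cube Row)
    (seeds : List Seed) : Bool :=
  tableOk K secs rows seeds &&
    (fun prog => (fun pos neg => Nat.blt ((pos.sum + neg.sum + 1) * 2 ^ (q.length + 2)) (2 ^ bits) &&
      vanishes pos neg seeds (iterates prog q.length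
        (advance prog (advance prog (start K secs rows)))))
      (q.map Int.toNat) (q.map fun c => (-c).toNat)) (rows.map Row.next)

/-- The sectors that contain the given identity states. -/
def ofGroups (groups : List (List (List ℕ))) : List Sector :=
  sectors 20 (groups.map fun l => ⟨(l.headD []).foldl max 0, l, l⟩)

/-- Build the table and verify it. -/
noncomputable def verified (K : ℕ) (q : List ℤ) (groups : List (List (List ℕ))) : Bool :=
  (fun secs => verify K q secs (.ofList ⟨groups.length - 1, [], []⟩ (mkRows secs 0 0))
    ((idRows K).map fun l => mkSeed l secs 0)) (ofGroups groups)

/-- A grouping of the identity states for `k = 3`. -/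
def groupsThree : List (List (List ℕ)) :=
  [[[1, 2, 3, 4]], [[1, 2, 3, 0], [1, 2, 0, 3], [1, 0, 2, 3], [0, 1, 2, 3]],
    [[1, 2, 0, 0], [1, 0, 2, 0], [1, 0, 0, 2], [0, 1, 2, 0], [0, 1, 0, 2], [0, 0, 1, 2]],
    [[1, 0, 0, 0], [0, 1, 0, 0], [0, 0, 1, 0], [0, 0, 0, 1]], [[0, 0, 0, 0]]]

/-- A grouping of the identity states for `k = 4`. -/
def groupsFour : List (List (List ℕ)) :=
  [[[1, 2, 3, 4, 5]],
    [[1, 2, 3, 4, 0], [1, 2, 3, 0, 4], [1, 2, 0, 3, 4], [1, 0, 2, 3, 4], [0, 1, 2, 3, 4]],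
    [[1, 2, 3, 0, 0], [0, 1, 2, 3, 0], [0, 0, 1, 2, 3], [1, 0, 0, 2, 3], [1, 2, 0, 0, 3]],
    [[1, 2, 0, 3, 0], [0, 1, 2, 0, 3]], [[1, 0, 2, 3, 0], [0, 1, 0, 2, 3]], [[1, 0, 2, 0, 3]],
    [[1, 2, 0, 0, 0], [1, 0, 2, 0, 0], [1, 0, 0, 2, 0], [1, 0, 0, 0, 2], [0, 1, 2, 0, 0],
      [0, 1, 0, 2, 0], [0, 1, 0, 0, 2], [0, 0, 1, 2, 0], [0, 0, 1, 0, 2], [0, 0, 0, 1, 2]],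
    [[1, 0, 0, 0, 0], [0, 1, 0, 0, 0], [0, 0, 1, 0, 0], [0, 0, 0, 1, 0], [0, 0, 0, 0, 1]],
    [[0, 0, 0, 0, 0]]]

/-! ### The states after one column -/

/-- The labels `L` behind a strip through which `t` paths lead: these paths are numbered from `1`
to `t`, and the paths with both ends in `L` have labels between `10 + t` and `20`. -/
structure IsLane (k t : ℕ) (L : List ℕ) : Prop where
  length : L.length = k + 1
  cases : ∀ x ∈ L, x ≠ 0 → x ≤ t ∧ L.count x = 1 ∨ 10 + t < x ∧ x < 20 ∧ L.count x = 2
  mem : ∀ x, x ≠ 0 → x ≤ t → x ∈ L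

/-- The labels `R` in front of a strip through which `t` paths lead: these paths are numbered from
`1` to `t`, and the paths with both ends in `R` have labels between `20` and `98`. -/
structure IsRow (k t : ℕ) (R : List ℕ) : Prop where
  length : R.length = k + 1
  cases : ∀ x ∈ R, x ≠ 0 → x ≤ t ∧ R.count x = 1 ∨ 20 ≤ x ∧ x < 99 ∧ R.count x = 2
  mem : ∀ x, x ≠ 0 → x ≤ t → x ∈ R

theorem IsLane.lt {k t : ℕ} {L : List ℕ} (h : IsLane k t L) (ht : t < 10) {x : ℕ} (hx : x ∈ L) :
    x < 20 := by
  by_cases h0 : x = 0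
  · omega
  · rcases h.cases x hx h0 with h | h <;> omega

/-- A through path has one end on each side; any other path has both ends on one side. The ranges
above 10 + t and below 20, and from 20 up, keep the latter two kinds apart. -/
theorem paired {k t : ℕ} {L R : List ℕ} (ht : t < 10) (hL : IsLane k t L) (hR : IsRow k t R) :
    Paired L R := by
  intro x h0 hx
  by_cases hxt : x ≤ t
  · rcases hL.cases x (hL.mem x h0 hxt) h0 with h1 | h1 <;>
      rcases hR.cases x (hR.mem x h0 hxt) h0 with h2 | h2 <;> omega
  · rcases hx with hx | hx
    · have hxR : x ∉ R := fun hxR => by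
        have := hL.lt ht hx
        rcases hR.cases x hxR h0 with h2 | h2 <;> omega
      rw [List.count_eq_zero.2 hxR]
      rcases hL.cases x hx h0 with h1 | h1 <;> omega
    · have hxL : x ∉ L := fun hxL => by
        have := hL.lt ht hxL
        rcases hR.cases x hx h0 with h2 | h2 <;> omega
      rw [List.count_eq_zero.2 hxL]
      rcases hR.cases x hx h0 with h1 | h1 <;> omega

theorem standard_eq_zero {R : List ℕ} {z : ℕ} : standard R z = 0 ↔ z = 0 := by
  unfold standard
  split_ifs <;> omega

/-- Labels from 20 on are replaced by the place of their first occurrence, which determines them,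
and their new values stay apart from the labels below 20. -/
theorem standard_inj {R : List ℕ} {z z' : ℕ} (hz : z < 20 ∨ z ∈ R)
    (h : standard R z = standard R z') : z = z' := by
  unfold standard at h
  split_ifs at h with h1 h2 h2
  · exact h
  · omega
  · omega
  · exact (List.idxOf_inj (hz.resolve_left h1)).1 (by omega)

theorem map_standard {R L : List ℕ} (h : ∀ x ∈ L, x < 20) : L.map (standard R) = L := by
  conv_rhs => rw [← List.map_id L]
  exact List.map_congr_left fun x hx => by simp [standard, h x hx]

theorem rename_self (a b : ℕ) : rename a b b = a := by simp [rename]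

theorem rename_of_ne {a b x : ℕ} (h : x ≠ b) : rename a b x = x := by simp [rename, h]

/-- The labels on the left side after a step. -/
def after (t : ℕ) (o : Option (ℕ × ℕ)) (L : List ℕ) : List ℕ := match o with
  | none => L
  | some (a, b) => L.map (merge t a b)

theorem merge_lt {t a b x : ℕ} (ht : t < 10) (hx : x < 20) : merge t a b x < 20 := by
  unfold merge
  split_ifs <;> omega

theorem merge_eq_zero {t a b x : ℕ} (ha : a ≠ 0) (hb : b ≠ 0) (hab : a ≠ b) :
    merge t a b x = 0 ↔ x = 0 := by
  unfold merge
  split_ifs <;> omega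

/-- The labels in use are at most t or above 10 + t, so 10 + t is free for the joined path. Closing
the gaps at `a` and `b` is injective on the remaining through paths. -/
theorem merge_inj {t a b z z' : ℕ} (hab : a ≠ b)
    (hz : z ≤ t ∨ 10 + t < z) (hz' : z' ≤ t ∨ 10 + t < z') (h : merge t a b z = merge t a b z') :
    z = z' ∨ ((z = a ∨ z = b) ∧ (z' = a ∨ z' = b)) := by
  unfold merge at h
  split_ifs at h <;> omega

theorem mem_of_count_eq_two {a b : ℕ} {l : List ℕ} (hab : a ≠ b)
    (h : (a :: b :: l).count a = 2) : a ∈ l := by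
  rw [List.count_cons_self, List.count_cons_of_ne hab.symm] at h
  exact List.count_pos_iff.1 (by omega)

section Step

variable {k t n : ℕ} {L rest : List ℕ} {a b : ℕ}

/-- The path `a` returns to the front, so its other end takes over the label `b`; the labels behind
the strip do not change. -/
theorem count_join_right (ht : t < 10) (hL : IsLane k t L) (hR : IsRow k t (a :: b :: rest))
    (ha : 20 ≤ a) (hb : b ≠ 0) (hab : a ≠ b) :
    count k (n + 1) L (a :: b :: rest) =
      count k n L ((a :: (rest ++ [b])).map (standard (a :: (rest ++ [b])))) +
      count k n L (((0 :: (rest ++ [0])).map (rename b a)).map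
        (standard ((0 :: (rest ++ [0])).map (rename b a)))) := by
  have hlt : ∀ x ∈ L, x < 20 := fun x hx => hL.lt ht hx
  have ha0 : a ≠ 0 := by omega
  have har : a ∈ rest := by
    refine mem_of_count_eq_two hab ?_
    rcases hR.cases a (by simp) ha0 with h | h <;> omega
  set R₁ := a :: (rest ++ [b]) with hR₁
  set R₂ := (0 :: (rest ++ [0])).map (rename b a) with hR₂
  have hmem : ∀ z ∈ rest, rename b a z ∈ R₂ := fun z hz => by
    rw [hR₂]
    exact List.mem_map_of_mem (by simp [hz])
  have hocc : ∀ z, Occurs L (a :: b :: rest) z → z < 20 ∨ z ∈ R₁ := by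
    rintro z (hz | hz)
    · exact .inl (hlt z hz)
    · right
      simp only [hR₁, List.mem_cons, List.mem_append, List.not_mem_nil, or_false] at hz ⊢
      tauto
  have hbR : b ∈ R₂ := by simpa [rename_self] using hmem a har
  have hocc' : ∀ z, Occurs L (a :: b :: rest) z → rename b a z < 20 ∨ rename b a z ∈ R₂ := by
    rintro z (hz | hz)
    · left
      have := hlt z hz
      rwa [rename_of_ne (by omega)]
    · right
      simp only [List.mem_cons] at hz
      rcases hz with rfl | rfl | hz
      · rwa [rename_self]
      · rwa [rename_of_ne hab.symm]
      · exact hmem z hz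
  have hlen : rest.length + 1 = k := by simpa using hR.length
  rw [count_join (G := standard R₁) (G' := fun z => standard R₂ (rename b a z)) hlen ha0 hb
    (fun z _ => standard_eq_zero) (fun z z' hz _ => standard_inj (hocc z hz))
    ⟨a, .inr har, .inl rfl⟩ (fun z _ => ?_) ?_ (fun z z' hz hz' h => ?_), map_standard hlt]
  · congr 2
    · refine (List.map_congr_left fun x hx => ?_).trans (map_standard (R := R₂) hlt)
      have := hlt x hx
      rw [rename_of_ne (by omega)]
    · rw [hR₂, List.map_map]
      rfl
  · rw [rename_self, rename_of_ne hab.symm]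
  · rw [standard_eq_zero]
    unfold rename
    split_ifs <;> omega
  · have := standard_inj (hocc' z hz) h
    unfold rename at this
    split_ifs at this <;> omega

/-- Here `a` leads through and `b` returns to the front, so the other end of `b` takes over the
label `a`. -/
theorem count_join_left (ht : t < 10) (hL : IsLane k t L) (hR : IsRow k t (a :: b :: rest))
    (ha : a < 20) (ha0 : a ≠ 0) (hb : 20 ≤ b) :
    count k (n + 1) L (a :: b :: rest) =
      count k n L ((a :: (rest ++ [b])).map (standard (a :: (rest ++ [b])))) +
      count k n L (((0 :: (rest ++ [0])).map (rename a b)).map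
        (standard ((0 :: (rest ++ [0])).map (rename a b)))) := by
  have hlt : ∀ x ∈ L, x < 20 := fun x hx => hL.lt ht hx
  have hab : a ≠ b := by omega
  have hbr : b ∈ rest := by
    have := hR.cases b (by simp) (by omega)
    rw [List.count_cons_of_ne hab, List.count_cons_self] at this
    exact List.count_pos_iff.1 (by omega)
  set R₁ := a :: (rest ++ [b]) with hR₁
  set R₂ := (0 :: (rest ++ [0])).map (rename a b) with hR₂
  have hocc : ∀ z, Occurs L (a :: b :: rest) z → z < 20 ∨ z ∈ R₁ := by
    rintro z (hz | hz)
    · exact .inl (hlt z hz)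
    · right
      simp only [hR₁, List.mem_cons, List.mem_append, List.not_mem_nil, or_false] at hz ⊢
      tauto
  have hocc' : ∀ z, Occurs L (a :: b :: rest) z → rename a b z < 20 ∨ rename a b z ∈ R₂ := by
    rintro z (hz | hz)
    · left
      have := hlt z hz
      rwa [rename_of_ne (by omega)]
    · simp only [List.mem_cons] at hz
      rcases hz with rfl | rfl | hz
      · left
        rwa [rename_of_ne hab]
      · left
        rwa [rename_self]
      · right
        rw [hR₂]
        exact List.mem_map_of_mem (by simp [hz])
  have hlen : rest.length + 1 = k := by simpa using hR.length
  rw [count_join (G := standard R₁) (G' := fun z => standard R₂ (rename a b z)) hlen ha0 (by omega)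
    (fun z _ => standard_eq_zero) (fun z z' hz _ => standard_inj (hocc z hz))
    ⟨b, .inr hbr, .inr rfl⟩ (fun z _ => ?_) ?_ (fun z z' hz hz' h => ?_), map_standard hlt]
  · congr 2
    · refine (List.map_congr_left fun x hx => ?_).trans (map_standard (R := R₂) hlt)
      have := hlt x hx
      rw [rename_of_ne (by omega)]
    · rw [hR₂, List.map_map]
      rfl
  · rw [rename_self, rename_of_ne hab]
  · rw [standard_eq_zero]
    unfold rename
    split_ifs <;> omega
  · have := standard_inj (hocc' z hz) h
    unfold rename at this
    split_ifs at this <;> omega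

/-- Both paths lead through, and joining them makes a path with both ends behind the strip. This is
the only transition that changes `L`; it does so by a renaming that is the same for all lanes of a
sector, which allows whole vectors of counts to be moved at once. -/
theorem count_join_through (ht : t < 10) (hL : IsLane k t L) (hR : IsRow k t (a :: b :: rest))
    (ha : a < 20) (ha0 : a ≠ 0) (hb : b < 20) (hb0 : b ≠ 0) (hab : a ≠ b) :
    count k (n + 1) L (a :: b :: rest) =
      count k n L ((a :: (rest ++ [b])).map (standard (a :: (rest ++ [b])))) +
      count k n (L.map (merge t a b)) (((0 :: (rest ++ [0])).map (merge t a b)).map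
        (standard ((0 :: (rest ++ [0])).map (merge t a b)))) := by
  have hlt : ∀ x ∈ L, x < 20 := fun x hx => hL.lt ht hx
  have hat : a ≤ t := by rcases hR.cases a (by simp) ha0 with h | h <;> omega
  set R₁ := a :: (rest ++ [b]) with hR₁
  set R₂ := (0 :: (rest ++ [0])).map (merge t a b) with hR₂
  have hocc : ∀ z, Occurs L (a :: b :: rest) z → z < 20 ∨ z ∈ R₁ := by
    rintro z (hz | hz)
    · exact .inl (hlt z hz)
    · right
      simp only [hR₁, List.mem_cons, List.mem_append, List.not_mem_nil, or_false] at hz ⊢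
      tauto
  have hocc' : ∀ z, Occurs L (a :: b :: rest) z →
      merge t a b z < 20 ∨ merge t a b z ∈ R₂ := by
    rintro z (hz | hz)
    · exact .inl (merge_lt ht (hlt z hz))
    · simp only [List.mem_cons] at hz
      rcases hz with rfl | rfl | hz
      · exact .inl (merge_lt ht ha)
      · exact .inl (merge_lt ht hb)
      · right
        rw [hR₂]
        exact List.mem_map_of_mem (by simp [hz])
  have hcases : ∀ z, Occurs L (a :: b :: rest) z → z ≤ t ∨ 10 + t < z := by
    rintro z (hz | hz) <;> by_cases h0 : z = 0
    · omega
    · rcases hL.cases z hz h0 with h | h <;> omega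
    · omega
    · rcases hR.cases z hz h0 with h | h <;> omega
  have hlen : rest.length + 1 = k := by simpa using hR.length
  rw [count_join (G := standard R₁) (G' := fun z => standard R₂ (merge t a b z)) hlen ha0 hb0
    (fun z _ => standard_eq_zero) (fun z z' hz _ => standard_inj (hocc z hz))
    ⟨a, .inl (hL.mem a ha0 hat), .inl rfl⟩
    (fun z _ => standard_eq_zero.trans (merge_eq_zero ha0 hb0 hab)) ?_ (fun z z' hz hz' h =>
      merge_inj hab (hcases z hz) (hcases z' hz')
        (standard_inj (hocc' z hz) h)), map_standard hlt]
  · congr 2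
    · have : ∀ x ∈ L.map (merge t a b), x < 20 := by
        intro x hx
        obtain ⟨y, hy, rfl⟩ := List.mem_map.1 hx
        exact merge_lt ht (hlt y hy)
      rw [← map_standard (R := R₂) this, List.map_map]
      rfl
    · rw [hR₂, List.map_map]
      rfl
  · simp [merge]

theorem count_step (hk : 1 ≤ k) (ht : t < 10) (hL : IsLane k t L) {R : List ℕ} (hR : R = [] ∨ IsRow k t R) :
    count k (n + 1) L R =
      ((stepRow t R).map fun q => count k n (after t q.2 L) q.1).sum := by
  rcases hR with rfl | hR
  · simp [stepRow, count_nil_succ]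
  have hlt : ∀ x ∈ L, x < 20 := fun x hx => hL.lt ht hx
  match R, hR with
  | [], hR => simpa using hR.length
  | [a], hR =>
    have := hR.length
    simp at this
    omega
  | a :: b :: rest, hR =>
    have hlen : rest.length + 1 = k := by simpa using hR.length
    have hocc : ∀ z, Occurs L (a :: b :: rest) z → z < 20 ∨ z = a ∨ z = b ∨ z ∈ rest := by
      rintro z (hz | hz)
      · exact .inl (hlt z hz)
      · exact .inr (by simpa using hz)
    simp only [stepRow]
    split_ifs with h1 h2 h3 h4 h5 h6
    · obtain ⟨rfl, rfl⟩ := h1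
      -- Rows use labels below 99 and lanes labels below 20, so 99 is free for the new path.
      have h99 : ¬ Occurs L (0 :: 0 :: rest) 99 := by
        rintro (h | h)
        · have := hlt _ h
          omega
        · rcases hR.cases 99 h (by omega) with h | h <;> omega
      have hocc' : ∀ z, z = 99 ∨ Occurs L (0 :: 0 :: rest) z → z < 20 ∨ z ∈ 99 :: (rest ++ [99]) := by
        rintro z (rfl | hz)
        · simp
        · rcases hocc z hz with h | rfl | rfl | h
          · exact .inl h
          · simp
          · simp
          · simp [h]
      rw [count_cup (f := 99) (G := standard (99 :: (rest ++ [99]))) hlen (by omega) h99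
        (fun z _ => standard_eq_zero)
        (fun z z' hz _ => standard_inj (hocc' z hz)), map_standard hlt]
      simp [after]
    · have hab : a = 0 ↔ b ≠ 0 := by omega
      have hocc' : ∀ z, Occurs L (a :: b :: rest) z → z < 20 ∨ z ∈ b :: (rest ++ [a]) := by
        intro z hz
        rcases hocc z hz with h | rfl | rfl | h <;> simp [*]
      rw [count_swap (G := standard (b :: (rest ++ [a]))) hlen hab (fun z _ => standard_eq_zero)
        (fun z z' hz _ => standard_inj (hocc' z hz)), map_standard hlt]
      simp [after]
    · subst h3
      have ha : a ≠ 0 := by tauto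
      have hcount := hR.cases a (by simp) ha
      rw [List.count_cons_self, List.count_cons_self] at hcount
      have haR : a ∉ rest := List.count_eq_zero.1 (by omega)
      have haL : a ∉ L := fun h => by
        have := hlt a h
        omega
      have hocc' : ∀ z, Occurs L (a :: a :: rest) z → z < 20 ∨ z ∈ a :: (rest ++ [a]) := by
        intro z hz
        rcases hocc z hz with h | rfl | rfl | h <;> simp [*]
      rw [count_loop (G := standard (a :: (rest ++ [a]))) hlen hL.length ha haL haR
        (fun z _ => standard_eq_zero)
        (fun z z' hz _ => standard_inj (hocc' z hz)), map_standard hlt, if_pos h4]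
      simp [after]
    · subst h3
      have ha : a ≠ 0 := by tauto
      have hcount := hR.cases a (by simp) ha
      rw [List.count_cons_self, List.count_cons_self] at hcount
      have haR : a ∉ rest := List.count_eq_zero.1 (by omega)
      have haL : a ∉ L := fun h => by
        have := hlt a h
        omega
      have hocc' : ∀ z, Occurs L (a :: a :: rest) z → z < 20 ∨ z ∈ a :: (rest ++ [a]) := by
        intro z hz
        rcases hocc z hz with h | rfl | rfl | h <;> simp [*]
      rw [count_loop (G := standard (a :: (rest ++ [a]))) hlen hL.length ha haL haR
        (fun z _ => standard_eq_zero)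
        (fun z z' hz _ => standard_inj (hocc' z hz)), map_standard hlt, if_neg h4]
      simp [after]
    · rw [count_join_right ht hL hR h5 (by tauto) h3]
      simp [after]
    · rw [count_join_left ht hL hR (by omega) (by tauto) h6]
      simp [after]
    · rw [count_join_through ht hL hR (by omega) (by tauto) (by omega) (by tauto) h3]
      simp [after]

end Step

/-! ### Soundness of the verification -/

theorem isLane_of_laneOk {k t : ℕ} {L : List ℕ} (h : laneOk (k + 1) t L = true) : IsLane k t L := by
  simp only [laneOk, Bool.and_eq_true, Nat.beq_eq, List.all_eq_true, Bool.or_eq_true,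
    List.mem_range, List.any_eq_true] at h
  refine ⟨h.1.1, fun x hx h0 => ?_, fun x h0 hxt => ?_⟩
  · rcases h.1.2 x hx with h1 | h1
    · exact absurd h1 h0
    · by_cases hxt : x ≤ t
      · rw [Nat.ble_eq_true_of_le hxt, cond_true, Nat.beq_eq] at h1
        exact .inl ⟨hxt, h1⟩
      · rw [Bool.eq_false_iff.2 (mt Nat.le_of_ble_eq_true hxt), cond_false] at h1
        simp only [Bool.and_eq_true, Nat.beq_eq, Nat.blt_eq] at h1
        exact .inr ⟨h1.1.1, h1.1.2, h1.2⟩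
  · obtain ⟨y, hy, he⟩ := h.2 (x - 1) (by omega)
    rwa [show x = y by omega]

theorem isRow_of_rowOk {k t : ℕ} {R : List ℕ} (h : rowOk (k + 1) t R = true) :
    R = [] ∨ IsRow k t R := by
  simp only [rowOk, Bool.and_eq_true, Nat.beq_eq, List.all_eq_true, Bool.or_eq_true,
    List.mem_range, List.any_eq_true, List.length_eq_zero_iff] at h
  refine h.imp_right fun h => ⟨h.1.1, fun x hx h0 => ?_, fun x h0 hxt => ?_⟩
  · rcases h.1.2 x hx with h1 | h1
    · exact absurd h1 h0
    · by_cases hxt : x ≤ t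
      · rw [Nat.ble_eq_true_of_le hxt, cond_true, Nat.beq_eq] at h1
        exact .inl ⟨hxt, h1⟩
      · rw [Bool.eq_false_iff.2 (mt Nat.le_of_ble_eq_true hxt), cond_false] at h1
        simp only [Bool.and_eq_true, Nat.beq_eq, Nat.blt_eq, Nat.ble_eq] at h1
        exact .inr ⟨h1.1.1, h1.1.2, h1.2⟩
  · obtain ⟨y, hy, he⟩ := h.2 (x - 1) (by omega)
    rwa [show x = y by omega]

theorem eqL_iff {l m : List ℕ} : eqL l m = true ↔ l = m := by
  induction l generalizing m with
  | nil => cases m <;> simp [eqL]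
  | cons a l ih => cases m <;> simp [eqL, ih]

theorem eqLL_iff {l m : List (List ℕ)} : eqLL l m = true ↔ l = m := by
  induction l generalizing m with
  | nil => cases m <;> simp [eqLL]
  | cons a l ih => cases m <;> simp [eqLL, ih, eqL_iff]

/-! ### Access to tables. -/

section Tables

variable {α β : Type}

theorem Sept.sel_map (f : α → β) (x : Sept α) (i : Digit) : (x.map f).sel i = f (x.sel i) := by
  cases i <;> rfl

theorem Sept.sel_of_all {f : α → Bool} {x : Sept α} (h : x.all f = true) (i : Digit) :
    f (x.sel i) = true := by
  simp only [Sept.all, Bool.and_eq_true] at h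
  obtain ⟨h1, h2, h3, h4, h5, h6, h7⟩ := h
  cases i <;> assumption

theorem Cube.get_map (f : α → β) (x : Cube α) (p : Pos) : (x.map f).get p = f (x.get p) := by
  simp only [Cube.get, Cube.map, Sept.sel_map]

theorem Cube.get_of_all {f : α → Bool} {x : Cube α} (h : x.all f = true) (p : Pos) :
    f (x.get p) = true :=
  Sept.sel_of_all (Sept.sel_of_all (Sept.sel_of_all h p.i) p.j) p.k

theorem Sept.sel_ofFn (f : Digit → α) (i : Digit) :
    (Sept.ofFn fun j => f (.ofNat j)).sel i = f i := by
  cases i <;> rfl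

theorem get_positions (p : Pos) : positions.get p = p := by
  have h1 := Sept.sel_ofFn
    (fun i => Sept.ofFn fun j => Sept.ofFn fun k => (⟨i, .ofNat j, .ofNat k⟩ : Pos)) p.i
  have h2 := Sept.sel_ofFn (fun j => Sept.ofFn fun k => (⟨p.i, j, .ofNat k⟩ : Pos)) p.j
  have h3 := Sept.sel_ofFn (fun k => (⟨p.i, p.j, k⟩ : Pos)) p.k
  exact (congrArg (fun x : Sept (Sept Pos) => (x.sel p.j).sel p.k) h1).trans
    ((congrArg (fun x : Sept Pos => x.sel p.k) h2).trans h3)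

theorem entry_eq_or_mem (d : α) (l : List α) (i : ℕ) : entry d l i = d ∨ entry d l i ∈ l := by
  induction l generalizing i with
  | nil => exact .inl rfl
  | cons a l ih =>
    cases i with
    | zero => exact .inr (by simp [entry])
    | succ i => exact (ih i).imp_right fun h => List.mem_cons_of_mem _ h

end Tables

/-! ### Vectors as digits in base `2 ^ bits`. -/

section Pack

variable {f g : List ℕ → ℕ}

theorem pack_cons (f : List ℕ → ℕ) (a : List ℕ) (l : List (List ℕ)) :
    pack f (a :: l) = f a + 2 ^ bits * pack f l := rfl

theorem pack_congr {l : List (List ℕ)} (h : ∀ L ∈ l, f L = g L) : pack f l = pack g l := by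
  induction l with
  | nil => rfl
  | cons a l ih =>
    rw [pack_cons, pack_cons, h a (by simp), ih fun L hL => h L (by simp [hL])]

theorem pack_map (φ : List ℕ → List ℕ) (l : List (List ℕ)) :
    pack f (l.map φ) = pack (fun L => f (φ L)) l := by
  induction l with
  | nil => rfl
  | cons a l ih => rw [List.map_cons, pack_cons, pack_cons, ih]

theorem pack_add (l : List (List ℕ)) : pack (fun L => f L + g L) l = pack f l + pack g l := by
  induction l with
  | nil => rfl
  | cons a l ih =>
    rw [pack_cons, pack_cons, pack_cons, ih]
    ring

theorem pack_zero (l : List (List ℕ)) : pack (fun _ => 0) l = 0 := by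
  induction l with
  | nil => rfl
  | cons a l ih => rw [pack_cons, ih]; rfl

/-- Each entry fits into one digit, so division by a power of the base discards exactly the first
entries. Together with `pack_take` this extracts a section of a vector. -/
theorem pack_drop (l : List (List ℕ)) (hl : ∀ L ∈ l, f L < 2 ^ bits) (i : ℕ) :
    pack f l / 2 ^ (bits * i) = pack f (l.drop i) := by
  induction i generalizing l with
  | zero => simp
  | succ i ih =>
    cases l with
    | nil => simp [pack]
    | cons a l =>
      rw [Nat.mul_succ, Nat.pow_add, Nat.mul_comm, ← Nat.div_div_eq_div_mul, pack_cons,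
        Nat.add_mul_div_left _ _ (Nat.two_pow_pos _), Nat.div_eq_of_lt (hl a (by simp)), zero_add,
        ih l fun L hL => hl L (by simp [hL])]
      rfl

theorem pack_take (l : List (List ℕ)) (hl : ∀ L ∈ l, f L < 2 ^ bits) (i : ℕ) :
    pack f l % 2 ^ (bits * i) = pack f (l.take i) := by
  induction i generalizing l with
  | zero => simp [pack, Nat.mod_one]
  | succ i ih =>
    cases l with
    | nil => simp [pack]
    | cons a l =>
      rw [Nat.mul_succ, Nat.add_comm, Nat.pow_add, Nat.mod_mul, List.take_succ_cons, pack_cons,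
        pack_cons, Nat.add_mul_mod_self_left, Nat.mod_eq_of_lt (hl a (by simp)),
        Nat.add_mul_div_left _ _ (Nat.two_pow_pos _), Nat.div_eq_of_lt (hl a (by simp)), zero_add,
        ih l fun L hL => hl L (by simp [hL])]

end Pack

/-- The linear combination of the values of `g` with the coefficients `q`. -/
def comb : List ℤ → (ℕ → ℤ) → ℤ
  | [], _ => 0
  | c :: q, g => c * g 0 + comb q fun i => g (i + 1)

theorem comb_add (q : List ℤ) (g g' : ℕ → ℤ) :
    comb q (fun i => g i + g' i) = comb q g + comb q g' := by
  induction q generalizing g g' with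
  | nil => rfl
  | cons c q ih =>
    simp only [comb, ih]
    ring

theorem comb_mul (q : List ℤ) (c : ℤ) (g : ℕ → ℤ) : comb q (fun i => c * g i) = c * comb q g := by
  induction q generalizing g with
  | nil => simp [comb]
  | cons d q ih =>
    simp only [comb, ih]
    ring

theorem comb_zero (q : List ℤ) : comb q (fun _ => 0) = 0 := by
  induction q with
  | nil => rfl
  | cons c q ih => simp [comb, ih]

theorem comb_list_sum {ι : Type} (q : List ℤ) (l : List ι) (g : ℕ → ι → ℕ) :
    comb q (fun i => ((l.map (g i)).sum : ℕ)) = (l.map fun x => comb q fun i => (g i x : ℤ)).sum := by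
  induction l with
  | nil => simpa using comb_zero q
  | cons x l ih =>
    simp only [List.map_cons, List.sum_cons, Nat.cast_add, comb_add, ih]

theorem comb_eq_sum (q : List ℤ) (g : ℕ → ℤ) :
    comb q g = ∑ i ∈ Finset.range q.length, q.getD i 0 * g i := by
  induction q generalizing g with
  | nil => simp [comb]
  | cons c q ih => simp [comb, ih, Finset.sum_range_succ', add_comm]

theorem comb_congr {q : List ℤ} {g g' : ℕ → ℤ} (h : ∀ i < q.length, g i = g' i) :
    comb q g = comb q g' := by
  rw [comb_eq_sum, comb_eq_sum]
  exact Finset.sum_congr rfl fun i hi => by rw [h i (Finset.mem_range.1 hi)]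

theorem abs_comb_le (q : List ℤ) (M : ℕ) (g : ℕ → ℕ) (hg : ∀ i < q.length, g i ≤ M) :
    |comb q fun i => (g i : ℤ)| ≤
      (((q.map Int.toNat).sum + (q.map fun c => (-c).toNat).sum) * M : ℕ) := by
  induction q generalizing g with
  | nil => simp [comb]
  | cons c q ih =>
    have h0 : g 0 ≤ M := hg 0 (by simp)
    have h1 := ih (fun i => g (i + 1)) fun i hi => hg (i + 1) (by simpa using hi)
    have h2 : |c * (g 0 : ℤ)| ≤ ((c.toNat + (-c).toNat) * M : ℕ) := by
      rw [abs_mul, Nat.abs_cast]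
      push_cast
      have : |c| = (c.toNat : ℤ) + ((-c).toNat : ℤ) := by
        rcases le_total 0 c with hc | hc
        · rw [abs_of_nonneg hc]; omega
        · rw [abs_of_nonpos hc]; omega
      rw [← this]
      exact mul_le_mul_of_nonneg_left (by exact_mod_cast h0) (abs_nonneg c)
    refine (abs_add_le _ _).trans ((add_le_add h2 h1).trans (le_of_eq ?_))
    simp only [List.map_cons, List.sum_cons]
    push_cast
    ring

/-- A linear relation between packed vectors holds for each entry. -/
theorem comb_eq_zero_of_pack {q : List ℤ} {M : ℕ}
    (hM : ((q.map Int.toNat).sum + (q.map fun c => (-c).toNat).sum) * M < 2 ^ bits)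
    (f : ℕ → List ℕ → ℕ) (l : List (List ℕ)) (hf : ∀ L ∈ l, ∀ i < q.length, f i L ≤ M)
    (h : comb q (fun i => (pack (f i) l : ℤ)) = 0) : ∀ L ∈ l, comb q (fun i => (f i L : ℤ)) = 0 := by
  induction l with
  | nil => simp
  | cons a l ih =>
    have h1 : comb q (fun i => (f i a : ℤ)) + (2 ^ bits : ℕ) * comb q (fun i => (pack (f i) l : ℤ)) =
        0 := by
      rw [← h, ← comb_mul, ← comb_add]
      exact comb_congr fun i _ => by rw [pack_cons]; push_cast; ring
    have ha : comb q (fun i => (f i a : ℤ)) = 0 := by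
      -- The lowest entry of the combination is divisible by the base but smaller than it in
      -- absolute value.
      refine Int.eq_zero_of_abs_lt_dvd (m := (2 ^ bits : ℕ))
        ⟨-comb q (fun i => (pack (f i) l : ℤ)), by linear_combination h1⟩ ?_
      exact (abs_comb_le q M (fun i => f i a) (hf a (by simp))).trans_lt (by exact_mod_cast hM)
    rw [ha, zero_add] at h1
    have h2 := (mul_eq_zero.1 h1).resolve_left (by exact_mod_cast (Nat.two_pow_pos bits).ne')
    intro L hL
    rcases List.mem_cons.1 hL with rfl | hL
    · exact ha
    · exact ih (fun L hL => hf L (by simp [hL])) h2 L hL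

/-- The calculation uses natural numbers only, so positive and negative parts of the coefficients
are kept on different sides of an equation. -/
theorem dot_iterates (prog : Cube (List Jump)) (F : Cube ℕ → ℕ) (q : List ℤ) (N : ℕ)
    (hN : q.length ≤ N) (x : Cube ℕ) :
    (dot F (q.map Int.toNat) (iterates prog N x) : ℤ) -
      dot F (q.map fun c => (-c).toNat) (iterates prog N x) =
      comb q fun i => (F ((advance prog)^[i] x) : ℤ) := by
  induction q generalizing N x with
  | nil => simp [dot, comb]
  | cons c q ih =>
    obtain ⟨N, rfl⟩ : ∃ N', N = N' + 1 := ⟨N - 1, by simp at hN; omega⟩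
    have h := ih N (by simpa using hN) (advance prog x)
    have h1 : ∀ (d : ℕ) (q : List ℕ), dot F (d :: q) (iterates prog (N + 1) x) =
        d * F x + dot F q (iterates prog N (advance prog x)) := fun d q => rfl
    simp only [List.map_cons, h1, comb]
    push_cast
    simp only [Function.iterate_succ_apply, Function.iterate_zero, id_eq]
    rw [← h]
    have : (c.toNat : ℤ) - ((-c).toNat : ℤ) = c := by omega
    linear_combination (F x : ℤ) * this

/-! ### From a checked table to the recurrence. -/

section Soundness

variable {k : ℕ} {secs : List Sector} {rows : Cube Row} {seeds : List Seed}

/-- The number of paths through the strip in a sector. -/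
def pathsOf (secs : List Sector) (s : ℕ) : ℕ := (entry ⟨0, [], []⟩ secs s).t

/-- The lanes of the row at a position. -/
noncomputable def lanesAt (secs : List Sector) (rows : Cube Row) (p : Pos) : List (List ℕ) :=
  lanesOf secs (rows.get p).s

/-- The vector at each position consists of the numbers of completions by `n` columns. -/
def Represents (k : ℕ) (secs : List Sector) (rows : Cube Row) (n : ℕ) (x : Cube ℕ) : Prop :=
  ∀ p, x.get p = pack (fun L => count k n L (rows.get p).R) (lanesAt secs rows p)

/-- The verified properties of a table. -/
structure Valid (k : ℕ) (secs : List Sector) (rows : Cube Row) (seeds : List Seed) : Prop where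
  lt : ∀ s, pathsOf secs s < 10
  lane : ∀ s, ∀ L ∈ lanesOf secs s, IsLane k (pathsOf secs s) L
  row : ∀ p, (rows.get p).R = [] ∨ IsRow k (pathsOf secs (rows.get p).s) (rows.get p).R
  next : ∀ p, nextOk secs rows (rows.get p).s (pathsOf secs (rows.get p).s)
    (stepRow (pathsOf secs (rows.get p).s) (rows.get p).R) (rows.get p).next = true
  seeds : seedsOk secs rows (idRows (k + 1)) seeds = true

theorem valid_of_tableOk (h : tableOk (k + 1) secs rows seeds = true) :
    Valid k secs rows seeds := by
  simp only [tableOk, Bool.and_eq_true, List.all_eq_true, Nat.blt_eq] at h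
  obtain ⟨⟨hs, hr⟩, hseeds⟩ := h
  have hr' := fun p => Cube.get_of_all hr p
  simp only [Row.ok, Bool.and_eq_true] at hr'
  refine ⟨fun s => ?_, fun s L hL => ?_, fun p => isRow_of_rowOk (hr' p).1, fun p => (hr' p).2,
    hseeds⟩
  · rcases entry_eq_or_mem (⟨0, [], []⟩ : Sector) secs s with h | h
    · rw [pathsOf, h]
      simp
    · exact (hs _ h).1
  · rcases entry_eq_or_mem (⟨0, [], []⟩ : Sector) secs s with h | h
    · rw [lanesOf, h] at hL
      simp at hL
    · exact isLane_of_laneOk ((hs _ h).2 L hL)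

namespace Valid

theorem count_succ (hv : Valid k secs rows seeds) (hk : 1 ≤ k) (n : ℕ) {p : Pos} {L : List ℕ}
    (hL : L ∈ lanesAt secs rows p) :
    count k (n + 1) L (rows.get p).R =
      ((stepRow (pathsOf secs (rows.get p).s) (rows.get p).R).map fun q =>
        count k n (after (pathsOf secs (rows.get p).s) q.2 L) q.1).sum :=
  count_step hk (hv.lt _) (hv.lane _ L hL) (hv.row p)

theorem exists_of_nextOk {s t : ℕ} :
    ∀ {qs : List (List ℕ × Option (ℕ × ℕ))} {js : List Jump},
      nextOk secs rows s t qs js = true → ∀ q ∈ qs, ∃ j, jumpOk secs rows s t q j = true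
  | [], _ => by simp
  | q :: qs, [] => by simp [nextOk]
  | q :: qs, j :: js => by
    intro h q' hq'
    rw [nextOk, Bool.and_eq_true] at h
    rcases List.mem_cons.1 hq' with rfl | hq'
    · exact ⟨j, h.1⟩
    · exact exists_of_nextOk h.2 q' hq'

/-- For both kinds of jumps the lanes after the step form a section of the lanes at the target;
`keep` is the case in which this section is everything. -/
theorem jumpOk_spec {s t : ℕ} {q : List ℕ × Option (ℕ × ℕ)} {j : Jump}
    (h : jumpOk secs rows s t q j = true) : ∃ p, (rows.get p).R = q.1 ∧
      ∃ off, ((lanesAt secs rows p).drop off).take (lanesOf secs s).length =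
          (lanesOf secs s).map (after t q.2) ∧
        (j = .keep p ∧ (lanesAt secs rows p) = (lanesOf secs s).map (after t q.2) ∨
          j = .cut p off (2 ^ (bits * off)) (2 ^ (bits * (lanesOf secs s).length))) := by
  obtain ⟨R, o⟩ := q
  cases j with
  | keep p =>
    cases o with
    | none =>
      simp only [jumpOk, Bool.and_eq_true, Nat.beq_eq, eqL_iff, true_and] at h
      have hmap : (lanesOf secs s).map (after t none) = lanesOf secs s := List.map_id _
      exact ⟨p, h.2, 0, by simp only [lanesAt, h.1, hmap, List.drop_zero, List.take_length],
        .inl ⟨rfl, by simp only [lanesAt, h.1, hmap]⟩⟩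
    | some c => simp [jumpOk] at h
  | cut p off d m =>
    cases o with
    | none => simp [jumpOk] at h
    | some c =>
      obtain ⟨a, b⟩ := c
      simp only [jumpOk, Bool.and_eq_true, Nat.beq_eq, eqL_iff, eqLL_iff] at h
      obtain ⟨⟨⟨h1, h2⟩, h3⟩, h4⟩ := h
      exact ⟨p, h1, off, h4, .inr (by rw [h2, h3])⟩

/-- The table is closed under steps: every continuation of a tabulated state is tabulated again. -/
theorem exists_next (hv : Valid k secs rows seeds) {p : Pos} {L : List ℕ}
    (hL : L ∈ lanesAt secs rows p) {q : List ℕ × Option (ℕ × ℕ)}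
    (hq : q ∈ stepRow (pathsOf secs (rows.get p).s) (rows.get p).R) :
    ∃ p', (rows.get p').R = q.1 ∧
      after (pathsOf secs (rows.get p).s) q.2 L ∈ lanesAt secs rows p' := by
  obtain ⟨j, hj⟩ := exists_of_nextOk (hv.next p) q hq
  obtain ⟨p', h1, off, h2, -⟩ := jumpOk_spec hj
  have : after (pathsOf secs (rows.get p).s) q.2 L ∈
      ((lanesAt secs rows p').drop off).take (lanesOf secs (rows.get p).s).length := by
    rw [h2]
    exact List.mem_map_of_mem hL
  exact ⟨p', h1, List.mem_of_mem_drop (List.mem_of_mem_take this)⟩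

theorem count_zero_eq (hv : Valid k secs rows seeds) {p : Pos} {L : List ℕ}
    (hL : L ∈ lanesAt secs rows p) :
    count k 0 L (rows.get p).R = startValue (k + 1) (rows.get p).R L := by
  have hlane := hv.lane _ L hL
  rcases hv.row p with h | h
  · rw [h, count_nil_zero]
    simp only [startValue]
    by_cases h0 : ∀ x ∈ L, x = 0
    · rw [if_pos h0, List.all_eq_true.2 fun x hx => by rw [h0 x hx]; rfl, cond_true]
    · have : ¬ L.all (Nat.beq 0) = true := fun h => h0 fun x hx => by
        have := List.all_eq_true.1 h x hx
        exact (Nat.beq_eq.mp this).symm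
      rw [if_neg h0, Bool.eq_false_iff.2 this, cond_false]
  · rw [count_zero hlane.length h.length (paired (hv.lt _) hlane h)]
    match hR : (rows.get p).R with
    | [] => simpa [hR] using h.length
    | a :: R =>
      simp only [startValue]
      cases closes (k + 1) L (a :: R) <;> rfl

theorem startValue_le (K : ℕ) (R L : List ℕ) : startValue K R L ≤ 1 := by
  unfold startValue
  split
  · cases L.all (Nat.beq 0) <;> simp
  · cases closes K L _ <;> simp

theorem length_stepRow_le (t : ℕ) (R : List ℕ) : (stepRow t R).length ≤ 2 := by
  match R with
  | [] => simp [stepRow]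
  | [a] => simp [stepRow]
  | a :: b :: R =>
    simp only [stepRow]
    split_ifs <;> simp

/-- A column offers at most two continuations, and without columns there is at most one completion.
The bound keeps each count within its digit. -/
theorem count_le (hv : Valid k secs rows seeds) (hk : 1 ≤ k) (n : ℕ) :
    ∀ {p : Pos} {L : List ℕ}, L ∈ lanesAt secs rows p → count k n L (rows.get p).R ≤ 2 ^ n := by
  induction n with
  | zero =>
    intro p L hL
    rw [hv.count_zero_eq hL]
    exact startValue_le _ _ _
  | succ n ih =>
    intro p L hL
    rw [hv.count_succ hk n hL]
    have := List.sum_le_card_nsmul ((stepRow (pathsOf secs (rows.get p).s) (rows.get p).R).map fun q =>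
        count k n (after (pathsOf secs (rows.get p).s) q.2 L) q.1) (2 ^ n) (fun x hx => by
      obtain ⟨q, hq, rfl⟩ := List.mem_map.1 hx
      obtain ⟨p', h1, h2⟩ := hv.exists_next hL hq
      rw [← h1]
      exact ih h2)
    rw [List.length_map, smul_eq_mul] at this
    refine this.trans ?_
    rw [Nat.pow_succ, Nat.mul_comm (2 ^ n)]
    exact Nat.mul_le_mul_right _ (length_stepRow_le _ _)

theorem count_lt (hv : Valid k secs rows seeds) (hk : 1 ≤ k) {n : ℕ} (hn : n < bits)
    {p : Pos} {L : List ℕ} (hL : L ∈ lanesAt secs rows p) :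
    count k n L (rows.get p).R < 2 ^ bits :=
  (hv.count_le hk n hL).trans_lt (Nat.pow_lt_pow_right (by omega) hn)

theorem represents_start (hv : Valid k secs rows seeds) :
    Represents k secs rows 0 (start (k + 1) secs rows) := fun p => by
  rw [start, Cube.get_map]
  exact pack_congr fun L hL => (hv.count_zero_eq hL).symm

theorem value_eq (hv : Valid k secs rows seeds) (hk : 1 ≤ k) {n : ℕ} (hn : n < bits) {x : Cube ℕ}
    (hx : Represents k secs rows n x) {s t : ℕ} {q : List ℕ × Option (ℕ × ℕ)} {j : Jump}
    (h : jumpOk secs rows s t q j = true) :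
    j.value x = pack (fun L => count k n (after t q.2 L) q.1) (lanesOf secs s) := by
  obtain ⟨p, h1, off, h2, ⟨rfl, h3⟩ | rfl⟩ := jumpOk_spec h
  · exact (hx p).trans (by rw [h3, pack_map, h1])
  · change x.get p / 2 ^ (bits * off) % 2 ^ (bits * (lanesOf secs s).length) = _
    rw [hx p, pack_drop _ (fun L hL => hv.count_lt hk hn hL),
      pack_take _ (fun L hL => hv.count_lt hk hn (List.mem_of_mem_drop hL)), h2, pack_map, h1]

theorem total_eq (hv : Valid k secs rows seeds) (hk : 1 ≤ k) {n : ℕ} (hn : n < bits) {x : Cube ℕ}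
    (hx : Represents k secs rows n x) {s t : ℕ} :
    ∀ {qs : List (List ℕ × Option (ℕ × ℕ))} {js : List Jump},
      nextOk secs rows s t qs js = true →
      total x js = pack (fun L => (qs.map fun q => count k n (after t q.2 L) q.1).sum)
        (lanesOf secs s)
  | [], [] => fun _ => (pack_zero _).symm
  | [], _ :: _ => by simp [nextOk]
  | _ :: _, [] => by simp [nextOk]
  | q :: qs, j :: js => by
    intro h
    rw [nextOk, Bool.and_eq_true] at h
    change j.value x + total x js = _
    rw [hv.value_eq hk hn hx h.1, total_eq hv hk hn hx h.2, ← pack_add]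
    exact pack_congr fun L _ => by rw [List.map_cons, List.sum_cons]

theorem represents_advance (hv : Valid k secs rows seeds) (hk : 1 ≤ k) {n : ℕ} (hn : n < bits)
    {x : Cube ℕ} (hx : Represents k secs rows n x) :
    Represents k secs rows (n + 1) (advance (rows.map Row.next) x) := fun p => by
  rw [advance, Cube.get_map, Cube.get_map, hv.total_eq hk hn hx (hv.next p)]
  exact pack_congr fun L hL => (hv.count_succ hk n hL).symm

theorem represents_iterate (hv : Valid k secs rows seeds) (hk : 1 ≤ k) {n i : ℕ} (hn : n + i ≤ bits)
    {x : Cube ℕ} (hx : Represents k secs rows n x) :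
    Represents k secs rows (n + i) ((advance (rows.map Row.next))^[i] x) := by
  induction i with
  | zero => exact hx
  | succ i ih =>
    rw [Function.iterate_succ_apply']
    exact hv.represents_advance hk (show n + i < bits by omega) (ih (by omega))

/-- A recurrence that holds for one start holds for all later ones. -/
theorem recurrence_of_le (hv : Valid k secs rows seeds) (hk : 1 ≤ k) {q : List ℤ} {m : ℕ}
    (h : ∀ p, ∀ L ∈ lanesAt secs rows p,
      comb q (fun i => (count k (m + i) L (rows.get p).R : ℤ)) = 0) (m' : ℕ) (hm : m ≤ m') :
    ∀ p, ∀ L ∈ lanesAt secs rows p,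
      comb q (fun i => (count k (m' + i) L (rows.get p).R : ℤ)) = 0 := by
  induction m', hm using Nat.le_induction with
  | base => exact h
  | succ m' _ ih =>
    intro p L hL
    have : ∀ i < q.length, (count k (m' + 1 + i) L (rows.get p).R : ℤ) =
        (((stepRow (pathsOf secs (rows.get p).s) (rows.get p).R).map fun q =>
          count k (m' + i) (after (pathsOf secs (rows.get p).s) q.2 L) q.1).sum : ℕ) := fun i _ => by
      rw [show m' + 1 + i = m' + i + 1 by omega, hv.count_succ hk _ hL]
    -- The continuations do not depend on the number of columns, so the combination starting one
    -- column later is a sum of combinations over the next states, each zero by induction.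
    rw [comb_congr this, comb_list_sum]
    refine List.sum_eq_zero fun z hz => ?_
    obtain ⟨c, hc, rfl⟩ := List.mem_map.1 hz
    obtain ⟨p', h1, h2⟩ := hv.exists_next hL hc
    rw [← h1]
    exact ih p' _ h2

/-- Each identity state is found both as a row and as a lane of that row's sector, so its count is a
single digit of a packed vector. -/
theorem seed_spec :
    ∀ {ls : List (List ℕ)} {ss : List Seed}, seedsOk secs rows ls ss = true →
      (∀ l ∈ ls, ∃ p, (rows.get p).R = l ∧ l ∈ lanesAt secs rows p) ∧
      ∀ x : Cube ℕ, ∀ n, Represents k secs rows n x →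
        (∀ p, ∀ L ∈ lanesAt secs rows p, count k n L (rows.get p).R < 2 ^ bits) →
        readOff ss x = (ls.map fun l => count k n l l).sum
  | [], [] => fun _ => ⟨by simp, fun _ _ _ _ => rfl⟩
  | [], _ :: _ => by simp [seedsOk]
  | _ :: _, [] => by simp [seedsOk]
  | l :: ls, s :: ss => by
    intro h
    simp only [seedsOk, Bool.and_eq_true, Nat.beq_eq, eqL_iff, eqLL_iff] at h
    obtain ⟨⟨⟨h1, h2⟩, h3⟩, h4⟩ := h
    obtain ⟨ih1, ih2⟩ := seed_spec h4
    constructor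
    · intro l' hl'
      rcases List.mem_cons.1 hl' with rfl | hl'
      · exact ⟨s.p, h1, List.mem_of_mem_drop (List.mem_of_mem_take (h3 ▸ List.mem_singleton_self _))⟩
      · exact ih1 l' hl'
    · intro x n hx hlt
      change x.get s.p / s.d % 2 ^ bits + readOff ss x = _
      have h5 : pack (fun L => count k n L (rows.get s.p).R) ((lanesAt secs rows s.p).drop s.off) %
          2 ^ (bits * 1) = _ := pack_take _ (fun L hL => hlt _ _ (List.mem_of_mem_drop hL)) 1
      rw [ih2 x n hx hlt, h2, hx s.p, pack_drop _ (hlt s.p), ← Nat.mul_one bits, h5, lanesAt, h3, h1]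
      rfl

end Valid

/-- The verified recurrence holds for the numbers of Hamiltonian cycles. -/
theorem recurrence_of_verify (hk : 1 ≤ k) {c : ℤ} {q : List ℤ}
    (h : verify (k + 1) (c :: q) secs rows seeds = true) (m : ℕ) (hm : 1 ≤ m) :
    comb (c :: q) (fun i => (GenPetersen.h k (m + i) : ℤ)) = 0 := by
  simp only [verify, vanishes, Bool.and_eq_true, Nat.blt_eq] at h
  obtain ⟨h1, h2, h3, h4⟩ := h
  have hv := valid_of_tableOk h1
  set prog := rows.map Row.next with hprog
  set x := advance prog (advance prog (start (k + 1) secs rows)) with hxdef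
  -- The overflow test also bounds the number of columns; the summand 1 in it makes its first factor
  -- positive.
  have hlen : (c :: q).length + 2 < bits := by
    have : 1 * 2 ^ ((c :: q).length + 2) < 2 ^ bits :=
      (Nat.mul_le_mul_right _ (Nat.le_add_left 1 _)).trans_lt h2
    rwa [one_mul, Nat.pow_lt_pow_iff_right (by omega)] at this
  have hx : Represents k secs rows 2 x :=
    hv.represents_iterate hk (n := 0) (i := 2) (by omega) hv.represents_start
  have hxi : ∀ i < (c :: q).length, Represents k secs rows (2 + i) ((advance prog)^[i] x) :=
    fun i hi => hv.represents_iterate hk (by omega) hx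
  have hrec : ∀ p, ∀ L ∈ lanesAt secs rows p,
      comb (c :: q) (fun i => (count k (2 + i) L (rows.get p).R : ℤ)) = 0 := by
    intro p
    refine comb_eq_zero_of_pack (M := 2 ^ ((c :: q).length + 2))
      (lt_of_le_of_lt (Nat.mul_le_mul_right _ (Nat.le_succ _)) h2)
      (fun i L => count k (2 + i) L (rows.get p).R) (lanesAt secs rows p) ?_ ?_
    · intro L hL i hi
      exact (hv.count_le hk _ hL).trans (Nat.pow_le_pow_right (by omega) (by omega))
    · have h5 := Cube.get_of_all h3 p
      rw [get_positions, Nat.beq_eq] at h5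
      have h6 := dot_iterates prog (fun x => x.get p) (c :: q) _ le_rfl x
      rw [h5, sub_self] at h6
      rw [h6]
      exact comb_congr fun i hi => by rw [hxi i hi p]
  obtain ⟨hseed, hread⟩ := Valid.seed_spec hv.seeds
  -- From m = 2 on all terms are sums of counts of identity states, and the recurrence holds for
  -- each such state.
  rcases hm.lt_or_eq with hm | rfl
  · have : ∀ i < (c :: q).length, (GenPetersen.h k (m + i) : ℤ) =
        (((idRows (k + 1)).map fun l => count k (m + i) l l).sum : ℕ) := fun i _ => by
      rw [h_eq_sum_count (by omega)]
    rw [comb_congr this, comb_list_sum]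
    refine List.sum_eq_zero fun z hz => ?_
    obtain ⟨l, hl, rfl⟩ := List.mem_map.1 hz
    obtain ⟨p, h5, h6⟩ := hseed l hl
    have := hv.recurrence_of_le hk hrec m hm p l h6
    rwa [h5] at this
  -- For m = 1 the constant coefficient multiplies h_k(1) = 1, and the remaining ones multiply
  -- values read off from the vectors for 2, 3, … columns. This is the separate equation in
  -- `vanishes`.
  · rw [Nat.beq_eq, List.map_cons, List.map_cons, List.headD_cons, List.headD_cons, List.tail_cons,
      List.tail_cons] at h4
    have h5 := dot_iterates prog (readOff seeds) q (c :: q).length (by simp) x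
    have h6 : comb q (fun i => (readOff seeds ((advance prog)^[i] x) : ℤ)) =
        comb q (fun i => (GenPetersen.h k (1 + (i + 1)) : ℤ)) := comb_congr fun i hi => by
      have hi' : i < (c :: q).length := by simp; omega
      rw [hread _ _ (hxi i hi') fun p L hL => hv.count_lt hk (by omega) hL,
        h_eq_sum_count (by omega), show 1 + (i + 1) = 2 + i by omega]
    rw [comb, ← h6, ← h5, add_zero, h_one, Nat.cast_one, mul_one]
    have h7 : (c.toNat : ℤ) - ((-c).toNat : ℤ) = c := by omega
    have h8 := congrArg (fun z : ℕ => (z : ℤ)) h4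
    push_cast at h8
    linear_combination h8 - h7

end Soundness

theorem recurrence_of_verified {k : ℕ} (hk : 1 ≤ k) {q : List ℤ} (hq : q ≠ [])
    {groups : List (List (List ℕ))} (h : verified (k + 1) q groups = true) (m : ℕ) (hm : 1 ≤ m) :
    ∑ i ∈ Finset.range q.length, q.getD i 0 * (GenPetersen.h k (m + i) : ℤ) = 0 := by
  obtain ⟨c, q, rfl⟩ := List.exists_cons_of_ne_nil hq
  rw [← comb_eq_sum (c :: q) fun i => (GenPetersen.h k (m + i) : ℤ)]
  exact recurrence_of_verify hk h m hm

/-- The finite calculation: with 4 terminals for k = 3, the table is built and checked, and P is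
found to annihilate the vectors that start with two columns. The next evaluation does the same with
5 terminals for k = 4 and Q. -/
theorem verified_three : verified 4 PCoeffs groupsThree = true := by decide +kernel

theorem verified_four : verified 5 QCoeffs groupsFour = true := by decide +kernel

/-! ### The coefficients of the polynomials -/

open Polynomial

/-- The polynomial with the given coefficients, from the constant term upwards. -/
noncomputable def ofCoeffs : List ℤ → ℤ[X]
  | [] => 0
  | a :: l => C a + X * ofCoeffs l

/-- The coefficients of a sum. -/
def addCoeffs : List ℤ → List ℤ → List ℤ
  | [], m => m
  | a :: l, m => match m with
    | [] => a :: l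
    | b :: m => (a + b) :: addCoeffs l m

/-- The coefficients of a product. -/
def mulCoeffs : List ℤ → List ℤ → List ℤ
  | [], _ => []
  | a :: l, m => addCoeffs (m.map (a * ·)) (0 :: mulCoeffs l m)

theorem ofCoeffs_add (l m : List ℤ) : ofCoeffs (addCoeffs l m) = ofCoeffs l + ofCoeffs m := by
  induction l generalizing m with
  | nil => simp [addCoeffs, ofCoeffs]
  | cons a l ih =>
    cases m with
    | nil => simp [addCoeffs, ofCoeffs]
    | cons b m =>
      simp only [addCoeffs, ofCoeffs, ih, C_add]
      ring

theorem ofCoeffs_map_mul (a : ℤ) (l : List ℤ) : ofCoeffs (l.map (a * ·)) = C a * ofCoeffs l := by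
  induction l with
  | nil => simp [ofCoeffs]
  | cons b l ih =>
    simp only [List.map_cons, ofCoeffs, ih, C_mul]
    ring

theorem ofCoeffs_mul (l m : List ℤ) : ofCoeffs (mulCoeffs l m) = ofCoeffs l * ofCoeffs m := by
  induction l with
  | nil => simp [mulCoeffs, ofCoeffs]
  | cons a l ih =>
    simp only [mulCoeffs, ofCoeffs_add, ofCoeffs_map_mul, ofCoeffs, ih, C_0]
    ring

theorem coeff_ofCoeffs (l : List ℤ) (i : ℕ) : (ofCoeffs l).coeff i = l.getD i 0 := by
  induction l generalizing i with
  | nil => simp [ofCoeffs]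
  | cons a l ih =>
    cases i with
    | zero => simp [ofCoeffs]
    | succ i => rw [ofCoeffs, coeff_add, coeff_C_succ, coeff_X_mul, ih, zero_add, List.getD_cons_succ]

theorem natDegree_ofCoeffs {l : List ℤ} {d : ℕ} (hl : l.length = d + 1) (hd : l.getD d 0 ≠ 0) :
    (ofCoeffs l).natDegree = d := by
  refine natDegree_eq_of_le_of_coeff_ne_zero (natDegree_le_iff_coeff_eq_zero.2 fun i hi => ?_)
    (by rwa [coeff_ofCoeffs])
  rw [coeff_ofCoeffs, List.getD_eq_default _ _ (by omega)]

theorem P_eq_ofCoeffs : P = ofCoeffs PCoeffs := by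
  have h1 : P1 = ofCoeffs [-1, 1] := by simp [P1, ofCoeffs]; ring
  have h2 : P2 = ofCoeffs [1, 1] := by simp [P2, ofCoeffs]; ring
  have h3 : P3 = ofCoeffs [1, 0, 1] := by simp [P3, ofCoeffs]; ring
  have h4 : P4 = ofCoeffs [1, -1, 1] := by simp [P4, ofCoeffs]; ring
  have h5 : P5 = ofCoeffs [1, 1, 1] := by simp [P5, ofCoeffs]; ring
  have h6 : P6 = ofCoeffs [1, 0, -1, 0, 1] := by simp [P6, ofCoeffs]; ring
  have h7 : P7 = ofCoeffs [-1, -1, 0, -1, 0, 0, 1] := by simp [P7, ofCoeffs]; ring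
  have h8 : P8 = ofCoeffs [-1, 0, -2, 0, -1, 0, 1, 0, -1, 0, 0, 0, -1, 0, 1] := by
    simp [P8, ofCoeffs]; ring
  rw [P, h1, h2, h3, h4, h5, h6, h7, h8, sq]
  simp only [← ofCoeffs_mul]
  exact congrArg ofCoeffs (by decide +kernel)

theorem Q_eq_ofCoeffs : Q = ofCoeffs QCoeffs := by
  have h1 : Q1 = ofCoeffs [-1, 1] := by simp [Q1, ofCoeffs]; ring
  have h2 : Q2 = ofCoeffs [1, 1] := by simp [Q2, ofCoeffs]; ring
  have h3 : Q3 = ofCoeffs [1, 0, 1] := by simp [Q3, ofCoeffs]; ring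
  have h4 : Q4 = ofCoeffs [1, 0, 0, 0, 1] := by simp [Q4, ofCoeffs]; ring
  have h5 : Q5 = ofCoeffs [1, -1, 1, -1, 1] := by simp [Q5, ofCoeffs]; ring
  have h7 : Q7 = ofCoeffs [1, 0, -1, 0, 1, 0, -1, 0, 1] := by simp [Q7, ofCoeffs]; ring
  have h8 : Q8 = ofCoeffs [-1, 1, -1, 0, -1, 0, 0, 0, 1] := by simp [Q8, ofCoeffs]; ring
  have h9 : Q9 = ofCoeffs [-1, -1, -1, 0, -1, 0, 0, 0, 1] := by simp [Q9, ofCoeffs]; ring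
  have h10 : Q10 = ofCoeffs [-1, 0, 1, 0, -1, 0, -2, 0, 1, 0, 1] := by simp [Q10, ofCoeffs]; ring
  have h11 : Q11 = ofCoeffs [-1, 1, -1, 1, -1, 1, -1, 2, -2, 1, -2, 2, -3, 3, -3, 3, -3, 2, -2, 1,
      -1, 1] := by simp [Q11, ofCoeffs]; ring
  have h12 : Q12 = ofCoeffs [1, 1, 0, -1, 1, 1, 2, 0, -1, -1, 3, 1, -1, 0, -2, -1, 0, 0, -2, 0, 0,
      0, 1] := by simp [Q12, ofCoeffs]; ring
  have h13 : Q13 = ofCoeffs [-1, 0, 0, 0, 0, -3, 0, 3, 0, 1, 0, 0, 8, 0, 3, 0, 0, 3, 0, 0, 1, 0, 0,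
      0, 0, -1, 0, 1, 0, -1, 0, 0, 0, 0, 1, 0, 0, 1] := by simp [Q13, ofCoeffs]; ring
  rw [Q, h1, h2, h3, h4, h5, h7, h8, h9, h10, h11, h12, h13, sq]
  simp only [← ofCoeffs_mul]
  exact congrArg ofCoeffs (by decide +kernel)

/-- A recurrence with the coefficients read from the constant term upwards and downwards. -/
theorem sum_reflect {p : ℤ[X]} {l : List ℤ} (hp : p = ofCoeffs l) {d : ℕ} (hl : l.length = d + 1)
    {f : ℕ → ℤ} {n : ℕ} (hn : d ≤ n)
    (h : ∑ i ∈ Finset.range l.length, l.getD i 0 * f (n - d + i) = 0) :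
    ∑ j ∈ Finset.range (d + 1), p.coeff (d - j) * f (n - j) = 0 := by
  rw [← h, hl, ← Finset.sum_range_reflect]
  refine Finset.sum_congr rfl fun i hi => ?_
  have hi := Finset.mem_range.1 hi
  rw [hp, coeff_ofCoeffs, show d - (d + 1 - 1 - i) = i by omega,
    show n - (d + 1 - 1 - i) = n - d + i by omega]

end GenPetersen

theorem theorem5p1 :
    (GenPetersen.P.natDegree = 38 ∧
      (∀ i : ℕ, GenPetersen.P.coeff i = GenPetersen.PCoeffs.getD i 0) ∧
      ∀ n : ℕ, 39 ≤ n →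
        ∑ j ∈ Finset.range 39,
          GenPetersen.P.coeff (38 - j) * (GenPetersen.h 3 (n - j) : ℤ) = 0) ∧
    (GenPetersen.Q.natDegree = 162 ∧
      (∀ i : ℕ, GenPetersen.Q.coeff i = GenPetersen.QCoeffs.getD i 0) ∧
      ∀ n : ℕ, 163 ≤ n →
        ∑ j ∈ Finset.range 163,
          GenPetersen.Q.coeff (162 - j) * (GenPetersen.h 4 (n - j) : ℤ) = 0) := by
  refine ⟨⟨?_, fun i => ?_, fun n hn => ?_⟩, ?_, fun i => ?_, fun n hn => ?_⟩
  · rw [GenPetersen.P_eq_ofCoeffs]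
    exact GenPetersen.natDegree_ofCoeffs (by decide +kernel) (by decide +kernel)
  · rw [GenPetersen.P_eq_ofCoeffs, GenPetersen.coeff_ofCoeffs]
  -- The smallest argument of h is n - 38, which is at least 1, as the recurrence requires.
  · exact GenPetersen.sum_reflect (d := 38) (f := fun n => (GenPetersen.h 3 n : ℤ))
      GenPetersen.P_eq_ofCoeffs (by decide +kernel) (by omega)
      (GenPetersen.recurrence_of_verified (k := 3) (by omega) (by simp [GenPetersen.PCoeffs])
        GenPetersen.verified_three _ (by omega))
  · rw [GenPetersen.Q_eq_ofCoeffs]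
    exact GenPetersen.natDegree_ofCoeffs (by decide +kernel) (by decide +kernel)
  · rw [GenPetersen.Q_eq_ofCoeffs, GenPetersen.coeff_ofCoeffs]
  · exact GenPetersen.sum_reflect (d := 162) (f := fun n => (GenPetersen.h 4 n : ℤ))
      GenPetersen.Q_eq_ofCoeffs (by decide +kernel) (by omega)
      (GenPetersen.recurrence_of_verified (k := 4) (by omega) (by simp [GenPetersen.QCoeffs])
        GenPetersen.verified_four _ (by omega))
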